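/- **Conventions.** All modules are $\mathbb{Z}/2$-graded. Let $R$ be a commutative ring containing $\mathbb{Q}$. A $\mathbb{Z}/2$-graded $L_\infty$-algebra over $R$ is a $\mathbb{Z}/2$-graded $R$-module $\mathfrak{g}$ with an odd $R$-linear coderivation $Q$ of the symmetric coalgebra $\operatorname{Sym}_R(\Pi\mathfrak{g})$ on the parity shift $\Pi\mathfrak{g}$ such that $Q(1)=0$ and $Q^2=0$; its differential $d_{\mathfrak{g}}$ is the linear part of $Q$, and $H^\bullet(\mathfrak{g},d_{\mathfrak{g}})=\ker d_{\mathfrak{g}}/\operatorname{im} d_{\mathfrak{g}}$. An $L_\infty$-morphism is an even morphism of counital coaugmented coalgebras commuting with the codifferentials; it is a quasi-isomorphism if its linear part induces an isomorphism on cohomology, and two $L_\infty$-algebras are $L_\infty$ quasi-isomorphic if they are joined by a finite chain of $L_\infty$-quasi-isomorphisms pointing in either direction. A differential $\mathbb{Z}/2$-graded Lie algebra is regarded as an $L_\infty$-algebra in the usual way (linear part $d$, quadratic part $\pm[\cdot,\cdot]$, no higher parts); it is abelian if its bracket is zero. A differential $\mathbb{Z}/2$-graded Lie algebra, or an $L_\infty$-algebra,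 is *homotopy abelian* over $R$ if it is $L_\infty$ quasi-isomorphic over $R$ to an abelian differential $\mathbb{Z}/2$-graded Lie algebra over $R$. **Proposition.** (i) Let $\mathfrak{g}$ be a flat family of differential $\mathbb{Z}/2$-graded Lie algebras (respectively, of $\mathbb{Z}/2$-graded $L_\infty$-algebras) over $\mathbb{C}[[u]]$, that is, such an algebra over the ring $\mathbb{C}[[u]]$, with $\mathbb{C}[[u]]$-linear operations, whose underlying $\mathbb{C}[[u]]$-module is flat. Assume that (A) $\mathfrak{g}\otimes_{\mathbb{C}[[u]]}\mathbb{C}((u))$ is homotopy abelian over $\mathbb{C}((u))$, and (B) $H^\bullet(\mathfrak{g},d_{\mathfrak{g}})$ is a flat $\mathbb{C}[[u]]$-module. Then the special fibre $\mathfrak{g}_0=\mathfrak{g}\otimes_{\mathbb{C}[[u]]}\mathbb{C}=\mathfrak{g}/u\mathfrak{g}$ is a homotopy abelian differential $\mathbb{Z}/2$-graded Lie algebra (respectively, $L_\infty$-algebra) over $\mathbb{C}$. (ii) Let $\mathfrak{g}$ be a homotopy abelian $\mathbb{Z}/2$-graded $L_\infty$-algebra (for example, a differential $\mathbb{Z}/2$-graded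 Lie algebra) over $\mathbb{C}$, let $\mathfrak{g}_1$ be a $\mathbb{Z}/2$-graded $L_\infty$-algebra over $\mathbb{C}$, and let $\mathfrak{g}_1\to\mathfrak{g}$ be an $L_\infty$-morphism such that the induced map $H^\bullet(\mathfrak{g}_1,d_{\mathfrak{g}_1})\to H^\bullet(\mathfrak{g},d_{\mathfrak{g}})$ is injective. Then $\mathfrak{g}_1$ is homotopy abelian. (iii) Let $\mathfrak{g}$ be a homotopy abelian $\mathbb{Z}/2$-graded $L_\infty$-algebra (for example, a differential $\mathbb{Z}/2$-graded Lie algebra) over $\mathbb{C}$, let $\mathfrak{g}_2$ be a $\mathbb{Z}/2$-graded $L_\infty$-algebra over $\mathbb{C}$, and let $\mathfrak{g}\to\mathfrak{g}_2$ be an $L_\infty$-morphism such that the induced map $H^\bullet(\mathfrak{g},d_{\mathfrak{g}})\to H^\bullet(\mathfrak{g}_2,d_{\mathfrak{g}_2})$ is surjective. Then $\mathfrak{g}_2$ is homotopy abelian. -/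

import Mathlib

open scoped TensorProduct

universe u v w

noncomputable section

section SuperSymmetric

variable (R : Type u) [CommRing R]
variable (V₀ V₁ : Type v) [AddCommGroup V₀] [Module R V₀] [AddCommGroup V₁] [Module R V₁]

/-- The relations of the super-symmetric algebra of `V = V₀ ⊕ V₁`: even vectors commute with all
vectors, odd vectors anticommute with each other. -/
inductive SSym.Rel : TensorAlgebra R (V₀ × V₁) → TensorAlgebra R (V₀ × V₁) → Prop
  | even (a : V₀) (v : V₀ × V₁) :
      Rel (TensorAlgebra.ι R (a, 0) * TensorAlgebra.ι R v)
        (TensorAlgebra.ι R v * TensorAlgebra.ι R (a, 0))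
  | odd (b c : V₁) :
      Rel (TensorAlgebra.ι R (0, b) * TensorAlgebra.ι R (0, c))
        (-(TensorAlgebra.ι R (0, c) * TensorAlgebra.ι R (0, b)))

/-- The super-symmetric algebra `Sym (V₀ ⊕ V₁)` of the super module with even part `V₀` and odd
part `V₁`. -/
def SSym : Type (max u v) := RingQuot (SSym.Rel R V₀ V₁)

end SuperSymmetric

namespace SSym

instance instRing (R : Type u) [CommRing R] (V₀ V₁ : Type v) [AddCommGroup V₀] [Module R V₀]
    [AddCommGroup V₁] [Module R V₁] : Ring (SSym R V₀ V₁) :=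
  inferInstanceAs (Ring (RingQuot (SSym.Rel R V₀ V₁)))

instance instAlgebra' {A : Type w} [CommRing A] (R : Type u) [CommRing R] [Algebra A R]
    (V₀ V₁ : Type v) [AddCommGroup V₀] [Module R V₀] [AddCommGroup V₁] [Module R V₁]
    [Module A V₀] [Module A V₁] [IsScalarTower A R V₀] [IsScalarTower A R V₁] :
    Algebra A (SSym R V₀ V₁) :=
  inferInstanceAs (Algebra A (RingQuot (SSym.Rel R V₀ V₁)))

instance instAlgebra (R : Type u) [CommRing R] (V₀ V₁ : Type v) [AddCommGroup V₀] [Module R V₀]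
    [AddCommGroup V₁] [Module R V₁] : Algebra R (SSym R V₀ V₁) :=
  inferInstance

instance instIsScalarTower {A : Type w} [CommRing A] (R : Type u) [CommRing R] [Algebra A R]
    (V₀ V₁ : Type v) [AddCommGroup V₀] [Module R V₀] [AddCommGroup V₁] [Module R V₁]
    [Module A V₀] [Module A V₁] [IsScalarTower A R V₀] [IsScalarTower A R V₁] :
    IsScalarTower A R (SSym R V₀ V₁) :=
  inferInstanceAs (IsScalarTower A R (RingQuot (SSym.Rel R V₀ V₁)))

variable {R : Type u} [CommRing R]
variable {V₀ V₁ : Type v} [AddCommGroup V₀] [Module R V₀] [AddCommGroup V₁] [Module R V₁]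

variable (R V₀ V₁) in
/-- The inclusion of the generators. -/
def ι : V₀ × V₁ →ₗ[R] SSym R V₀ V₁ :=
  (RingQuot.mkAlgHom R (SSym.Rel R V₀ V₁)).toLinearMap.comp (TensorAlgebra.ι R)

theorem ι_even_mul (a : V₀) (v : V₀ × V₁) :
    ι R V₀ V₁ (a, 0) * ι R V₀ V₁ v = ι R V₀ V₁ v * ι R V₀ V₁ (a, 0) := by
  have h := RingQuot.mkAlgHom_rel R (SSym.Rel.even (R := R) a v)
  rw [map_mul, map_mul] at h
  exact h

theorem ι_odd_mul (b c : V₁) :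
    ι R V₀ V₁ (0, b) * ι R V₀ V₁ (0, c) = -(ι R V₀ V₁ (0, c) * ι R V₀ V₁ (0, b)) := by
  have h := RingQuot.mkAlgHom_rel R (SSym.Rel.odd (R := R) (V₀ := V₀) b c)
  rw [map_neg, map_mul, map_mul] at h
  exact h

section lift

variable {A : Type w} [Ring A] [Algebra R A]

/-- The universal property of the super-symmetric algebra. -/
def lift (f : V₀ × V₁ →ₗ[R] A) (h₀ : ∀ a v, f (a, 0) * f v = f v * f (a, 0))
    (h₁ : ∀ b c, f (0, b) * f (0, c) = -(f (0, c) * f (0, b))) : SSym R V₀ V₁ →ₐ[R] A :=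
  RingQuot.liftAlgHom R ⟨TensorAlgebra.lift R f, by
    intro x y h
    induction h with
    | even a v => simpa using h₀ a v
    | odd b c => simpa using h₁ b c⟩

@[simp]
theorem lift_ι (f : V₀ × V₁ →ₗ[R] A) (h₀ h₁) (v : V₀ × V₁) :
    lift f h₀ h₁ (ι R V₀ V₁ v) = f v := by
  have h := RingQuot.liftAlgHom_mkAlgHom_apply (S := R) (s := SSym.Rel R V₀ V₁)
    (TensorAlgebra.lift R f) (by
      intro x y h
      induction h with
      | even a v => simpa using h₀ a v
      | odd b c => simpa using h₁ b c) (TensorAlgebra.ι R v)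
  rw [TensorAlgebra.lift_ι_apply] at h
  exact h

theorem algHom_ext {f g : SSym R V₀ V₁ →ₐ[R] A}
    (h : ∀ v, f (ι R V₀ V₁ v) = g (ι R V₀ V₁ v)) : f = g := by
  apply RingQuot.ringQuot_ext'
  apply TensorAlgebra.hom_ext
  ext v <;> exact h _

end lift

/-- Induction on words. -/
theorem induction_left {P : SSym R V₀ V₁ → Prop} (one : P 1)
    (add : ∀ x y, P x → P y → P (x + y)) (smul : ∀ (r : R) x, P x → P (r • x))
    (mul : ∀ v x, P x → P (ι R V₀ V₁ v * x)) (x : SSym R V₀ V₁) : P x := by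
  obtain ⟨t, rfl⟩ := RingQuot.mkAlgHom_surjective R (SSym.Rel R V₀ V₁) x
  let m : TensorAlgebra R (V₀ × V₁) →ₐ[R] SSym R V₀ V₁ := RingQuot.mkAlgHom R (SSym.Rel R V₀ V₁)
  change P (m t)
  suffices h : ∀ t y, P y → P (m t * y) by
    simpa using h t 1 one
  intro t
  induction t using TensorAlgebra.induction with
  | algebraMap r =>
    intro y hy
    rw [AlgHom.commutes, ← Algebra.smul_def]
    exact smul r y hy
  | ι v =>
    intro y hy
    exact mul v y hy
  | mul a b ha hb => intro y hy; rw [map_mul, mul_assoc]; exact ha _ (hb _ hy)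
  | add a b ha hb => intro y hy; rw [map_add, add_mul]; exact add _ _ (ha _ hy) (hb _ hy)

/-- Two linear maps that satisfy the same recursion on words are equal. -/
theorem linearMap_ext {N : Type w} [AddCommGroup N] [Module R N] {f g : SSym R V₀ V₁ →ₗ[R] N}
    (one : f 1 = g 1)
    (mul : ∀ v x, f x = g x → f (ι R V₀ V₁ v * x) = g (ι R V₀ V₁ v * x)) : f = g := by
  ext x
  induction x using induction_left with
  | one => exact one
  | add x y hx hy => rw [map_add, map_add, hx, hy]
  | smul r x hx => rw [map_smul, map_smul, hx]
  | mul v x hx => exact mul v x hx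

variable (R V₀ V₁) in
/-- The parity involution `v₀ + v₁ ↦ v₀ - v₁` of `V`. -/
def inv : V₀ × V₁ →ₗ[R] V₀ × V₁ := LinearMap.prodMap LinearMap.id (-LinearMap.id)

@[simp] theorem inv_apply (v : V₀ × V₁) : inv R V₀ V₁ v = (v.1, -v.2) := rfl

variable (R V₀ V₁) in
/-- The parity involution of `Sym V`: it is `1` on even and `-1` on odd elements. -/
def parity : SSym R V₀ V₁ →ₐ[R] SSym R V₀ V₁ :=
  lift ((ι R V₀ V₁).comp (inv R V₀ V₁))
    (by
      intro a v
      simpa using ι_even_mul (R := R) a (v.1, -v.2))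
    (by
      intro b c
      simpa using ι_odd_mul (R := R) (V₀ := V₀) (-b) (-c))

@[simp] theorem parity_ι (v : V₀ × V₁) :
    parity R V₀ V₁ (ι R V₀ V₁ v) = ι R V₀ V₁ (v.1, -v.2) := by
  simp [parity]

@[simp] theorem parity_parity (x : SSym R V₀ V₁) :
    parity R V₀ V₁ (parity R V₀ V₁ x) = x := by
  have h : (parity R V₀ V₁).comp (parity R V₀ V₁) = AlgHom.id R _ := by
    apply algHom_ext
    intro v
    simp
  exact DFunLike.congr_fun h x

variable (R V₀ V₁) in
/-- The counit of `Sym V`: the projection to the words of length zero. -/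
def counit : SSym R V₀ V₁ →ₐ[R] R := lift 0 (by simp) (by simp)

@[simp] theorem counit_ι (v : V₀ × V₁) : counit R V₀ V₁ (ι R V₀ V₁ v) = 0 := by
  simp [counit]

variable (R V₀ V₁) in
/-- The operator `Δ(v) · -` on `Sym V ⊗ Sym V`, where `Δ(v) = v ⊗ 1 + 1 ⊗ v` and the product of
`Sym V ⊗ Sym V` obeys the sign rule `(1 ⊗ v) (x ⊗ y) = (-1) ^ (|v| |x|) x ⊗ v y`. -/
def comulGen : V₀ × V₁ →ₗ[R] Module.End R (SSym R V₀ V₁ ⊗[R] SSym R V₀ V₁) where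
  toFun v :=
    TensorProduct.map (LinearMap.mulLeft R (ι R V₀ V₁ v)) LinearMap.id +
    TensorProduct.map LinearMap.id (LinearMap.mulLeft R (ι R V₀ V₁ (v.1, 0))) +
    TensorProduct.map (parity R V₀ V₁).toLinearMap (LinearMap.mulLeft R (ι R V₀ V₁ (0, v.2)))
  map_add' v w := by
    have h₀ : ((v + w).1, (0 : V₁)) = (v.1, 0) + (w.1, 0) := by simp
    have h₁ : ((0 : V₀), (v + w).2) = (0, v.2) + (0, w.2) := by simp
    apply TensorProduct.ext'
    intro x y
    rw [h₀, h₁]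
    simp only [map_add, LinearMap.add_apply, TensorProduct.map_tmul, LinearMap.mulLeft_apply,
      add_mul, TensorProduct.tmul_add, TensorProduct.add_tmul, LinearMap.id_apply]
    abel
  map_smul' r v := by
    have h₀ : ((r • v).1, (0 : V₁)) = r • (v.1, 0) := by simp
    have h₁ : ((0 : V₀), (r • v).2) = r • (0, v.2) := by simp
    apply TensorProduct.ext'
    intro x y
    rw [h₀, h₁]
    simp only [map_smul, LinearMap.add_apply, TensorProduct.map_tmul, LinearMap.mulLeft_apply,
      smul_mul_assoc, TensorProduct.tmul_smul, TensorProduct.smul_tmul', LinearMap.id_apply,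
      LinearMap.smul_apply, smul_add, RingHom.id_apply]

theorem comulGen_tmul (v : V₀ × V₁) (x y : SSym R V₀ V₁) :
    comulGen R V₀ V₁ v (x ⊗ₜ y) = (ι R V₀ V₁ v * x) ⊗ₜ y + x ⊗ₜ (ι R V₀ V₁ (v.1, 0) * y) +
      parity R V₀ V₁ x ⊗ₜ (ι R V₀ V₁ (0, v.2) * y) := rfl

variable (R V₀ V₁) in
/-- The left multiplication by `Δ(x)` on `Sym V ⊗ Sym V`. -/
def comulMul : SSym R V₀ V₁ →ₐ[R] Module.End R (SSym R V₀ V₁ ⊗[R] SSym R V₀ V₁) :=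
  lift (comulGen R V₀ V₁)
    (by
      intro a v
      apply TensorProduct.ext'
      intro x y
      have h0 : ι R V₀ V₁ ((0 : V₀), (0 : V₁)) = 0 := map_zero _
      have e1 := fun z => congrArg (· * z) (ι_even_mul (R := R) a v)
      have e2 := fun z => congrArg (· * z) (ι_even_mul (R := R) a (v.1, (0 : V₁)))
      have e3 := fun z => congrArg (· * z) (ι_even_mul (R := R) a ((0 : V₀), v.2))
      simp only [mul_assoc] at e1 e2 e3
      simp only [Module.End.mul_apply, comulGen_tmul, map_add, h0, zero_mul, TensorProduct.tmul_zero,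
        add_zero, map_mul, parity_ι, neg_zero, e1, e2, e3]
      abel)
    (by
      intro b c
      apply TensorProduct.ext'
      intro x y
      have h0 : ι R V₀ V₁ ((0 : V₀), (0 : V₁)) = 0 := map_zero _
      have hn : ∀ d : V₁, ι R V₀ V₁ ((0 : V₀), -d) = -ι R V₀ V₁ (0, d) := by
        intro d
        rw [← map_neg]
        simp
      have e1 := fun z => congrArg (· * z) (ι_odd_mul (R := R) (V₀ := V₀) b c)
      simp only [mul_assoc, neg_mul] at e1
      simp only [Module.End.mul_apply, comulGen_tmul, map_add, h0, zero_mul, TensorProduct.tmul_zero,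
        add_zero, map_mul, parity_ι, hn, e1, LinearMap.neg_apply, parity_parity, neg_mul,
        TensorProduct.neg_tmul, TensorProduct.tmul_neg]
      abel)

variable (R V₀ V₁) in
/-- The comultiplication of the symmetric coalgebra `Sym V`: the map
`v₁ ⋯ vₙ ↦ Δ(v₁) ⋯ Δ(vₙ)` with `Δ(v) = v ⊗ 1 + 1 ⊗ v`, that is, the sum of
`± v_I ⊗ v_J` over all `I ⊔ J = {1, …, n}` with the Koszul signs. -/
def comul : SSym R V₀ V₁ →ₗ[R] SSym R V₀ V₁ ⊗[R] SSym R V₀ V₁ :=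
  (LinearMap.applyₗ (1 ⊗ₜ 1)).comp (comulMul R V₀ V₁).toLinearMap

@[simp] theorem comul_one : comul R V₀ V₁ 1 = 1 ⊗ₜ 1 := by
  simp [comul]

theorem comul_ι_mul (v : V₀ × V₁) (x : SSym R V₀ V₁) :
    comul R V₀ V₁ (ι R V₀ V₁ v * x) = comulGen R V₀ V₁ v (comul R V₀ V₁ x) := by
  simp [comul, comulMul]

variable (R V₀ V₁) in
/-- The projection of `Sym V` onto the words of length one. -/
def proj : SSym R V₀ V₁ →ₗ[R] V₀ × V₁ :=
  letI : Module Rᵐᵒᵖ (V₀ × V₁) := Module.compHom _ ((RingHom.id R).fromOpposite mul_comm)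
  haveI : IsCentralScalar R (V₀ × V₁) := ⟨fun _ _ => rfl⟩
  (TrivSqZeroExt.sndHom R (V₀ × V₁)).comp
    (lift (TrivSqZeroExt.inrHom R (V₀ × V₁)) (by simp) (by simp)).toLinearMap

@[simp] theorem proj_one : proj R V₀ V₁ 1 = 0 := by
  let : Module Rᵐᵒᵖ (V₀ × V₁) := Module.compHom _ ((RingHom.id R).fromOpposite mul_comm)
  have : IsCentralScalar R (V₀ × V₁) := ⟨fun _ _ => rfl⟩
  have h := map_one (lift (R := R) (TrivSqZeroExt.inrHom R (V₀ × V₁)) (by simp) (by simp))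
  exact congrArg TrivSqZeroExt.snd h

theorem proj_ι_mul (v : V₀ × V₁) (x : SSym R V₀ V₁) :
    proj R V₀ V₁ (ι R V₀ V₁ v * x) = counit R V₀ V₁ x • v := by
  let : Module Rᵐᵒᵖ (V₀ × V₁) := Module.compHom _ ((RingHom.id R).fromOpposite mul_comm)
  have : IsCentralScalar R (V₀ × V₁) := ⟨fun _ _ => rfl⟩
  have h : (TrivSqZeroExt.fstHom R R (V₀ × V₁)).comp
      (lift (TrivSqZeroExt.inrHom R (V₀ × V₁)) (by simp) (by simp)) = counit R V₀ V₁ := by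
    apply algHom_ext
    intro v
    simp
  rw [← h]
  simp [proj]

@[simp] theorem proj_ι (v : V₀ × V₁) : proj R V₀ V₁ (ι R V₀ V₁ v) = v := by
  have h := proj_ι_mul (R := R) v 1
  simpa using h

end SSym

namespace SSym

variable {R : Type u} [CommRing R]
variable {V₀ V₁ : Type v} [AddCommGroup V₀] [Module R V₀] [AddCommGroup V₁] [Module R V₁]

theorem comul_ι (v : V₀ × V₁) :
    comul R V₀ V₁ (ι R V₀ V₁ v) = ι R V₀ V₁ v ⊗ₜ 1 + 1 ⊗ₜ ι R V₀ V₁ v := by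
  have h := comul_ι_mul (R := R) v 1
  have hv : ι R V₀ V₁ v = ι R V₀ V₁ (v.1, 0) + ι R V₀ V₁ (0, v.2) := by
    rw [← map_add]
    simp
  rw [mul_one, comul_one, comulGen_tmul, mul_one, mul_one, mul_one, map_one, add_assoc,
    ← TensorProduct.tmul_add, ← hv] at h
  exact h

@[simp] theorem counit_parity (x : SSym R V₀ V₁) :
    counit R V₀ V₁ (parity R V₀ V₁ x) = counit R V₀ V₁ x := by
  have h : (counit R V₀ V₁).comp (parity R V₀ V₁) = counit R V₀ V₁ := by
    apply algHom_ext
    intro v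
    simp
  exact DFunLike.congr_fun h x

theorem proj_parity (x : SSym R V₀ V₁) :
    proj R V₀ V₁ (parity R V₀ V₁ x) = inv R V₀ V₁ (proj R V₀ V₁ x) := by
  have h : (proj R V₀ V₁).comp (parity R V₀ V₁).toLinearMap =
      (inv R V₀ V₁).comp (proj R V₀ V₁) := by
    apply linearMap_ext
    · simp only [LinearMap.comp_apply, AlgHom.toLinearMap_apply, map_one, proj_one, map_zero]
    · intro v x _
      simp only [LinearMap.comp_apply, AlgHom.toLinearMap_apply, map_mul, parity_ι, proj_ι_mul,
        counit_parity, map_smul, inv_apply]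
  exact LinearMap.congr_fun h x

variable (R V₀ V₁) in
/-- Contraction of the left factor with the counit. -/
def counitLeft : SSym R V₀ V₁ ⊗[R] SSym R V₀ V₁ →ₗ[R] SSym R V₀ V₁ :=
  (TensorProduct.lid R _).toLinearMap.comp
    (TensorProduct.map (counit R V₀ V₁).toLinearMap LinearMap.id)

variable (R V₀ V₁) in
/-- The map `x ⊗ y ↦ (projection of x to V) · y`. -/
def projMul : SSym R V₀ V₁ ⊗[R] SSym R V₀ V₁ →ₗ[R] SSym R V₀ V₁ :=
  (LinearMap.mul' R _).comp
    (TensorProduct.map ((ι R V₀ V₁).comp (proj R V₀ V₁)) LinearMap.id)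

theorem ι_split (v : V₀ × V₁) :
    ι R V₀ V₁ v = ι R V₀ V₁ (v.1, 0) + ι R V₀ V₁ (0, v.2) := by
  rw [← map_add]
  simp

theorem counitLeft_comulGen (v : V₀ × V₁) (t : SSym R V₀ V₁ ⊗[R] SSym R V₀ V₁) :
    counitLeft R V₀ V₁ (comulGen R V₀ V₁ v t) = ι R V₀ V₁ v * counitLeft R V₀ V₁ t := by
  induction t with
  | zero => simp
  | add a b ha hb => rw [map_add, map_add, ha, hb, map_add, mul_add]
  | tmul x y =>
    rw [comulGen_tmul, ι_split v]
    simp [counitLeft, add_mul]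

theorem counitLeft_comul (x : SSym R V₀ V₁) :
    counitLeft R V₀ V₁ (comul R V₀ V₁ x) = x := by
  have h : (counitLeft R V₀ V₁).comp (comul R V₀ V₁) = LinearMap.id := by
    apply linearMap_ext
    · simp [counitLeft]
    · intro v x hx
      simp only [LinearMap.comp_apply, LinearMap.id_apply] at hx ⊢
      rw [comul_ι_mul, counitLeft_comulGen, hx]
  exact LinearMap.congr_fun h x

theorem ι_mul_odd (p : V₀ × V₁) (c : V₁) :
    ι R V₀ V₁ (p.1, -p.2) * ι R V₀ V₁ (0, c) = ι R V₀ V₁ (0, c) * ι R V₀ V₁ p := by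
  rw [ι_split p, ι_split (p.1, -p.2), add_mul, mul_add, ι_even_mul]
  have hn : ι R V₀ V₁ ((0 : V₀), -p.2) = -ι R V₀ V₁ (0, p.2) := by
    rw [← map_neg]
    simp
  simp only [hn, neg_mul]
  rw [ι_odd_mul p.2 c, neg_neg]

theorem projMul_comulGen (v : V₀ × V₁) (t : SSym R V₀ V₁ ⊗[R] SSym R V₀ V₁) :
    projMul R V₀ V₁ (comulGen R V₀ V₁ v t) =
      ι R V₀ V₁ v * counitLeft R V₀ V₁ t + ι R V₀ V₁ v * projMul R V₀ V₁ t := by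
  induction t with
  | zero => simp
  | add a b ha hb =>
    rw [map_add, map_add, ha, hb, map_add, map_add, mul_add, mul_add]
    abel
  | tmul x y =>
    have h1 := ι_even_mul (R := R) v.1 (proj R V₀ V₁ x)
    have h2 := ι_mul_odd (R := R) (proj R V₀ V₁ x) v.2
    rw [comulGen_tmul, map_add, map_add]
    simp only [projMul, counitLeft, LinearMap.comp_apply, TensorProduct.map_tmul,
      LinearMap.id_apply, LinearMap.mul'_apply, proj_ι_mul, proj_parity, inv_apply,
      LinearEquiv.coe_coe, TensorProduct.lid_tmul, AlgHom.toLinearMap_apply, map_smul]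
    rw [← mul_assoc, ← mul_assoc, h2, ← h1, add_assoc, ← add_mul, ← add_mul, ← add_mul,
      ← ι_split, add_mul, mul_assoc, smul_mul_assoc, mul_smul_comm]

variable (R V₀ V₁) in
/-- The word length grading, as the map sending a word `w` of length `n` to `w Xⁿ`. -/
def weight : SSym R V₀ V₁ →ₐ[R] Polynomial (SSym R V₀ V₁) :=
  lift (((Polynomial.monomial 1).restrictScalars R).comp (ι R V₀ V₁))
    (by
      intro a v
      simp [Polynomial.monomial_mul_monomial, ι_even_mul a v])
    (by
      intro b c
      simp [Polynomial.monomial_mul_monomial, ι_odd_mul b c])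

theorem weight_ι (v : V₀ × V₁) :
    weight R V₀ V₁ (ι R V₀ V₁ v) = Polynomial.monomial 1 (ι R V₀ V₁ v) := by
  simp [weight]

theorem coeff_weight_ι_mul_zero (v : V₀ × V₁) (x : SSym R V₀ V₁) :
    (weight R V₀ V₁ (ι R V₀ V₁ v * x)).coeff 0 = 0 := by
  rw [map_mul, weight_ι, Polynomial.mul_coeff_zero, Polynomial.coeff_monomial]
  simp

theorem coeff_weight_ι_mul_succ (v : V₀ × V₁) (x : SSym R V₀ V₁) (n : ℕ) :
    (weight R V₀ V₁ (ι R V₀ V₁ v * x)).coeff (n + 1) =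
      ι R V₀ V₁ v * (weight R V₀ V₁ x).coeff n := by
  rw [map_mul, weight_ι, Polynomial.coeff_monomial_mul]

/-- The sum of the homogeneous components of `x` is `x`. -/
theorem sum_weight (x : SSym R V₀ V₁) :
    Polynomial.lsum (fun _ => (LinearMap.id : SSym R V₀ V₁ →ₗ[R] SSym R V₀ V₁))
      (weight R V₀ V₁ x) = x := by
  have key : ∀ (a : SSym R V₀ V₁) (p : Polynomial (SSym R V₀ V₁)),
      Polynomial.lsum (fun _ => (LinearMap.id : SSym R V₀ V₁ →ₗ[R] SSym R V₀ V₁))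
        (Polynomial.monomial 1 a * p) =
      a * Polynomial.lsum (fun _ => (LinearMap.id : SSym R V₀ V₁ →ₗ[R] SSym R V₀ V₁)) p := by
    intro a p
    induction p using Polynomial.induction_on' with
    | add p q hp hq => rw [mul_add, map_add, hp, hq, map_add, mul_add]
    | monomial n b =>
      rw [Polynomial.monomial_mul_monomial]
      simp [Polynomial.lsum_apply, Polynomial.sum_monomial_index]
  induction x using induction_left with
  | one =>
    rw [map_one, ← Polynomial.monomial_zero_one, Polynomial.lsum_apply,
      Polynomial.sum_monomial_index _ _ rfl]
    rfl
  | add x y hx hy => rw [map_add, map_add, hx, hy]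
  | smul r x hx => rw [map_smul, map_smul, hx]
  | mul v x hx => rw [map_mul, weight_ι, key, hx]

theorem coeff_weight_euler (x : SSym R V₀ V₁) (n : ℕ) :
    (weight R V₀ V₁ (projMul R V₀ V₁ (comul R V₀ V₁ x))).coeff n =
      n • (weight R V₀ V₁ x).coeff n := by
  induction x using induction_left generalizing n with
  | one =>
    rw [comul_one]
    simp only [projMul, LinearMap.comp_apply, TensorProduct.map_tmul, proj_one, map_zero,
      TensorProduct.zero_tmul, Polynomial.coeff_zero, map_one, Polynomial.coeff_one]
    cases n <;> simp
  | add x y hx hy => simp only [map_add, Polynomial.coeff_add, hx, hy, smul_add]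
  | smul r x hx => simp only [map_smul, Polynomial.coeff_smul, hx, smul_comm r n]
  | mul v x hx =>
    rw [comul_ι_mul, projMul_comulGen, counitLeft_comul, map_add, Polynomial.coeff_add]
    cases n with
    | zero => simp only [coeff_weight_ι_mul_zero, add_zero, smul_zero]
    | succ n =>
      rw [coeff_weight_ι_mul_succ, coeff_weight_ι_mul_succ, hx, succ_nsmul, mul_smul_comm,
        add_comm]

theorem coeff_weight_zero (x : SSym R V₀ V₁) :
    (weight R V₀ V₁ x).coeff 0 = counit R V₀ V₁ x • 1 := by
  induction x using induction_left with
  | one => simp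
  | add x y hx hy => simp only [map_add, Polynomial.coeff_add, hx, hy, add_smul]
  | smul r x hx => simp only [map_smul, Polynomial.coeff_smul, hx, smul_assoc]
  | mul v x hx => rw [coeff_weight_ι_mul_zero, map_mul, counit_ι, zero_mul, zero_smul]

/-- In characteristic zero every primitive element of `Sym V` lies in `V`. -/
theorem eq_ι_of_primitive [Algebra ℚ R] {x : SSym R V₀ V₁}
    (h : comul R V₀ V₁ x = x ⊗ₜ 1 + 1 ⊗ₜ x) : x = ι R V₀ V₁ (proj R V₀ V₁ x) := by
  have hE : projMul R V₀ V₁ (comul R V₀ V₁ x) = ι R V₀ V₁ (proj R V₀ V₁ x) := by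
    rw [h]
    simp [projMul]
  have h0 : counit R V₀ V₁ x • (1 : SSym R V₀ V₁) = 0 := by
    have h1 := counitLeft_comul x
    rw [h] at h1
    simpa [counitLeft] using h1
  have hw : weight R V₀ V₁ x = Polynomial.monomial 1 (ι R V₀ V₁ (proj R V₀ V₁ x)) := by
    ext n
    have hn := coeff_weight_euler x n
    rw [hE, weight_ι, Polynomial.coeff_monomial] at hn
    rw [Polynomial.coeff_monomial]
    rcases n with _ | _ | n
    · simp [coeff_weight_zero, h0]
    · simpa using hn.symm
    · have hne : (1 : ℕ) ≠ n + 1 + 1 := by omega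
      rw [if_neg hne] at hn ⊢
      have hq : algebraMap ℚ R ((n + 1 + 1 : ℕ) : ℚ)⁻¹ •
          ((n + 1 + 1) • (weight R V₀ V₁ x).coeff (n + 1 + 1)) =
          (weight R V₀ V₁ x).coeff (n + 1 + 1) := by
        rw [← Nat.cast_smul_eq_nsmul R (n + 1 + 1), smul_smul]
        have : ((n + 1 + 1 : ℕ) : R) = algebraMap ℚ R ((n + 1 + 1 : ℕ) : ℚ) := by simp
        rw [this, ← map_mul, inv_mul_cancel₀ (by positivity), map_one, one_smul]
      rw [← hq, ← hn, smul_zero]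
  have hs := sum_weight x
  rw [hw] at hs
  rw [← hs]
  simp [Polynomial.lsum_apply, Polynomial.sum_monomial_index]

end SSym

/-- A `ℤ/2`-graded `L∞`-algebra `𝔤` over a commutative ring `R` (containing `ℚ`), given on its
parity shift `V = Π𝔤 = even ⊕ odd`: an odd coderivation `Q` of the symmetric coalgebra `Sym V`
with `Q(1) = 0` and `Q² = 0`. -/
structure LInfAlg (R : Type u) [CommRing R] where
  /-- The even part of `V = Π𝔤`, which is the odd part of `𝔤`. -/
  even : Type v
  /-- The odd part of `V = Π𝔤`, which is the even part of `𝔤`. -/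
  odd : Type v
  [instEvenAdd : AddCommGroup even]
  [instEvenMod : Module R even]
  [instOddAdd : AddCommGroup odd]
  [instOddMod : Module R odd]
  /-- The codifferential. -/
  Q : SSym R even odd →ₗ[R] SSym R even odd
  Q_parity : ∀ x, Q (SSym.parity R even odd x) = -SSym.parity R even odd (Q x)
  Q_comul : ∀ x, SSym.comul R even odd (Q x) =
    TensorProduct.map Q LinearMap.id (SSym.comul R even odd x) +
      TensorProduct.map (SSym.parity R even odd).toLinearMap Q (SSym.comul R even odd x)
  Q_one : Q 1 = 0
  Q_Q : ∀ x, Q (Q x) = 0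

namespace LInfAlg

attribute [instance] instEvenAdd instEvenMod instOddAdd instOddMod

variable {R : Type u} [CommRing R]

/-- The super module `V = Π𝔤`. -/
abbrev V (g : LInfAlg.{u, v} R) : Type v := g.even × g.odd

/-- The symmetric coalgebra of `V = Π𝔤`. -/
abbrev S (g : LInfAlg.{u, v} R) : Type (max u v) := SSym R g.even g.odd

/-- The differential of an `L∞`-algebra: the linear part of `Q`. -/
def diff (g : LInfAlg.{u, v} R) : g.V →ₗ[R] g.V :=
  (SSym.proj R g.even g.odd).comp (g.Q.comp (SSym.ι R g.even g.odd))

/-- The cohomology `ker d / im d`. -/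
abbrev cohomology (g : LInfAlg.{u, v} R) : Type v :=
  LinearMap.ker g.diff ⧸ (LinearMap.range g.diff).submoduleOf (LinearMap.ker g.diff)

theorem Q_ι [Algebra ℚ R] (g : LInfAlg.{u, v} R) (v : g.V) :
    g.Q (SSym.ι R g.even g.odd v) = SSym.ι R g.even g.odd (g.diff v) := by
  apply SSym.eq_ι_of_primitive
  rw [g.Q_comul, SSym.comul_ι]
  simp [g.Q_one]

/-- An `L∞`-morphism: an even morphism `F` of counital coaugmented coalgebras which commutes with
the codifferentials. -/
structure Hom (g h : LInfAlg.{u, v} R) where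
  /-- The underlying linear map. -/
  F : g.S →ₗ[R] h.S
  F_parity : ∀ x, F (SSym.parity R g.even g.odd x) = SSym.parity R h.even h.odd (F x)
  F_comul : ∀ x, SSym.comul R h.even h.odd (F x) =
    TensorProduct.map F F (SSym.comul R g.even g.odd x)
  F_counit : ∀ x, SSym.counit R h.even h.odd (F x) = SSym.counit R g.even g.odd x
  F_one : F 1 = 1
  F_Q : ∀ x, F (g.Q x) = h.Q (F x)

namespace Hom

variable {g h : LInfAlg.{u, v} R}

/-- The linear part of an `L∞`-morphism. -/
def linear (f : Hom g h) : g.V →ₗ[R] h.V :=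
  (SSym.proj R h.even h.odd).comp (f.F.comp (SSym.ι R g.even g.odd))

theorem F_ι [Algebra ℚ R] (f : Hom g h) (v : g.V) :
    f.F (SSym.ι R g.even g.odd v) = SSym.ι R h.even h.odd (f.linear v) := by
  apply SSym.eq_ι_of_primitive
  rw [f.F_comul, SSym.comul_ι]
  simp [f.F_one]

theorem linear_diff [Algebra ℚ R] (f : Hom g h) (v : g.V) :
    f.linear (g.diff v) = h.diff (f.linear v) := by
  have e := f.F_Q (SSym.ι R g.even g.odd v)
  rw [g.Q_ι, f.F_ι, f.F_ι, h.Q_ι] at e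
  have e' := congrArg (SSym.proj R h.even h.odd) e
  rwa [SSym.proj_ι, SSym.proj_ι] at e'

/-- The map induced on cohomology by (the linear part of) an `L∞`-morphism. -/
def cohomologyMap [Algebra ℚ R] (f : Hom g h) : g.cohomology →ₗ[R] h.cohomology :=
  Submodule.mapQ _ _
    (f.linear.restrict (p := LinearMap.ker g.diff) (q := LinearMap.ker h.diff) (by
      intro v hv
      rw [LinearMap.mem_ker] at hv ⊢
      rw [← f.linear_diff, hv, map_zero]))
    (by
      rintro ⟨v, hv⟩ ⟨w, hw⟩
      exact ⟨f.linear w, by rw [← f.linear_diff, hw]; rfl⟩)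

/-- An `L∞`-quasi-isomorphism. -/
def IsQuasiIso [Algebra ℚ R] (f : Hom g h) : Prop := Function.Bijective f.cohomologyMap

end Hom

/-- Two `L∞`-algebras are `L∞` quasi-isomorphic if they are connected by a chain of
`L∞`-quasi-isomorphisms, pointing in either direction. -/
def QuasiIsomorphic [Algebra ℚ R] (g h : LInfAlg.{u, v} R) : Prop :=
  Relation.EqvGen (fun a b : LInfAlg.{u, v} R => ∃ f : Hom a b, f.IsQuasiIso) g h

end LInfAlg


namespace SSym

section baseChange

variable {R : Type u} [CommRing R] (A : Type w) [CommRing A] [Algebra R A]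
variable (V₀ V₁ : Type v) [AddCommGroup V₀] [Module R V₀] [AddCommGroup V₁] [Module R V₁]

/-- The map `V → A ⊗ V`, `v ↦ 1 ⊗ v`. -/
def baseMk : V₀ × V₁ →ₗ[R] (A ⊗[R] V₀) × (A ⊗[R] V₁) :=
  LinearMap.prodMap (TensorProduct.mk R A V₀ 1) (TensorProduct.mk R A V₁ 1)

theorem baseMk_apply (v : V₀ × V₁) : baseMk A V₀ V₁ v = (1 ⊗ₜ[R] v.1, 1 ⊗ₜ[R] v.2) := rfl

/-- The map `Sym_R V → Sym_A (A ⊗ V)` which extends `v ↦ 1 ⊗ v`. -/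
def ofBase : SSym R V₀ V₁ →ₐ[R] SSym A (A ⊗[R] V₀) (A ⊗[R] V₁) :=
  lift (((ι A (A ⊗[R] V₀) (A ⊗[R] V₁)).restrictScalars R).comp (baseMk A V₀ V₁))
    (by
      intro a v
      simpa [baseMk_apply] using ι_even_mul (R := A) (1 ⊗ₜ[R] a) (baseMk A V₀ V₁ v))
    (by
      intro b c
      simpa [baseMk_apply] using
        ι_odd_mul (R := A) (V₀ := A ⊗[R] V₀) (1 ⊗ₜ[R] b) (1 ⊗ₜ[R] c))

@[simp] theorem ofBase_ι (v : V₀ × V₁) :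
    ofBase A V₀ V₁ (ι R V₀ V₁ v) = ι A _ _ (1 ⊗ₜ[R] v.1, 1 ⊗ₜ[R] v.2) := by
  simp [ofBase, baseMk_apply]

/-- The map `A ⊗ Sym_R V → Sym_A (A ⊗ V)`. -/
def toSSym : A ⊗[R] SSym R V₀ V₁ →ₐ[A] SSym A (A ⊗[R] V₀) (A ⊗[R] V₁) :=
  Algebra.TensorProduct.lift (Algebra.ofId _ _) (ofBase A V₀ V₁)
    (fun _ _ => Algebra.commutes _ _)

theorem toSSym_tmul (a : A) (x : SSym R V₀ V₁) :
    toSSym A V₀ V₁ (a ⊗ₜ x) = a • ofBase A V₀ V₁ x := by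
  rw [Algebra.smul_def]
  rfl

/-- The map `A ⊗ V → A ⊗ Sym_R V`. -/
def fromGen : (A ⊗[R] V₀) × (A ⊗[R] V₁) →ₗ[A] A ⊗[R] SSym R V₀ V₁ :=
  LinearMap.coprod (((ι R V₀ V₁).comp (LinearMap.inl R V₀ V₁)).baseChange A)
    (((ι R V₀ V₁).comp (LinearMap.inr R V₀ V₁)).baseChange A)

/-- The map `Sym_A (A ⊗ V) → A ⊗ Sym_R V`. -/
def fromSSym : SSym A (A ⊗[R] V₀) (A ⊗[R] V₁) →ₐ[A] A ⊗[R] SSym R V₀ V₁ :=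
  lift (fromGen A V₀ V₁)
    (by
      rintro a ⟨p, q⟩
      rw [show (p, q) = (p, (0 : A ⊗[R] V₁)) + (0, q) by simp, map_add, mul_add, add_mul]
      simp only [fromGen, LinearMap.coprod_apply, map_zero, add_zero, zero_add]
      congr 1
      · induction a with
        | zero => simp
        | add x y hx hy => rw [map_add, add_mul, hx, hy, mul_add]
        | tmul x y =>
          induction p with
          | zero => simp
          | add z t hz ht => rw [map_add, mul_add, hz, ht, add_mul]
          | tmul z t =>
            have e := ι_even_mul (R := R) y (t, (0 : V₁))
            simp only [LinearMap.baseChange_tmul, LinearMap.comp_apply, LinearMap.inl_apply,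
              Algebra.TensorProduct.tmul_mul_tmul, mul_comm x z, e]
      · induction a with
        | zero => simp
        | add x y hx hy => rw [map_add, add_mul, hx, hy, mul_add]
        | tmul x y =>
          induction q with
          | zero => simp
          | add z t hz ht => rw [map_add, mul_add, hz, ht, add_mul]
          | tmul z t =>
            have e := ι_even_mul (R := R) y ((0 : V₀), t)
            simp only [LinearMap.baseChange_tmul, LinearMap.comp_apply, LinearMap.inl_apply,
              LinearMap.inr_apply, Algebra.TensorProduct.tmul_mul_tmul, mul_comm x z, e])
    (by
      intro b c
      simp only [fromGen, LinearMap.coprod_apply, map_zero, zero_add]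
      induction b with
      | zero => simp
      | add x y hx hy => rw [map_add, add_mul, hx, hy, mul_add, neg_add]
      | tmul x y =>
        induction c with
        | zero => simp
        | add z t hz ht => rw [map_add, mul_add, hz, ht, add_mul, neg_add]
        | tmul z t =>
          simp [ι_odd_mul y t, mul_comm x z, TensorProduct.tmul_neg])

theorem toSSym_fromSSym (x : SSym A (A ⊗[R] V₀) (A ⊗[R] V₁)) :
    toSSym A V₀ V₁ (fromSSym (R := R) A V₀ V₁ x) = x := by
  have h : (toSSym A V₀ V₁).comp (fromSSym (R := R) A V₀ V₁) = AlgHom.id A _ := by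
    apply algHom_ext
    rintro ⟨p, q⟩
    simp only [AlgHom.comp_apply, fromSSym, lift_ι, AlgHom.id_apply, fromGen,
      LinearMap.coprod_apply, map_add]
    rw [ι_split (R := A) (p, q)]
    congr 1
    · induction p with
      | zero => simp [show ((0 : A ⊗[R] V₀), (0 : A ⊗[R] V₁)) = 0 from rfl]
      | add x y hx hy =>
        rw [map_add, map_add, hx, hy, ← map_add]
        simp
      | tmul x y => simp [toSSym_tmul, ← map_smul, TensorProduct.smul_tmul']
    · induction q with
      | zero => simp [show ((0 : A ⊗[R] V₀), (0 : A ⊗[R] V₁)) = 0 from rfl]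
      | add x y hx hy =>
        rw [map_add, map_add, hx, hy, ← map_add]
        simp
      | tmul x y => simp [toSSym_tmul, ← map_smul, TensorProduct.smul_tmul']
  exact DFunLike.congr_fun h x

theorem fromSSym_ofBase (x : SSym R V₀ V₁) :
    fromSSym A V₀ V₁ (ofBase A V₀ V₁ x) = 1 ⊗ₜ x := by
  have h : ((fromSSym A V₀ V₁).restrictScalars R).comp (ofBase A V₀ V₁) =
      Algebra.TensorProduct.includeRight := by
    apply algHom_ext
    intro v
    simp [fromSSym, fromGen, ← TensorProduct.tmul_add, ← map_add]
  exact DFunLike.congr_fun h x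

theorem linearMap_ext_ofBase {N : Type*} [AddCommGroup N] [Module A N]
    {f g : SSym A (A ⊗[R] V₀) (A ⊗[R] V₁) →ₗ[A] N}
    (h : ∀ x : SSym R V₀ V₁, f (ofBase A V₀ V₁ x) = g (ofBase A V₀ V₁ x)) : f = g := by
  ext y
  rw [← toSSym_fromSSym A V₀ V₁ y]
  induction fromSSym A V₀ V₁ y with
  | zero => simp
  | add x y hx hy => rw [map_add, map_add, hx, hy, map_add]
  | tmul a x => rw [toSSym_tmul, map_smul, map_smul, h]

/-- The `A`-linear extension of an `R`-linear operator on `Sym_R V` to `Sym_A (A ⊗ V)`. -/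
def baseChangeMap (Q : SSym R V₀ V₁ →ₗ[R] SSym R V₀ V₁) :
    SSym A (A ⊗[R] V₀) (A ⊗[R] V₁) →ₗ[A] SSym A (A ⊗[R] V₀) (A ⊗[R] V₁) :=
  (toSSym A V₀ V₁).toLinearMap.comp ((Q.baseChange A).comp (fromSSym A V₀ V₁).toLinearMap)

@[simp] theorem baseChangeMap_ofBase (Q : SSym R V₀ V₁ →ₗ[R] SSym R V₀ V₁)
    (x : SSym R V₀ V₁) :
    baseChangeMap A V₀ V₁ Q (ofBase A V₀ V₁ x) = ofBase A V₀ V₁ (Q x) := by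
  simp [baseChangeMap, fromSSym_ofBase, toSSym_tmul]

/-- The map `x ⊗ y ↦ (1 ⊗ x) ⊗ (1 ⊗ y)`. -/
def ofBase₂ : SSym R V₀ V₁ ⊗[R] SSym R V₀ V₁ →ₗ[R]
    SSym A (A ⊗[R] V₀) (A ⊗[R] V₁) ⊗[A] SSym A (A ⊗[R] V₀) (A ⊗[R] V₁) :=
  TensorProduct.lift (LinearMap.mk₂ R
    (fun x y => ofBase A V₀ V₁ x ⊗ₜ[A] ofBase A V₀ V₁ y)
    (by intro x y z; rw [map_add, TensorProduct.add_tmul])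
    (by intro r x y; rw [map_smul, TensorProduct.smul_tmul'])
    (by intro x y z; rw [map_add, TensorProduct.tmul_add])
    (by intro r x y; rw [map_smul, TensorProduct.tmul_smul]))

@[simp] theorem ofBase₂_tmul (x y : SSym R V₀ V₁) :
    ofBase₂ A V₀ V₁ (x ⊗ₜ y) = ofBase A V₀ V₁ x ⊗ₜ[A] ofBase A V₀ V₁ y := rfl

theorem parity_ofBase (x : SSym R V₀ V₁) :
    parity A _ _ (ofBase A V₀ V₁ x) = ofBase A V₀ V₁ (parity R V₀ V₁ x) := by
  have h : ((parity A _ _).restrictScalars R).comp (ofBase A V₀ V₁) =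
      (ofBase A V₀ V₁).comp (parity R V₀ V₁) := by
    apply algHom_ext
    intro v
    simp [TensorProduct.tmul_neg]
  exact DFunLike.congr_fun h x

theorem comulGen_ofBase (v : V₀ × V₁) (t : SSym R V₀ V₁ ⊗[R] SSym R V₀ V₁) :
    comulGen A _ _ (1 ⊗ₜ[R] v.1, 1 ⊗ₜ[R] v.2) (ofBase₂ A V₀ V₁ t) =
      ofBase₂ A V₀ V₁ (comulGen R V₀ V₁ v t) := by
  induction t with
  | zero => simp
  | add x y hx hy => simp only [map_add, hx, hy]
  | tmul x y =>
    simp [comulGen_tmul, parity_ofBase]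

theorem comul_ofBase (x : SSym R V₀ V₁) :
    comul A _ _ (ofBase A V₀ V₁ x) = ofBase₂ A V₀ V₁ (comul R V₀ V₁ x) := by
  have h : ((comul A _ _).restrictScalars R).comp (ofBase A V₀ V₁).toLinearMap =
      (ofBase₂ A V₀ V₁).comp (comul R V₀ V₁) := by
    apply linearMap_ext
    · simp
    · intro v x hx
      simp only [LinearMap.comp_apply, AlgHom.toLinearMap_apply,
        LinearMap.restrictScalars_apply] at hx ⊢
      rw [map_mul, ofBase_ι, comul_ι_mul, comul_ι_mul, hx, comulGen_ofBase]
  exact LinearMap.congr_fun h x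

end baseChange

end SSym

namespace LInfAlg

variable {R : Type u} [CommRing R]

/-- The base change `A ⊗_R 𝔤` of an `L∞`-algebra: the operations are extended `A`-linearly. -/
def baseChange (A : Type w) [CommRing A] [Algebra R A] (g : LInfAlg.{u, v} R) :
    LInfAlg.{w, max w v} A where
  even := A ⊗[R] g.even
  odd := A ⊗[R] g.odd
  Q := SSym.baseChangeMap A g.even g.odd g.Q
  Q_parity x := by
    have h : (SSym.baseChangeMap A g.even g.odd g.Q).comp (SSym.parity A _ _).toLinearMap =
        -((SSym.parity A _ _).toLinearMap.comp (SSym.baseChangeMap A g.even g.odd g.Q)) := by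
      apply SSym.linearMap_ext_ofBase
      intro x
      simp [SSym.parity_ofBase, g.Q_parity]
    exact LinearMap.congr_fun h x
  Q_comul x := by
    have h : (SSym.comul A _ _).comp (SSym.baseChangeMap A g.even g.odd g.Q) =
        (TensorProduct.map (SSym.baseChangeMap A g.even g.odd g.Q) LinearMap.id).comp
          (SSym.comul A _ _) +
        (TensorProduct.map (SSym.parity A _ _).toLinearMap
          (SSym.baseChangeMap A g.even g.odd g.Q)).comp (SSym.comul A _ _) := by
      apply SSym.linearMap_ext_ofBase
      intro x
      simp only [LinearMap.comp_apply, LinearMap.add_apply, SSym.baseChangeMap_ofBase,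
        SSym.comul_ofBase, g.Q_comul, map_add]
      generalize SSym.comul R g.even g.odd x = t
      induction t with
      | zero => simp
      | add x y hx hy =>
        simp only [map_add] at hx hy ⊢
        rw [add_add_add_comm, hx, hy, add_add_add_comm]
      | tmul x y => simp [SSym.parity_ofBase]
    exact LinearMap.congr_fun h x
  Q_one := by
    have h := SSym.baseChangeMap_ofBase A g.even g.odd g.Q 1
    rwa [map_one, g.Q_one, map_zero] at h
  Q_Q x := by
    have h : (SSym.baseChangeMap A g.even g.odd g.Q).comp
        (SSym.baseChangeMap A g.even g.odd g.Q) = 0 := by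
      apply SSym.linearMap_ext_ofBase
      intro x
      simp [g.Q_Q]
    exact LinearMap.congr_fun h x

end LInfAlg

namespace SSym

section recursion

variable {R : Type u} [CommRing R]
variable {V₀ V₁ : Type v} [AddCommGroup V₀] [Module R V₀] [AddCommGroup V₁] [Module R V₁]

/-- The operator `(x, y) ↦ (v x, δ_v x + ρ(v) y)`. -/
def recGen (δ : V₀ × V₁ →ₗ[R] Module.End R (SSym R V₀ V₁)) (ρ : V₀ × V₁ →ₗ[R] V₀ × V₁) :
    V₀ × V₁ →ₗ[R] Module.End R (SSym R V₀ V₁ × SSym R V₀ V₁) where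
  toFun v := LinearMap.prod
    ((LinearMap.mulLeft R (ι R V₀ V₁ v)).comp (LinearMap.fst R _ _))
    (LinearMap.coprod (δ v) (LinearMap.mulLeft R (ι R V₀ V₁ (ρ v))))
  map_add' v w := by
    ext x <;> simp [add_mul]
  map_smul' r v := by
    ext x <;> simp

theorem recGen_apply (δ : V₀ × V₁ →ₗ[R] Module.End R (SSym R V₀ V₁))
    (ρ : V₀ × V₁ →ₗ[R] V₀ × V₁) (v : V₀ × V₁) (x y : SSym R V₀ V₁) :
    recGen δ ρ v (x, y) = (ι R V₀ V₁ v * x, δ v x + ι R V₀ V₁ (ρ v) * y) := rfl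

/-- The condition under which the recursion `N 1 = 0`, `N (v x) = δ_v x + ρ(v) N x` is
consistent. -/
structure RecCompat (δ : V₀ × V₁ →ₗ[R] Module.End R (SSym R V₀ V₁))
    (ρ : V₀ × V₁ →ₗ[R] V₀ × V₁) : Prop where
  rho_even : ∀ a v, ι R V₀ V₁ (ρ (a, 0)) * ι R V₀ V₁ (ρ v) =
    ι R V₀ V₁ (ρ v) * ι R V₀ V₁ (ρ (a, 0))
  rho_odd : ∀ b c, ι R V₀ V₁ (ρ (0, b)) * ι R V₀ V₁ (ρ (0, c)) =
    -(ι R V₀ V₁ (ρ (0, c)) * ι R V₀ V₁ (ρ (0, b)))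
  even : ∀ a v x, δ (a, 0) (ι R V₀ V₁ v * x) + ι R V₀ V₁ (ρ (a, 0)) * δ v x =
    δ v (ι R V₀ V₁ (a, 0) * x) + ι R V₀ V₁ (ρ v) * δ (a, 0) x
  odd : ∀ b c x, δ (0, b) (ι R V₀ V₁ (0, c) * x) + ι R V₀ V₁ (ρ (0, b)) * δ (0, c) x =
    -(δ (0, c) (ι R V₀ V₁ (0, b) * x) + ι R V₀ V₁ (ρ (0, c)) * δ (0, b) x)

/-- The algebra map behind the recursion. -/
def recHom (δ : V₀ × V₁ →ₗ[R] Module.End R (SSym R V₀ V₁)) (ρ : V₀ × V₁ →ₗ[R] V₀ × V₁)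
    (h : RecCompat δ ρ) : SSym R V₀ V₁ →ₐ[R] Module.End R (SSym R V₀ V₁ × SSym R V₀ V₁) :=
  lift (recGen δ ρ)
    (by
      intro a v
      apply LinearMap.ext
      rintro ⟨x, y⟩
      rw [Module.End.mul_apply, Module.End.mul_apply, recGen_apply, recGen_apply, recGen_apply,
        recGen_apply, mul_add, mul_add, ← mul_assoc, ← mul_assoc, ← mul_assoc, ← mul_assoc,
        ι_even_mul, ← h.rho_even a v, ← add_assoc, ← add_assoc, h.even])
    (by
      intro b c
      apply LinearMap.ext
      rintro ⟨x, y⟩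
      rw [LinearMap.neg_apply, Module.End.mul_apply, Module.End.mul_apply, recGen_apply,
        recGen_apply, recGen_apply, recGen_apply, mul_add, mul_add, ← mul_assoc, ← mul_assoc,
        ← mul_assoc, ← mul_assoc, ι_odd_mul b c, h.rho_odd b c, ← add_assoc, ← add_assoc, h.odd,
        Prod.neg_mk, neg_mul, neg_mul, ← neg_add])

/-- The linear operator with `N 1 = 0` and `N (v x) = δ_v x + ρ(v) N x`. -/
def recMap (δ : V₀ × V₁ →ₗ[R] Module.End R (SSym R V₀ V₁)) (ρ : V₀ × V₁ →ₗ[R] V₀ × V₁)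
    (h : RecCompat δ ρ) : SSym R V₀ V₁ →ₗ[R] SSym R V₀ V₁ :=
  (LinearMap.snd R _ _).comp ((LinearMap.applyₗ (1, 0)).comp (recHom δ ρ h).toLinearMap)

@[simp] theorem recMap_one (δ : V₀ × V₁ →ₗ[R] Module.End R (SSym R V₀ V₁))
    (ρ : V₀ × V₁ →ₗ[R] V₀ × V₁) (h : RecCompat δ ρ) : recMap δ ρ h 1 = 0 := by
  simp [recMap]

theorem recMap_ι_mul (δ : V₀ × V₁ →ₗ[R] Module.End R (SSym R V₀ V₁))
    (ρ : V₀ × V₁ →ₗ[R] V₀ × V₁) (h : RecCompat δ ρ) (v : V₀ × V₁) (x : SSym R V₀ V₁) :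
    recMap δ ρ h (ι R V₀ V₁ v * x) = δ v x + ι R V₀ V₁ (ρ v) * recMap δ ρ h x := by
  have h1 : ∀ x, (recHom δ ρ h x (1, 0)).1 = x := by
    intro x
    induction x using induction_left with
    | one => simp
    | add x y hx hy => simp [hx, hy]
    | smul r x hx => simp [hx]
    | mul v x hx =>
      rw [map_mul, Module.End.mul_apply, ← Prod.mk.eta (p := recHom δ ρ h x (1, 0)), hx]
      simp [recHom, recGen_apply]
  have h2 : recHom δ ρ h (ι R V₀ V₁ v * x) (1, 0) =
      (ι R V₀ V₁ v * x, δ v x + ι R V₀ V₁ (ρ v) * recMap δ ρ h x) := by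
    rw [map_mul, Module.End.mul_apply, ← Prod.mk.eta (p := recHom δ ρ h x (1, 0)), h1]
    simp [recHom, recMap, recGen_apply]
  exact congrArg Prod.snd h2

end recursion

end SSym

/-- A differential `ℤ/2`-graded Lie algebra `𝔤 = even ⊕ odd` over `R`. -/
structure DGLie (R : Type u) [CommRing R] where
  even : Type v
  odd : Type v
  [instEvenAdd : AddCommGroup even]
  [instEvenMod : Module R even]
  [instOddAdd : AddCommGroup odd]
  [instOddMod : Module R odd]
  /-- The differential. -/
  d : even × odd →ₗ[R] even × odd
  /-- The bracket. -/
  br : even × odd →ₗ[R] even × odd →ₗ[R] even × odd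
  d_even : ∀ a, (d (a, 0)).1 = 0
  d_odd : ∀ b, (d (0, b)).2 = 0
  br_even_even : ∀ a a', (br (a, 0) (a', 0)).2 = 0
  br_even_odd : ∀ a b, (br (a, 0) (0, b)).1 = 0
  br_odd_odd : ∀ b b', (br (0, b) (0, b')).2 = 0
  /-- `[x, y] = -[y, x]` for even `x`. -/
  skew_even : ∀ a y, br (a, 0) y = -br y (a, 0)
  /-- `[x, y] = [y, x]` for odd `x`, `y`. -/
  skew_odd : ∀ b b', br (0, b) (0, b') = br (0, b') (0, b)
  d_d : ∀ x, d (d x) = 0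
  /-- `d[x, y] = [dx, y] + (-1) ^ |x| [x, dy]`. -/
  leibniz : ∀ x y, d (br x y) = br (d x) y + br (x.1, -x.2) (d y)
  /-- `[x, [y, z]] = [[x, y], z] + [y, [x, z]]` for even `x`. -/
  jacobi_even : ∀ a y z, br (a, 0) (br y z) = br (br (a, 0) y) z + br y (br (a, 0) z)
  /-- `[x, [y, z]] = [[x, y], z] + (-1) ^ |y| [y, [x, z]]` for odd `x`. -/
  jacobi_odd : ∀ b y z,
    br (0, b) (br y z) = br (br (0, b) y) z + br (y.1, -y.2) (br (0, b) z)

namespace DGLie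

attribute [instance] instEvenAdd instEvenMod instOddAdd instOddMod

variable {R : Type u} [CommRing R] (L : DGLie.{u, v} R)

/-- A dg Lie algebra is abelian if its bracket is zero. -/
def IsAbelian : Prop := ∀ x y, L.br x y = 0

/-- The differential on the parity shift `Π𝔤 = odd ⊕ even`. -/
def q₁ : L.odd × L.even →ₗ[R] L.odd × L.even :=
  (LinearEquiv.prodComm R L.even L.odd).toLinearMap.comp
    (L.d.comp (LinearEquiv.prodComm R L.odd L.even).toLinearMap)

/-- The operation `(v, w) ↦ (-1) ^ |v| [v, w]` on the parity shift `Π𝔤 = odd ⊕ even`, where `|v|`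
is the parity of `v` in `𝔤`. -/
def q₂ : L.odd × L.even →ₗ[R] L.odd × L.even →ₗ[R] L.odd × L.even :=
  (L.br.compl₁₂ ((SSym.inv R L.even L.odd).comp
    (LinearEquiv.prodComm R L.odd L.even).toLinearMap)
    (LinearEquiv.prodComm R L.odd L.even).toLinearMap).compr₂
    (LinearEquiv.prodComm R L.even L.odd).toLinearMap

theorem q₁_apply (v : L.odd × L.even) : L.q₁ v = (L.d (v.2, v.1)).swap := rfl

theorem q₂_apply (v w : L.odd × L.even) :
    L.q₂ v w = (L.br (v.2, -v.1) (w.2, w.1)).swap := rfl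

theorem split' {A B : Type v} [AddCommGroup A] [AddCommGroup B] (v : A × B) :
    v = (v.1, 0) + (0, v.2) := by
  simp

theorem neg_snd {A B : Type v} [AddCommGroup A] [AddCommGroup B] (b : B) :
    ((0 : A), -b) = -(0, b) := by
  simp

theorem neg_fst {A B : Type v} [AddCommGroup A] [AddCommGroup B] (a : A) :
    (-a, (0 : B)) = -(a, 0) := by
  simp

theorem q₁_even (a : L.odd) : (L.q₁ (a, 0)).1 = 0 := L.d_odd a

theorem q₁_odd (c : L.even) : (L.q₁ (0, c)).2 = 0 := L.d_even c

theorem br_odd_even (b : L.odd) (a : L.even) : (L.br (0, b) (a, 0)).1 = 0 := by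
  have h := L.skew_even a (0, b)
  rw [eq_comm, neg_eq_iff_eq_neg] at h
  rw [h, Prod.fst_neg, L.br_even_odd, neg_zero]

theorem q₂_even_even (a a' : L.odd) : (L.q₂ (a, 0) (a', 0)).1 = 0 := by
  rw [q₂_apply]
  exact L.br_odd_odd _ _

theorem q₂_even_odd (a : L.odd) (c : L.even) : (L.q₂ (a, 0) (0, c)).2 = 0 := by
  rw [q₂_apply]
  exact L.br_odd_even _ _

theorem q₂_odd_even (a : L.odd) (c : L.even) : (L.q₂ (0, c) (a, 0)).2 = 0 := by
  simpa [q₂_apply] using L.br_even_odd c a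

theorem q₂_odd_odd (c c' : L.even) : (L.q₂ (0, c) (0, c')).1 = 0 := by
  simpa [q₂_apply] using L.br_even_even c c'

theorem odd_inv {A B : Type v} [AddCommGroup A] [Module R A] [AddCommGroup B] [Module R B]
    (f : A × B →ₗ[R] A × B) (h1 : ∀ a, (f (a, 0)).1 = 0) (h2 : ∀ b, (f (0, b)).2 = 0)
    (v : A × B) : f (v.1, -v.2) = (-(f v).1, (f v).2) := by
  obtain ⟨a, b⟩ := v
  have e : f (a, b) = f (a, 0) + f (0, b) := by
    rw [← map_add]
    simp
  have e' : f (a, -b) = f (a, 0) - f (0, b) := by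
    rw [← map_sub]
    simp
  have h1 := h1 a
  have h2 := h2 b
  ext <;> simp [e, e', h1, h2]

theorem even_inv {A B : Type v} [AddCommGroup A] [Module R A] [AddCommGroup B] [Module R B]
    (f : A × B →ₗ[R] A × B) (h1 : ∀ a, (f (a, 0)).2 = 0) (h2 : ∀ b, (f (0, b)).1 = 0)
    (v : A × B) : f (v.1, -v.2) = ((f v).1, -(f v).2) := by
  obtain ⟨a, b⟩ := v
  have e : f (a, b) = f (a, 0) + f (0, b) := by
    rw [← map_add]
    simp
  have e' : f (a, -b) = f (a, 0) - f (0, b) := by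
    rw [← map_sub]
    simp
  have h1 := h1 a
  have h2 := h2 b
  ext <;> simp [e, e', h1, h2]

theorem q₁_inv (v : L.odd × L.even) : L.q₁ (v.1, -v.2) = (-(L.q₁ v).1, (L.q₁ v).2) :=
  odd_inv _ L.q₁_even L.q₁_odd v

theorem q₂_even_inv (a : L.odd) (w : L.odd × L.even) :
    L.q₂ (a, 0) (w.1, -w.2) = (-(L.q₂ (a, 0) w).1, (L.q₂ (a, 0) w).2) :=
  odd_inv _ (L.q₂_even_even a) (L.q₂_even_odd a) w

theorem q₂_odd_inv (c : L.even) (w : L.odd × L.even) :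
    L.q₂ (0, c) (w.1, -w.2) = ((L.q₂ (0, c) w).1, -(L.q₂ (0, c) w).2) :=
  even_inv _ (fun a => L.q₂_odd_even a c) (L.q₂_odd_odd c) w

theorem q₂_symm_even (a : L.odd) (w : L.odd × L.even) :
    L.q₂ (a, 0) w = L.q₂ w (a, 0) := by
  have h1 := L.skew_odd a w.1
  have h2 := L.skew_even w.2 (0, a)
  have e1 : L.q₂ (a, 0) w = -(L.br (0, a) (w.2, 0) + L.br (0, a) (0, w.1)).swap := by
    rw [q₂_apply, ← map_add]
    simp [neg_snd, -Prod.neg_mk]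
  have e2 : L.q₂ w (a, 0) = (L.br (w.2, 0) (0, a) - L.br (0, w.1) (0, a)).swap := by
    rw [q₂_apply, ← LinearMap.sub_apply, ← map_sub]
    simp
  rw [e1, e2, h1, h2]
  ext <;> simp <;> abel

theorem q₂_symm_odd (c c' : L.even) : L.q₂ (0, c) (0, c') = -L.q₂ (0, c') (0, c) := by
  have h := L.skew_even c (c', 0)
  simp only [q₂_apply, neg_zero]
  rw [h]
  rfl

theorem q₁_q₁ (v : L.odd × L.even) : L.q₁ (L.q₁ v) = 0 := by
  have h := L.d_d (v.2, v.1)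
  exact congrArg Prod.swap h

theorem q_leibniz_even (a : L.odd) (w : L.odd × L.even) :
    L.q₁ (L.q₂ (a, 0) w) + L.q₂ (L.q₁ (a, 0)) w + L.q₂ (a, 0) (L.q₁ w) = 0 := by
  have h := L.leibniz (0, a) (w.2, w.1)
  have h1 : L.d (0, a) = ((L.d (0, a)).1, 0) := Prod.ext rfl (L.d_odd a)
  have e1 : L.q₁ (L.q₂ (a, 0) w) = -(L.d (L.br (0, a) (w.2, w.1))).swap := by
    rw [q₁_apply, q₂_apply, neg_snd, map_neg, LinearMap.neg_apply]
    change (L.d (-(L.br (0, a) (w.2, w.1)))).swap = _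
    rw [map_neg]
    rfl
  have e2 : L.q₂ (L.q₁ (a, 0)) w = (L.br (L.d (0, a)) (w.2, w.1)).swap := by
    rw [q₂_apply, q₁_apply, h1]
    simp
  have e3 : L.q₂ (a, 0) (L.q₁ w) = (L.br (0, -a) (L.d (w.2, w.1))).swap := by
    rw [q₂_apply, q₁_apply]
    rfl
  rw [e1, e2, e3, h]
  ext <;> simp

theorem q_leibniz_odd (c : L.even) (w : L.odd × L.even) :
    L.q₁ (L.q₂ (0, c) w) + L.q₂ (L.q₁ (0, c)) w - L.q₂ (0, c) (L.q₁ w) = 0 := by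
  have h := L.leibniz (c, 0) (w.2, w.1)
  have h1 : L.d (c, 0) = (0, (L.d (c, 0)).2) := Prod.ext (L.d_even c) rfl
  have e1 : L.q₁ (L.q₂ (0, c) w) = (L.d (L.br (c, 0) (w.2, w.1))).swap := by
    simp [q₁_apply, q₂_apply]
  have e2 : L.q₂ (L.q₁ (0, c)) w = -(L.br (L.d (c, 0)) (w.2, w.1)).swap := by
    rw [q₂_apply, q₁_apply, h1]
    simp [neg_snd, -Prod.neg_mk]
  have e3 : L.q₂ (0, c) (L.q₁ w) = (L.br (c, -0) (L.d (w.2, w.1))).swap := by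
    rw [q₂_apply, q₁_apply]
    simp
  rw [e1, e2, e3, h]
  ext <;> simp

theorem q_jacobi_even (a : L.odd) (w z : L.odd × L.even) :
    L.q₂ (L.q₂ (a, 0) w) z + L.q₂ (w.1, -w.2) (L.q₂ (a, 0) z) + L.q₂ (a, 0) (L.q₂ w z) = 0 := by
  have h := L.jacobi_odd a (w.2, -w.1) (z.2, z.1)
  have e1 : L.q₂ (L.q₂ (a, 0) w) z = (L.br (L.br (0, a) (w.2, -w.1)) (z.2, z.1)).swap := by
    have p : L.br (0, a) (w.2, w.1) =
        L.br (0, a) (w.2, 0) + L.br (0, a) (0, w.1) := by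
      rw [← map_add]
      simp
    have p' : L.br (0, a) (w.2, -w.1) =
        L.br (0, a) (w.2, 0) - L.br (0, a) (0, w.1) := by
      rw [← map_sub]
      simp
    have r1 := L.br_odd_even a w.2
    have r2 := L.br_odd_odd a w.1
    rw [q₂_apply, q₂_apply]
    congr 2
    rw [p']
    simp only [neg_snd, map_neg, LinearMap.neg_apply]
    rw [p]
    congr 1
    ext <;> simp [r1, r2]
  have e2 : L.q₂ (w.1, -w.2) (L.q₂ (a, 0) z) =
      (L.br (w.2, w.1) (L.br (0, a) (z.2, z.1))).swap := by
    rw [q₂_apply, q₂_apply, neg_snd, map_neg, LinearMap.neg_apply]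
    change (L.br (-(w.2, w.1)) (-(L.br (0, a) (z.2, z.1)))).swap = _
    rw [map_neg, map_neg, LinearMap.neg_apply, neg_neg]
  have e3 : L.q₂ (a, 0) (L.q₂ w z) =
      -(L.br (0, a) (L.br (w.2, -w.1) (z.2, z.1))).swap := by
    simp [q₂_apply, neg_snd, -Prod.neg_mk]
  rw [e1, e2, e3, h]
  ext <;> simp

theorem q_jacobi_odd (c : L.even) (w z : L.odd × L.even) :
    L.q₂ (L.q₂ (0, c) w) z + L.q₂ w (L.q₂ (0, c) z) - L.q₂ (0, c) (L.q₂ w z) = 0 := by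
  have h := L.jacobi_even c (w.2, -w.1) (z.2, z.1)
  have e1 : L.q₂ (L.q₂ (0, c) w) z = (L.br (L.br (c, 0) (w.2, -w.1)) (z.2, z.1)).swap := by
    have p : L.br (c, 0) (w.2, w.1) =
        L.br (c, 0) (w.2, 0) + L.br (c, 0) (0, w.1) := by
      rw [← map_add]
      simp
    have p' : L.br (c, 0) (w.2, -w.1) =
        L.br (c, 0) (w.2, 0) - L.br (c, 0) (0, w.1) := by
      rw [← map_sub]
      simp
    have r1 := L.br_even_even c w.2
    have r2 := L.br_even_odd c w.1
    rw [q₂_apply, q₂_apply]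
    congr 2
    rw [p']
    simp only [neg_zero]
    rw [p]
    congr 1
    ext <;> simp [r1, r2]
  have e2 : L.q₂ w (L.q₂ (0, c) z) =
      (L.br (w.2, -w.1) (L.br (c, 0) (z.2, z.1))).swap := by
    simp [q₂_apply]
  have e3 : L.q₂ (0, c) (L.q₂ w z) =
      (L.br (c, 0) (L.br (w.2, -w.1) (z.2, z.1))).swap := by
    simp [q₂_apply]
  rw [e1, e2, e3, h]
  ext <;> simp

end DGLie

namespace DGLie

variable {R : Type u} [CommRing R] (L : DGLie.{u, v} R)

/-- The symmetric algebra on `Π𝔤`. -/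
abbrev S : Type (max u v) := SSym R L.odd L.even

/-- The inclusion of `Π𝔤`. -/
abbrev i : L.odd × L.even →ₗ[R] L.S := SSym.ι R L.odd L.even

theorem i_neg_snd (c : L.even) : L.i (0, -c) = -L.i (0, c) := by
  rw [neg_snd, map_neg]

theorem fst_zero_eq {A B : Type v} [Zero A] {p : A × B} (h : p.1 = 0) : p = (0, p.2) :=
  Prod.ext h rfl

theorem snd_zero_eq {A B : Type v} [Zero B] {p : A × B} (h : p.2 = 0) : p = (p.1, 0) :=
  Prod.ext rfl h

/-- The map `w ↦ (multiplication by [v, w])`. -/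
def adGen (v : L.odd × L.even) : L.odd × L.even →ₗ[R] Module.End R L.S :=
  (LinearMap.mul R L.S).comp (L.i.comp (L.q₂ v))

theorem adGen_apply (v w : L.odd × L.even) (x : L.S) :
    L.adGen v w x = L.i (L.q₂ v w) * x := rfl

theorem mul_left_comm_even (a : L.odd) (v : L.odd × L.even) (x : L.S) :
    L.i (a, 0) * (L.i v * x) = L.i v * (L.i (a, 0) * x) := by
  rw [← mul_assoc, SSym.ι_even_mul, mul_assoc]

theorem mul_left_comm_odd (c : L.even) (v : L.odd × L.even) (x : L.S) :
    L.i (0, c) * (L.i v * x) = L.i (v.1, -v.2) * (L.i (0, c) * x) := by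
  rw [← mul_assoc, ← mul_assoc, SSym.ι_mul_odd]

theorem adGen_even_compat (a : L.odd) : SSym.RecCompat (L.adGen (a, 0)) (SSym.inv R _ _) where
  rho_even a v := by simp only [SSym.inv_apply, neg_zero, SSym.ι_even_mul]
  rho_odd b c := SSym.ι_odd_mul _ _
  even a' v x := by
    have e := fst_zero_eq (L.q₂_even_even a a')
    simp only [adGen_apply, SSym.inv_apply, neg_zero]
    rw [e, mul_left_comm_odd, mul_left_comm_even, add_comm]
  odd b c x := by
    have e1 := snd_zero_eq (L.q₂_even_odd a b)
    have e2 := snd_zero_eq (L.q₂_even_odd a c)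
    simp only [adGen_apply, SSym.inv_apply]
    rw [e1, e2, mul_left_comm_even, mul_left_comm_even, i_neg_snd, i_neg_snd]
    simp only [neg_mul]
    abel

theorem adGen_odd_compat (c : L.even) : SSym.RecCompat (L.adGen (0, c)) LinearMap.id where
  rho_even a v := SSym.ι_even_mul _ _
  rho_odd b c := SSym.ι_odd_mul _ _
  even a' v x := by
    have e := snd_zero_eq (L.q₂_odd_even a' c)
    simp only [adGen_apply, LinearMap.id_apply]
    rw [e, mul_left_comm_even, mul_left_comm_even, add_comm]
  odd b c' x := by
    have e1 := fst_zero_eq (L.q₂_odd_odd c b)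
    have e2 := fst_zero_eq (L.q₂_odd_odd c c')
    simp only [adGen_apply, LinearMap.id_apply]
    rw [e1, e2, L.mul_left_comm_odd _ (0, c'), L.mul_left_comm_odd _ (0, b), i_neg_snd, i_neg_snd]
    simp only [neg_mul]
    abel

/-- The superderivation of `Sym Π𝔤` that extends `w ↦ q₂ v w` for even `v`. -/
def ad₀ (a : L.odd) : L.S →ₗ[R] L.S := SSym.recMap _ _ (L.adGen_even_compat a)

/-- The superderivation of `Sym Π𝔤` that extends `w ↦ q₂ v w` for odd `v`. -/
def ad₁ (c : L.even) : L.S →ₗ[R] L.S := SSym.recMap _ _ (L.adGen_odd_compat c)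

@[simp] theorem ad₀_one (a : L.odd) : L.ad₀ a 1 = 0 := SSym.recMap_one _ _ _

@[simp] theorem ad₁_one (c : L.even) : L.ad₁ c 1 = 0 := SSym.recMap_one _ _ _

theorem ad₀_mul (a : L.odd) (z : L.odd × L.even) (x : L.S) :
    L.ad₀ a (L.i z * x) = L.i (L.q₂ (a, 0) z) * x + L.i (z.1, -z.2) * L.ad₀ a x :=
  SSym.recMap_ι_mul _ _ _ _ _

theorem ad₁_mul (c : L.even) (z : L.odd × L.even) (x : L.S) :
    L.ad₁ c (L.i z * x) = L.i (L.q₂ (0, c) z) * x + L.i z * L.ad₁ c x :=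
  SSym.recMap_ι_mul _ _ _ _ _

theorem q₂_split (v w : L.odd × L.even) :
    L.q₂ v w = L.q₂ (v.1, 0) w + L.q₂ (0, v.2) w := by
  rw [← LinearMap.add_apply, ← map_add]
  simp

theorem ad₀_add (a b : L.odd) (x : L.S) : L.ad₀ (a + b) x = L.ad₀ a x + L.ad₀ b x := by
  have h : L.ad₀ (a + b) = L.ad₀ a + L.ad₀ b := by
    apply SSym.linearMap_ext
    · simp
    · intro v x hx
      have e : L.q₂ (a + b, 0) v = L.q₂ (a, 0) v + L.q₂ (b, 0) v := by
        rw [← LinearMap.add_apply, ← map_add]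
        simp
      rw [LinearMap.add_apply] at hx ⊢
      rw [ad₀_mul, ad₀_mul, ad₀_mul, hx, e, map_add, add_mul, mul_add]
      abel
  exact LinearMap.congr_fun h x

theorem ad₁_add (a b : L.even) (x : L.S) : L.ad₁ (a + b) x = L.ad₁ a x + L.ad₁ b x := by
  have h : L.ad₁ (a + b) = L.ad₁ a + L.ad₁ b := by
    apply SSym.linearMap_ext
    · simp
    · intro v x hx
      have e : L.q₂ (0, a + b) v = L.q₂ (0, a) v + L.q₂ (0, b) v := by
        rw [← LinearMap.add_apply, ← map_add]
        simp
      rw [LinearMap.add_apply] at hx ⊢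
      rw [ad₁_mul, ad₁_mul, ad₁_mul, hx, e, map_add, add_mul, mul_add]
      abel
  exact LinearMap.congr_fun h x

theorem ad₀_smul (r : R) (a : L.odd) (x : L.S) : L.ad₀ (r • a) x = r • L.ad₀ a x := by
  have h : L.ad₀ (r • a) = r • L.ad₀ a := by
    apply SSym.linearMap_ext
    · simp
    · intro v x hx
      have e : L.q₂ (r • a, 0) v = r • L.q₂ (a, 0) v := by
        rw [← LinearMap.smul_apply, ← map_smul]
        simp
      rw [LinearMap.smul_apply] at hx ⊢
      rw [ad₀_mul, ad₀_mul, hx, e, map_smul, smul_add, smul_mul_assoc, mul_smul_comm]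
  exact LinearMap.congr_fun h x

theorem ad₁_smul (r : R) (a : L.even) (x : L.S) : L.ad₁ (r • a) x = r • L.ad₁ a x := by
  have h : L.ad₁ (r • a) = r • L.ad₁ a := by
    apply SSym.linearMap_ext
    · simp
    · intro v x hx
      have e : L.q₂ (0, r • a) v = r • L.q₂ (0, a) v := by
        rw [← LinearMap.smul_apply, ← map_smul]
        simp
      rw [LinearMap.smul_apply] at hx ⊢
      rw [ad₁_mul, ad₁_mul, hx, e, map_smul, smul_add, smul_mul_assoc, mul_smul_comm]
  exact LinearMap.congr_fun h x

/-- The inhomogeneous part `(dv) x + ad_v x` of the recursion for the Chevalley–Eilenberg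
differential. -/
def ceGen : L.odd × L.even →ₗ[R] Module.End R L.S where
  toFun v := LinearMap.mulLeft R (L.i (L.q₁ v)) + (L.ad₀ v.1 + L.ad₁ v.2)
  map_add' v w := by
    ext x
    simp [ad₀_add, ad₁_add, add_mul]
    abel
  map_smul' r v := by
    ext x
    simp [ad₀_smul, ad₁_smul]

theorem ceGen_apply (v : L.odd × L.even) (x : L.S) :
    L.ceGen v x = L.i (L.q₁ v) * x + (L.ad₀ v.1 x + L.ad₁ v.2 x) := rfl

@[simp] theorem ad₀_zero : L.ad₀ 0 = 0 := by
  ext x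
  have h := L.ad₀_smul 0 0 x
  rwa [zero_smul, zero_smul] at h

@[simp] theorem ad₁_zero : L.ad₁ 0 = 0 := by
  ext x
  have h := L.ad₁_smul 0 0 x
  rwa [zero_smul, zero_smul] at h

theorem ad₀_neg (a : L.odd) (x : L.S) : L.ad₀ (-a) x = -L.ad₀ a x := by
  have h := L.ad₀_smul (-1) a x
  rwa [neg_one_smul, neg_one_smul] at h

theorem ad₁_neg (a : L.even) (x : L.S) : L.ad₁ (-a) x = -L.ad₁ a x := by
  have h := L.ad₁_smul (-1) a x
  rwa [neg_one_smul, neg_one_smul] at h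

theorem ceGen_compat : SSym.RecCompat L.ceGen (SSym.inv R _ _) where
  rho_even a v := by simp only [SSym.inv_apply, neg_zero, SSym.ι_even_mul]
  rho_odd b c := SSym.ι_odd_mul _ _
  even a v x := by
    have e := fst_zero_eq (L.q₁_even a)
    have s : L.i (L.q₂ (a, 0) v) * x =
        L.i (L.q₂ (v.1, 0) (a, 0)) * x + L.i (L.q₂ (0, v.2) (a, 0)) * x := by
      rw [q₂_symm_even, q₂_split, map_add, add_mul]
    simp only [ceGen_apply, SSym.inv_apply, neg_zero, ad₁_zero, LinearMap.zero_apply, add_zero,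
      ad₀_mul, ad₁_mul, mul_add, s]
    rw [e, mul_left_comm_odd, mul_left_comm_even]
    abel
  odd b c x := by
    have e1 := snd_zero_eq (L.q₁_odd b)
    have e2 := snd_zero_eq (L.q₁_odd c)
    simp only [ceGen_apply, SSym.inv_apply, ad₀_zero, LinearMap.zero_apply, zero_add,
      ad₁_mul, mul_add, i_neg_snd, neg_mul, L.q₂_symm_odd b c, map_neg]
    rw [e1, e2, mul_left_comm_even, mul_left_comm_even]
    abel

/-- The Chevalley–Eilenberg differential on `Sym Π𝔤`. -/
def ce : L.S →ₗ[R] L.S := SSym.recMap _ _ L.ceGen_compat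

@[simp] theorem ce_one : L.ce 1 = 0 := SSym.recMap_one _ _ _

theorem ce_mul (v : L.odd × L.even) (x : L.S) :
    L.ce (L.i v * x) = L.i (L.q₁ v) * x + (L.ad₀ v.1 x + L.ad₁ v.2 x) +
      L.i (v.1, -v.2) * L.ce x :=
  SSym.recMap_ι_mul _ _ _ _ _

theorem eq_zero_of_add {M : Type w} [AddCommGroup M] {a b c : M} (hb : b = 0) (hc : c = 0)
    (h : a = b + c) : a = 0 := by
  rw [h, hb, hc, add_zero]

theorem i_q₂_even_inv (b : L.odd) (z : L.odd × L.even) (y : L.S) :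
    L.i (L.q₂ (b, 0) (z.1, -z.2)) * y =
      -(L.i ((L.q₂ (b, 0) z).1, -(L.q₂ (b, 0) z).2) * y) := by
  rw [q₂_even_inv, ← neg_mul, ← map_neg, Prod.neg_mk, neg_neg]

theorem ad_jacobi₀₀ (a a' : L.odd) (x : L.S) :
    L.ad₁ (L.q₂ (a, 0) (a', 0)).2 x + L.ad₀ a' (L.ad₀ a x) + L.ad₀ a (L.ad₀ a' x) = 0 := by
  have h : L.ad₁ (L.q₂ (a, 0) (a', 0)).2 + L.ad₀ a' ∘ₗ L.ad₀ a + L.ad₀ a ∘ₗ L.ad₀ a' = 0 := by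
    apply SSym.linearMap_ext
    · simp
    · intro z x hx
      have hj := congrArg (fun p => L.i p * x) (L.q_jacobi_even a (a', 0) z)
      have e := fst_zero_eq (L.q₂_even_even a a')
      rw [e] at hj
      simp only [neg_zero, map_add, map_zero, zero_mul, add_mul] at hj
      have hx' := congrArg (L.i z * ·) hx
      simp only [LinearMap.add_apply, LinearMap.comp_apply, LinearMap.zero_apply, mul_add,
        mul_zero] at hx' ⊢
      simp only [ad₀_mul, ad₁_mul, map_add, i_q₂_even_inv, neg_neg, Prod.mk.eta]
      apply eq_zero_of_add hj hx'
      abel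
  exact LinearMap.congr_fun h x

theorem ad_jacobi₀₁ (a : L.odd) (c : L.even) (x : L.S) :
    L.ad₀ (L.q₂ (a, 0) (0, c)).1 x - L.ad₁ c (L.ad₀ a x) + L.ad₀ a (L.ad₁ c x) = 0 := by
  have h : L.ad₀ (L.q₂ (a, 0) (0, c)).1 - L.ad₁ c ∘ₗ L.ad₀ a + L.ad₀ a ∘ₗ L.ad₁ c = 0 := by
    apply SSym.linearMap_ext
    · simp
    · intro z x hx
      have hj := congrArg (fun p => L.i p * x) (L.q_jacobi_even a (0, c) z)
      have e := snd_zero_eq (L.q₂_even_odd a c)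
      rw [e] at hj
      simp only [neg_snd, map_neg, LinearMap.neg_apply, neg_mul, map_add, map_zero, zero_mul,
        add_mul] at hj
      have hx' := congrArg (L.i (z.1, -z.2) * ·) hx
      simp only [LinearMap.add_apply, LinearMap.sub_apply, LinearMap.comp_apply,
        LinearMap.zero_apply, mul_add, mul_sub, mul_zero] at hx' ⊢
      simp only [ad₀_mul, ad₁_mul, map_add, q₂_odd_inv]
      apply eq_zero_of_add hj hx'
      abel
  exact LinearMap.congr_fun h x

theorem ad_jacobi₁₁ (c c' : L.even) (x : L.S) :
    L.ad₁ (L.q₂ (0, c) (0, c')).2 x + L.ad₁ c' (L.ad₁ c x) - L.ad₁ c (L.ad₁ c' x) = 0 := by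
  have h : L.ad₁ (L.q₂ (0, c) (0, c')).2 + L.ad₁ c' ∘ₗ L.ad₁ c - L.ad₁ c ∘ₗ L.ad₁ c' = 0 := by
    apply SSym.linearMap_ext
    · simp
    · intro z x hx
      have hj := congrArg (fun p => L.i p * x) (L.q_jacobi_odd c (0, c') z)
      have e := fst_zero_eq (L.q₂_odd_odd c c')
      rw [e] at hj
      simp only [map_add, map_sub, map_zero, zero_mul, add_mul, sub_mul] at hj
      have hx' := congrArg (L.i z * ·) hx
      simp only [LinearMap.add_apply, LinearMap.sub_apply, LinearMap.comp_apply,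
        LinearMap.zero_apply, mul_add, mul_sub, mul_zero] at hx' ⊢
      simp only [ad₁_mul, map_add]
      apply eq_zero_of_add hj hx'
      abel
  exact LinearMap.congr_fun h x

theorem ce_ad₀ (a : L.odd) (x : L.S) :
    L.ce (L.ad₀ a x) + L.ad₀ a (L.ce x) + L.ad₁ (L.q₁ (a, 0)).2 x = 0 := by
  have h : L.ce ∘ₗ L.ad₀ a + L.ad₀ a ∘ₗ L.ce + L.ad₁ (L.q₁ (a, 0)).2 = 0 := by
    apply SSym.linearMap_ext
    · simp
    · intro z x hx
      have hl := congrArg (fun p => L.i p * x) (L.q_leibniz_even a z)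
      have e := fst_zero_eq (L.q₁_even a)
      rw [e] at hl
      simp only [map_add, map_zero, zero_mul, add_mul] at hl
      have hx' := congrArg (L.i z * ·) hx
      simp only [LinearMap.add_apply, LinearMap.comp_apply, LinearMap.zero_apply, mul_add,
        mul_zero] at hx' ⊢
      have j0 := L.ad_jacobi₀₀ a z.1 x
      have j1 := L.ad_jacobi₀₁ a z.2 x
      have e2 : (L.q₂ (a, 0) z).1 = (L.q₂ (a, 0) (0, z.2)).1 := by
        conv_lhs => rw [split' z, map_add, Prod.fst_add, q₂_even_even, zero_add]
      have e3 : (L.q₂ (a, 0) z).2 = (L.q₂ (a, 0) (z.1, 0)).2 := by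
        conv_lhs => rw [split' z, map_add, Prod.snd_add, q₂_even_odd, add_zero]
      have e4 : ∀ y, L.i ((L.q₁ z).1, -(L.q₁ z).2) * y = -(L.i (L.q₁ (z.1, -z.2)) * y) := by
        intro y
        rw [q₁_inv, ← neg_mul, ← map_neg, Prod.neg_mk, neg_neg]
      simp only [ad₀_mul, ad₁_mul, ce_mul, map_add, e2, e3, i_q₂_even_inv, e4, neg_neg,
        Prod.mk.eta, ad₁_neg]
      apply eq_zero_of_add hl (eq_zero_of_add hx' (eq_zero_of_add j0 j1 rfl) rfl)
      abel
  exact LinearMap.congr_fun h x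

theorem ce_ad₁ (c : L.even) (x : L.S) :
    L.ce (L.ad₁ c x) - L.ad₁ c (L.ce x) + L.ad₀ (L.q₁ (0, c)).1 x = 0 := by
  have h : L.ce ∘ₗ L.ad₁ c - L.ad₁ c ∘ₗ L.ce + L.ad₀ (L.q₁ (0, c)).1 = 0 := by
    apply SSym.linearMap_ext
    · simp
    · intro z x hx
      have hl := congrArg (fun p => L.i p * x) (L.q_leibniz_odd c z)
      have e := snd_zero_eq (L.q₁_odd c)
      rw [e] at hl
      simp only [map_add, map_sub, map_zero, zero_mul, add_mul, sub_mul] at hl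
      have hx' := congrArg (L.i (z.1, -z.2) * ·) hx
      simp only [LinearMap.add_apply, LinearMap.sub_apply, LinearMap.comp_apply,
        LinearMap.zero_apply, mul_add, mul_sub, mul_zero] at hx' ⊢
      have j0 := L.ad_jacobi₀₁ z.1 c x
      have j1 := L.ad_jacobi₁₁ c z.2 x
      have e2 : (L.q₂ (0, c) z).1 = (L.q₂ (z.1, 0) (0, c)).1 := by
        conv_lhs => rw [split' z, map_add, Prod.fst_add, q₂_odd_odd, add_zero, ← q₂_symm_even]
      have e3 : (L.q₂ (0, c) z).2 = (L.q₂ (0, c) (0, z.2)).2 := by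
        conv_lhs => rw [split' z, map_add, Prod.snd_add, q₂_odd_even, zero_add]
      simp only [ad₀_mul, ad₁_mul, ce_mul, map_add, e2, e3, q₂_odd_inv]
      apply eq_zero_of_add hl (eq_zero_of_add hx' (eq_zero_of_add j0 j1 rfl) rfl)
      abel
  exact LinearMap.congr_fun h x

theorem ce_ce (x : L.S) : L.ce (L.ce x) = 0 := by
  have h : L.ce ∘ₗ L.ce = 0 := by
    apply SSym.linearMap_ext
    · simp
    · intro v x hx
      simp only [LinearMap.comp_apply, LinearMap.zero_apply] at hx ⊢
      have h0 := L.ce_ad₀ v.1 x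
      have h1 := L.ce_ad₁ v.2 x
      have e2 : (L.q₁ v).1 = (L.q₁ (0, v.2)).1 := by
        conv_lhs => rw [split' v, map_add, Prod.fst_add, q₁_even, zero_add]
      have e3 : (L.q₁ v).2 = (L.q₁ (v.1, 0)).2 := by
        conv_lhs => rw [split' v, map_add, Prod.snd_add, q₁_odd, add_zero]
      have e4 : ∀ y, L.i ((L.q₁ v).1, -(L.q₁ v).2) * y = -(L.i (L.q₁ (v.1, -v.2)) * y) := by
        intro y
        rw [q₁_inv, ← neg_mul, ← map_neg, Prod.neg_mk, neg_neg]
      simp only [ce_mul, map_add, e4, q₁_q₁, map_zero, zero_mul, hx, mul_zero, ad₁_neg]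
      rw [e2, e3]
      apply eq_zero_of_add h0 h1
      abel
  exact LinearMap.congr_fun h x

theorem parity_i (v : L.odd × L.even) :
    SSym.parity R L.odd L.even (L.i v) = L.i (v.1, -v.2) := SSym.parity_ι v

theorem ad₀_parity (a : L.odd) (x : L.S) :
    L.ad₀ a (SSym.parity R L.odd L.even x) = -SSym.parity R L.odd L.even (L.ad₀ a x) := by
  have h : L.ad₀ a ∘ₗ (SSym.parity R L.odd L.even).toLinearMap =
      -((SSym.parity R L.odd L.even).toLinearMap ∘ₗ L.ad₀ a) := by
    apply SSym.linearMap_ext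
    · simp
    · intro z x hx
      simp only [LinearMap.comp_apply, LinearMap.neg_apply, AlgHom.toLinearMap_apply] at hx ⊢
      simp only [map_mul, parity_i, ad₀_mul, map_add, hx, i_q₂_even_inv, mul_neg]
      abel
  exact LinearMap.congr_fun h x

theorem ad₁_parity (c : L.even) (x : L.S) :
    L.ad₁ c (SSym.parity R L.odd L.even x) = SSym.parity R L.odd L.even (L.ad₁ c x) := by
  have h : L.ad₁ c ∘ₗ (SSym.parity R L.odd L.even).toLinearMap =
      (SSym.parity R L.odd L.even).toLinearMap ∘ₗ L.ad₁ c := by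
    apply SSym.linearMap_ext
    · simp
    · intro z x hx
      simp only [LinearMap.comp_apply, AlgHom.toLinearMap_apply] at hx ⊢
      simp only [map_mul, parity_i, ad₁_mul, map_add, hx, q₂_odd_inv]
  exact LinearMap.congr_fun h x

theorem ce_parity (x : L.S) :
    L.ce (SSym.parity R L.odd L.even x) = -SSym.parity R L.odd L.even (L.ce x) := by
  have h : L.ce ∘ₗ (SSym.parity R L.odd L.even).toLinearMap =
      -((SSym.parity R L.odd L.even).toLinearMap ∘ₗ L.ce) := by
    apply SSym.linearMap_ext
    · simp
    · intro v x hx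
      simp only [LinearMap.comp_apply, LinearMap.neg_apply, AlgHom.toLinearMap_apply] at hx ⊢
      have e4 : ∀ y, L.i ((L.q₁ v).1, -(L.q₁ v).2) * y = -(L.i (L.q₁ (v.1, -v.2)) * y) := by
        intro y
        rw [q₁_inv, ← neg_mul, ← map_neg, Prod.neg_mk, neg_neg]
      simp only [map_mul, parity_i, ce_mul, map_add, hx, e4, ad₀_parity, ad₁_parity, ad₁_neg,
        mul_neg, map_neg]
      abel
  exact LinearMap.congr_fun h x

theorem comul_i_mul (v : L.odd × L.even) (x : L.S) :
    SSym.comul R L.odd L.even (L.i v * x) =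
      SSym.comulGen R L.odd L.even v (SSym.comul R L.odd L.even x) := SSym.comul_ι_mul v x

theorem comul_ad₀ (a : L.odd) (x : L.S) : SSym.comul R L.odd L.even (L.ad₀ a x) =
    TensorProduct.map (L.ad₀ a) LinearMap.id (SSym.comul R L.odd L.even x) +
      TensorProduct.map (SSym.parity R L.odd L.even).toLinearMap (L.ad₀ a)
        (SSym.comul R L.odd L.even x) := by
  have h : SSym.comul R L.odd L.even ∘ₗ L.ad₀ a =
      (TensorProduct.map (L.ad₀ a) LinearMap.id +
      TensorProduct.map (SSym.parity R L.odd L.even).toLinearMap (L.ad₀ a)) ∘ₗ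
        SSym.comul R L.odd L.even := by
    apply SSym.linearMap_ext
    · simp
    · intro z x hx
      simp only [LinearMap.comp_apply] at hx ⊢
      rw [ad₀_mul, map_add, comul_i_mul, comul_i_mul, comul_i_mul, hx]
      generalize SSym.comul R L.odd L.even x = t
      have e2 : (L.q₂ (a, 0) (0, z.2)) = ((L.q₂ (a, 0) z).1, 0) := by
        refine Prod.ext ?_ (L.q₂_even_odd _ _)
        conv_rhs => rw [split' z, map_add, Prod.fst_add, q₂_even_even, zero_add]
      have e3 : (L.q₂ (a, 0) (z.1, 0)) = (0, (L.q₂ (a, 0) z).2) := by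
        refine Prod.ext (L.q₂_even_even _ _) ?_
        conv_rhs => rw [split' z, map_add, Prod.snd_add, q₂_even_odd, add_zero]
      induction t with
      | zero => simp
      | add x y hx hy =>
        simp only [map_add] at hx hy ⊢
        rw [← hx, ← hy]
        abel
      | tmul x y =>
        simp only [SSym.comulGen_tmul, LinearMap.add_apply, TensorProduct.map_tmul, map_add,
          LinearMap.id_apply, AlgHom.toLinearMap_apply, ad₀_mul, map_mul, parity_i, e2, e3,
          ad₀_parity, SSym.parity_parity, TensorProduct.add_tmul, TensorProduct.tmul_add,
          TensorProduct.neg_tmul, i_neg_snd, neg_zero, neg_mul, TensorProduct.tmul_neg]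
        abel
  exact LinearMap.congr_fun h x

theorem comul_ad₁ (c : L.even) (x : L.S) : SSym.comul R L.odd L.even (L.ad₁ c x) =
    TensorProduct.map (L.ad₁ c) LinearMap.id (SSym.comul R L.odd L.even x) +
      TensorProduct.map LinearMap.id (L.ad₁ c) (SSym.comul R L.odd L.even x) := by
  have h : SSym.comul R L.odd L.even ∘ₗ L.ad₁ c =
      (TensorProduct.map (L.ad₁ c) LinearMap.id +
      TensorProduct.map LinearMap.id (L.ad₁ c)) ∘ₗ SSym.comul R L.odd L.even := by
    apply SSym.linearMap_ext
    · simp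
    · intro z x hx
      simp only [LinearMap.comp_apply] at hx ⊢
      rw [ad₁_mul, map_add, comul_i_mul, comul_i_mul, comul_i_mul, hx]
      generalize SSym.comul R L.odd L.even x = t
      have e2 : (L.q₂ (0, c) (0, z.2)) = (0, (L.q₂ (0, c) z).2) := by
        refine Prod.ext (L.q₂_odd_odd _ _) ?_
        conv_rhs => rw [split' z, map_add, Prod.snd_add, q₂_odd_even, zero_add]
      have e3 : (L.q₂ (0, c) (z.1, 0)) = ((L.q₂ (0, c) z).1, 0) := by
        refine Prod.ext ?_ (L.q₂_odd_even _ _)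
        conv_rhs => rw [split' z, map_add, Prod.fst_add, q₂_odd_odd, add_zero]
      induction t with
      | zero => simp
      | add x y hx hy =>
        simp only [map_add] at hx hy ⊢
        rw [← hx, ← hy]
        abel
      | tmul x y =>
        simp only [SSym.comulGen_tmul, LinearMap.add_apply, TensorProduct.map_tmul, map_add,
          LinearMap.id_apply, ad₁_mul, e2, e3, ad₁_parity, TensorProduct.add_tmul,
          TensorProduct.tmul_add]
        abel
  exact LinearMap.congr_fun h x

theorem comul_ce (x : L.S) : SSym.comul R L.odd L.even (L.ce x) =
    TensorProduct.map L.ce LinearMap.id (SSym.comul R L.odd L.even x) +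
      TensorProduct.map (SSym.parity R L.odd L.even).toLinearMap L.ce
        (SSym.comul R L.odd L.even x) := by
  have h : SSym.comul R L.odd L.even ∘ₗ L.ce =
      (TensorProduct.map L.ce LinearMap.id +
      TensorProduct.map (SSym.parity R L.odd L.even).toLinearMap L.ce) ∘ₗ
        SSym.comul R L.odd L.even := by
    apply SSym.linearMap_ext
    · simp
    · intro v x hx
      simp only [LinearMap.comp_apply] at hx ⊢
      rw [ce_mul, map_add, map_add, map_add, comul_i_mul, comul_i_mul, comul_i_mul, hx,
        comul_ad₀, comul_ad₁]
      generalize SSym.comul R L.odd L.even x = t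
      have e2 : L.q₁ (0, v.2) = ((L.q₁ v).1, 0) := by
        refine Prod.ext ?_ (L.q₁_odd _)
        conv_rhs => rw [split' v, map_add, Prod.fst_add, q₁_even, zero_add]
      have e3 : L.q₁ (v.1, 0) = (0, (L.q₁ v).2) := by
        refine Prod.ext (L.q₁_even _) ?_
        conv_rhs => rw [split' v, map_add, Prod.snd_add, q₁_odd, add_zero]
      induction t with
      | zero => simp
      | add x y hx hy =>
        simp only [map_add] at hx hy ⊢
        rw [add_add_add_comm] at hx hy ⊢
        rw [← sub_eq_zero] at hx hy ⊢
        apply eq_zero_of_add hx hy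
        abel
      | tmul x y =>
        simp only [SSym.comulGen_tmul, LinearMap.add_apply, TensorProduct.map_tmul, map_add,
          LinearMap.id_apply, AlgHom.toLinearMap_apply, ce_mul, map_mul, parity_i, e2, e3,
          ce_parity, SSym.parity_parity, TensorProduct.add_tmul, TensorProduct.tmul_add,
          TensorProduct.neg_tmul, i_neg_snd, neg_zero, neg_mul, TensorProduct.tmul_neg,
          ad₀_zero, ad₁_zero, LinearMap.zero_apply, add_zero, zero_add]
        abel
  exact LinearMap.congr_fun h x

/-- The `L∞`-algebra of a dg Lie algebra `𝔤`: the codifferential `Q` on `Sym Π𝔤` has the linear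
part `d`, the quadratic part `(-1) ^ |x| [x, y]`, and no other parts. -/
def toLInfAlg : LInfAlg.{u, v} R where
  even := L.odd
  odd := L.even
  Q := L.ce
  Q_parity := L.ce_parity
  Q_comul := L.comul_ce
  Q_one := L.ce_one
  Q_Q := L.ce_ce

end DGLie

namespace DGLie

variable {R : Type u} [CommRing R]

section baseChange

variable (A : Type w) [CommRing A] [Algebra R A]

theorem linearMap_ext_one {M : Type v} [AddCommGroup M] [Module R M] {N : Type*}
    [AddCommMonoid N] [Module A N] {f g : A ⊗[R] M →ₗ[A] N}
    (h : ∀ x : M, f (1 ⊗ₜ x) = g (1 ⊗ₜ x)) : f = g := by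
  apply LinearMap.ext
  intro p
  induction p with
  | zero => rw [map_zero, map_zero]
  | add p q hp hq => rw [map_add, map_add, hp, hq]
  | tmul a x =>
    have e : a ⊗ₜ[R] x = a • ((1 : A) ⊗ₜ[R] x) := by simp [TensorProduct.smul_tmul']
    rw [e, map_smul, map_smul, h]

theorem linearMap_ext_baseMk {M₀ M₁ : Type v} [AddCommGroup M₀] [Module R M₀] [AddCommGroup M₁]
    [Module R M₁] {N : Type*} [AddCommMonoid N] [Module A N]
    {f g : (A ⊗[R] M₀) × (A ⊗[R] M₁) →ₗ[A] N}
    (h : ∀ x : M₀ × M₁, f (SSym.baseMk A M₀ M₁ x) = g (SSym.baseMk A M₀ M₁ x)) : f = g := by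
  apply LinearMap.prod_ext
  · apply linearMap_ext_one
    intro x
    simpa [SSym.baseMk_apply] using h (x, 0)
  · apply linearMap_ext_one
    intro x
    simpa [SSym.baseMk_apply] using h (0, x)

variable (L : DGLie.{u, v} R)

/-- The `A`-linear extension of the differential. -/
def dBase : (A ⊗[R] L.even) × (A ⊗[R] L.odd) →ₗ[A] (A ⊗[R] L.even) × (A ⊗[R] L.odd) :=
  (TensorProduct.prodRight R A A L.even L.odd).toLinearMap.comp
    ((L.d.baseChange A).comp (TensorProduct.prodRight R A A L.even L.odd).symm.toLinearMap)

/-- The `A`-bilinear extension of the bracket. -/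
def brBase : (A ⊗[R] L.even) × (A ⊗[R] L.odd) →ₗ[A] (A ⊗[R] L.even) × (A ⊗[R] L.odd) →ₗ[A]
    (A ⊗[R] L.even) × (A ⊗[R] L.odd) :=
  ((LinearMap.BilinMap.baseChange A L.br).compl₁₂
    (TensorProduct.prodRight R A A L.even L.odd).symm.toLinearMap
    (TensorProduct.prodRight R A A L.even L.odd).symm.toLinearMap).compr₂
    (TensorProduct.prodRight R A A L.even L.odd).toLinearMap

/-- The map `x ↦ 1 ⊗ x`. -/
abbrev j : L.even × L.odd →ₗ[R] (A ⊗[R] L.even) × (A ⊗[R] L.odd) :=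
  SSym.baseMk A L.even L.odd

theorem dBase_j (x : L.even × L.odd) : L.dBase A (L.j A x) = L.j A (L.d x) := by
  simp [dBase, SSym.baseMk_apply]

theorem brBase_j (x y : L.even × L.odd) :
    L.brBase A (L.j A x) (L.j A y) = L.j A (L.br x y) := by
  simp [brBase, SSym.baseMk_apply]

theorem j_even (a : L.even) : L.j A (a, 0) = (1 ⊗ₜ a, 0) := by
  simp [SSym.baseMk_apply]

theorem j_odd (b : L.odd) : L.j A (0, b) = (0, 1 ⊗ₜ b) := by
  simp [SSym.baseMk_apply]

theorem inv_j (x : L.even × L.odd) :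
    SSym.inv A _ _ (L.j A x) = L.j A (x.1, -x.2) := by
  simp [SSym.baseMk_apply, TensorProduct.tmul_neg]

theorem dBase_dBase (x : (A ⊗[R] L.even) × (A ⊗[R] L.odd)) : L.dBase A (L.dBase A x) = 0 := by
  have h : L.dBase A ∘ₗ L.dBase A = 0 := by
    apply linearMap_ext_baseMk
    intro x
    simp only [LinearMap.comp_apply, dBase_j, L.d_d, map_zero, LinearMap.zero_apply]
  exact LinearMap.congr_fun h x

theorem dBase_even (p : A ⊗[R] L.even) : (L.dBase A (p, 0)).1 = 0 := by
  have h : LinearMap.fst A _ _ ∘ₗ L.dBase A ∘ₗ LinearMap.inl A _ _ = 0 := by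
    apply linearMap_ext_one
    intro a
    simp only [LinearMap.comp_apply, LinearMap.inl_apply, ← j_even, dBase_j]
    simp [SSym.baseMk_apply, L.d_even]
  exact LinearMap.congr_fun h p

theorem dBase_odd (p : A ⊗[R] L.odd) : (L.dBase A (0, p)).2 = 0 := by
  have h : LinearMap.snd A _ _ ∘ₗ L.dBase A ∘ₗ LinearMap.inr A _ _ = 0 := by
    apply linearMap_ext_one
    intro a
    simp only [LinearMap.comp_apply, LinearMap.inr_apply, ← j_odd, dBase_j]
    simp [SSym.baseMk_apply, L.d_odd]
  exact LinearMap.congr_fun h p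

theorem brBase_even_even (p q : A ⊗[R] L.even) : (L.brBase A (p, 0) (q, 0)).2 = 0 := by
  have h : ((L.brBase A).compl₁₂ (LinearMap.inl A _ _) (LinearMap.inl A _ _)).compr₂
      (LinearMap.snd A _ _) = 0 := by
    apply linearMap_ext_one
    intro a
    apply linearMap_ext_one
    intro b
    simp only [LinearMap.compr₂_apply, LinearMap.compl₁₂_apply, LinearMap.inl_apply, ← j_even,
      brBase_j]
    simp [SSym.baseMk_apply, L.br_even_even]
  exact LinearMap.congr_fun₂ h p q

theorem brBase_even_odd (p : A ⊗[R] L.even) (q : A ⊗[R] L.odd) :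
    (L.brBase A (p, 0) (0, q)).1 = 0 := by
  have h : ((L.brBase A).compl₁₂ (LinearMap.inl A _ _) (LinearMap.inr A _ _)).compr₂
      (LinearMap.fst A _ _) = 0 := by
    apply linearMap_ext_one
    intro a
    apply linearMap_ext_one
    intro b
    simp only [LinearMap.compr₂_apply, LinearMap.compl₁₂_apply, LinearMap.inl_apply,
      LinearMap.inr_apply, ← j_even, ← j_odd, brBase_j]
    simp [SSym.baseMk_apply, L.br_even_odd]
  exact LinearMap.congr_fun₂ h p q

theorem brBase_odd_odd (p q : A ⊗[R] L.odd) : (L.brBase A (0, p) (0, q)).2 = 0 := by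
  have h : ((L.brBase A).compl₁₂ (LinearMap.inr A _ _) (LinearMap.inr A _ _)).compr₂
      (LinearMap.snd A _ _) = 0 := by
    apply linearMap_ext_one
    intro a
    apply linearMap_ext_one
    intro b
    simp only [LinearMap.compr₂_apply, LinearMap.compl₁₂_apply, LinearMap.inr_apply, ← j_odd,
      brBase_j]
    simp [SSym.baseMk_apply, L.br_odd_odd]
  exact LinearMap.congr_fun₂ h p q

theorem brBase_skew_even (p : A ⊗[R] L.even) (y : (A ⊗[R] L.even) × (A ⊗[R] L.odd)) :
    L.brBase A (p, 0) y = -L.brBase A y (p, 0) := by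
  have h : L.brBase A ∘ₗ LinearMap.inl A _ _ =
      (L.brBase A).flip ∘ₗ (-LinearMap.inl A _ _) := by
    apply linearMap_ext_one
    intro a
    apply linearMap_ext_baseMk
    intro y
    simp only [LinearMap.comp_apply, LinearMap.inl_apply, LinearMap.neg_apply, map_neg,
      LinearMap.flip_apply, ← j_even, brBase_j]
    rw [L.skew_even, map_neg]
  have h' := LinearMap.congr_fun₂ h p y
  simpa only [LinearMap.comp_apply, LinearMap.inl_apply, LinearMap.neg_apply, map_neg,
    LinearMap.flip_apply] using h'

theorem brBase_skew_odd (p q : A ⊗[R] L.odd) :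
    L.brBase A (0, p) (0, q) = L.brBase A (0, q) (0, p) := by
  have h : (L.brBase A).compl₁₂ (LinearMap.inr A _ _) (LinearMap.inr A _ _) =
      ((L.brBase A).compl₁₂ (LinearMap.inr A _ _) (LinearMap.inr A _ _)).flip := by
    apply linearMap_ext_one
    intro a
    apply linearMap_ext_one
    intro b
    simp only [LinearMap.compl₁₂_apply, LinearMap.inr_apply, LinearMap.flip_apply, ← j_odd,
      brBase_j]
    rw [L.skew_odd]
  exact LinearMap.congr_fun₂ h p q

theorem brBase_leibniz (x y : (A ⊗[R] L.even) × (A ⊗[R] L.odd)) :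
    L.dBase A (L.brBase A x y) =
      L.brBase A (L.dBase A x) y + L.brBase A (x.1, -x.2) (L.dBase A y) := by
  have h : (L.brBase A).compr₂ (L.dBase A) =
      L.brBase A ∘ₗ L.dBase A + (L.brBase A).compl₁₂ (SSym.inv A _ _) (L.dBase A) := by
    apply linearMap_ext_baseMk
    intro x
    apply linearMap_ext_baseMk
    intro y
    simp only [LinearMap.compr₂_apply, LinearMap.add_apply, LinearMap.comp_apply,
      LinearMap.compl₁₂_apply]
    rw [inv_j]
    simp only [brBase_j, dBase_j]
    rw [L.leibniz, map_add]
  exact LinearMap.congr_fun₂ h x y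

theorem brBase_jacobi_even (p : A ⊗[R] L.even) (y z : (A ⊗[R] L.even) × (A ⊗[R] L.odd)) :
    L.brBase A (p, 0) (L.brBase A y z) =
      L.brBase A (L.brBase A (p, 0) y) z + L.brBase A y (L.brBase A (p, 0) z) := by
  induction p with
  | zero => simp [show ((0 : A ⊗[R] L.even), (0 : A ⊗[R] L.odd)) = 0 from rfl]
  | add p q hp hq =>
    have e : (p + q, (0 : A ⊗[R] L.odd)) = (p, 0) + (q, 0) := by simp
    simp only [e, map_add, LinearMap.add_apply, hp, hq]
    abel
  | tmul s a =>
    have e : (s ⊗ₜ[R] a, (0 : A ⊗[R] L.odd)) = s • L.j A (a, 0) := by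
      rw [j_even]
      simp [TensorProduct.smul_tmul']
    have h : (L.brBase A).compr₂ (L.brBase A (L.j A (a, 0))) =
        L.brBase A ∘ₗ L.brBase A (L.j A (a, 0)) +
          (L.brBase A).compl₂ (L.brBase A (L.j A (a, 0))) := by
      apply linearMap_ext_baseMk
      intro y
      apply linearMap_ext_baseMk
      intro z
      simp only [LinearMap.compr₂_apply, LinearMap.add_apply, LinearMap.comp_apply,
        LinearMap.compl₂_apply, brBase_j]
      rw [L.jacobi_even, map_add]
    have h' := LinearMap.congr_fun₂ h y z
    simp only [LinearMap.compr₂_apply, LinearMap.add_apply, LinearMap.comp_apply,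
        LinearMap.compl₂_apply] at h'
    simp only [e, map_smul, LinearMap.smul_apply, h', smul_add]

theorem brBase_jacobi_odd (p : A ⊗[R] L.odd) (y z : (A ⊗[R] L.even) × (A ⊗[R] L.odd)) :
    L.brBase A (0, p) (L.brBase A y z) =
      L.brBase A (L.brBase A (0, p) y) z + L.brBase A (y.1, -y.2) (L.brBase A (0, p) z) := by
  induction p with
  | zero => simp [show ((0 : A ⊗[R] L.even), (0 : A ⊗[R] L.odd)) = 0 from rfl]
  | add p q hp hq =>
    have e : ((0 : A ⊗[R] L.even), p + q) = (0, p) + (0, q) := by simp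
    simp only [e, map_add, LinearMap.add_apply, hp, hq]
    abel
  | tmul s a =>
    have e : ((0 : A ⊗[R] L.even), s ⊗ₜ[R] a) = s • L.j A (0, a) := by
      rw [j_odd]
      simp [TensorProduct.smul_tmul']
    have h : (L.brBase A).compr₂ (L.brBase A (L.j A (0, a))) =
        L.brBase A ∘ₗ L.brBase A (L.j A (0, a)) +
          (L.brBase A).compl₁₂ (SSym.inv A _ _) (L.brBase A (L.j A (0, a))) := by
      apply linearMap_ext_baseMk
      intro y
      apply linearMap_ext_baseMk
      intro z
      simp only [LinearMap.compr₂_apply, LinearMap.add_apply, LinearMap.comp_apply,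
        LinearMap.compl₁₂_apply]
      rw [inv_j]
      simp only [brBase_j]
      rw [L.jacobi_odd, map_add]
    have h' := LinearMap.congr_fun₂ h y z
    simp only [LinearMap.compr₂_apply, LinearMap.add_apply, LinearMap.comp_apply,
        LinearMap.compl₁₂_apply, SSym.inv_apply] at h'
    simp only [e, map_smul, LinearMap.smul_apply, h', smul_add]

/-- The base change `A ⊗_R 𝔤` of a dg Lie algebra. -/
def baseChange : DGLie.{w, max w v} A where
  even := A ⊗[R] L.even
  odd := A ⊗[R] L.odd
  d := L.dBase A
  br := L.brBase A
  d_even := L.dBase_even A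
  d_odd := L.dBase_odd A
  br_even_even := L.brBase_even_even A
  br_even_odd := L.brBase_even_odd A
  br_odd_odd := L.brBase_odd_odd A
  skew_even := L.brBase_skew_even A
  skew_odd := L.brBase_skew_odd A
  d_d := L.dBase_dBase A
  leibniz := L.brBase_leibniz A
  jacobi_even := L.brBase_jacobi_even A
  jacobi_odd := L.brBase_jacobi_odd A

theorem ofBase_i_mul (z : L.odd × L.even) (x : L.S) :
    SSym.ofBase A L.odd L.even (L.i z * x) =
      SSym.ι A (A ⊗[R] L.odd) (A ⊗[R] L.even) (SSym.baseMk A L.odd L.even z) *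
        SSym.ofBase A L.odd L.even x := by
  rw [map_mul]
  congr 1
  exact SSym.ofBase_ι A L.odd L.even z

theorem q₁_baseMk (z : L.odd × L.even) : (L.baseChange A).q₁ (SSym.baseMk A L.odd L.even z) =
    SSym.baseMk A L.odd L.even (L.q₁ z) :=
  congrArg Prod.swap (L.dBase_j A (z.2, z.1))

theorem q₂_baseMk (z y : L.odd × L.even) :
    (L.baseChange A).q₂ (SSym.baseMk A L.odd L.even z) (SSym.baseMk A L.odd L.even y) =
      SSym.baseMk A L.odd L.even (L.q₂ z y) := by
  have h := congrArg Prod.swap (L.brBase_j A (z.2, -z.1) (y.2, y.1))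
  have e : L.j A (z.2, -z.1) = (1 ⊗ₜ[R] z.2, -(1 ⊗ₜ[R] z.1)) := by
    simp [SSym.baseMk_apply, TensorProduct.tmul_neg]
  rw [e] at h
  exact h

theorem inv_baseMk (z : L.odd × L.even) : ((SSym.baseMk (R := R) A L.odd L.even z).1,
    -(SSym.baseMk (R := R) A L.odd L.even z).2) = SSym.baseMk A L.odd L.even (z.1, -z.2) := by
  simp [SSym.baseMk_apply, TensorProduct.tmul_neg]

/-- The operator `ad₀` of the base change, with its type unfolded. -/
def adBase₀ (a : L.odd) : SSym A (A ⊗[R] L.odd) (A ⊗[R] L.even) →ₗ[A]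
    SSym A (A ⊗[R] L.odd) (A ⊗[R] L.even) := (L.baseChange A).ad₀ (1 ⊗ₜ[R] a)

/-- The operator `ad₁` of the base change, with its type unfolded. -/
def adBase₁ (c : L.even) : SSym A (A ⊗[R] L.odd) (A ⊗[R] L.even) →ₗ[A]
    SSym A (A ⊗[R] L.odd) (A ⊗[R] L.even) := (L.baseChange A).ad₁ (1 ⊗ₜ[R] c)

/-- The differential `ce` of the base change, with its type unfolded. -/
def ceBase : SSym A (A ⊗[R] L.odd) (A ⊗[R] L.even) →ₗ[A]
    SSym A (A ⊗[R] L.odd) (A ⊗[R] L.even) := (L.baseChange A).ce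

theorem adBase₀_mul (a : L.odd) (z : L.odd × L.even)
    (x : SSym A (A ⊗[R] L.odd) (A ⊗[R] L.even)) :
    L.adBase₀ A a (SSym.ι A _ _ (SSym.baseMk A L.odd L.even z) * x) =
      SSym.ι A _ _ (SSym.baseMk A L.odd L.even (L.q₂ (a, 0) z)) * x +
      SSym.ι A _ _ (SSym.baseMk A L.odd L.even (z.1, -z.2)) * L.adBase₀ A a x := by
  have h := (L.baseChange A).ad₀_mul (1 ⊗ₜ[R] a) (SSym.baseMk A L.odd L.even z) x
  have e : SSym.baseMk A L.odd L.even (a, 0) = (1 ⊗ₜ[R] a, 0) := by simp [SSym.baseMk_apply]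
  rw [← q₂_baseMk, ← inv_baseMk, e]
  exact h

theorem adBase₁_mul (c : L.even) (z : L.odd × L.even)
    (x : SSym A (A ⊗[R] L.odd) (A ⊗[R] L.even)) :
    L.adBase₁ A c (SSym.ι A _ _ (SSym.baseMk A L.odd L.even z) * x) =
      SSym.ι A _ _ (SSym.baseMk A L.odd L.even (L.q₂ (0, c) z)) * x +
      SSym.ι A _ _ (SSym.baseMk A L.odd L.even z) * L.adBase₁ A c x := by
  have h := (L.baseChange A).ad₁_mul (1 ⊗ₜ[R] c) (SSym.baseMk A L.odd L.even z) x
  have e : SSym.baseMk A L.odd L.even (0, c) = (0, 1 ⊗ₜ[R] c) := by simp [SSym.baseMk_apply]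
  rw [← q₂_baseMk, e]
  exact h

theorem ceBase_mul (z : L.odd × L.even) (x : SSym A (A ⊗[R] L.odd) (A ⊗[R] L.even)) :
    L.ceBase A (SSym.ι A _ _ (SSym.baseMk A L.odd L.even z) * x) =
      SSym.ι A _ _ (SSym.baseMk A L.odd L.even (L.q₁ z)) * x +
      (L.adBase₀ A z.1 x + L.adBase₁ A z.2 x) +
      SSym.ι A _ _ (SSym.baseMk A L.odd L.even (z.1, -z.2)) * L.ceBase A x := by
  have h := (L.baseChange A).ce_mul (SSym.baseMk A L.odd L.even z) x
  rw [← q₁_baseMk, ← inv_baseMk]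
  exact h

theorem adBase₀_ofBase (a : L.odd) (x : L.S) :
    L.adBase₀ A a (SSym.ofBase A L.odd L.even x) = SSym.ofBase A L.odd L.even (L.ad₀ a x) := by
  have h : (L.adBase₀ A a).restrictScalars R ∘ₗ (SSym.ofBase A L.odd L.even).toLinearMap =
      (SSym.ofBase A L.odd L.even).toLinearMap ∘ₗ L.ad₀ a := by
    apply SSym.linearMap_ext
    · simp only [LinearMap.comp_apply, AlgHom.toLinearMap_apply, map_one, ad₀_one, map_zero]
      exact ad₀_one (L.baseChange A) _
    · intro z x hx
      simp only [LinearMap.comp_apply, AlgHom.toLinearMap_apply,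
        LinearMap.restrictScalars_apply] at hx ⊢
      rw [ofBase_i_mul, adBase₀_mul, ad₀_mul, map_add, ofBase_i_mul, ofBase_i_mul, hx]
  exact LinearMap.congr_fun h x

theorem adBase₁_ofBase (c : L.even) (x : L.S) :
    L.adBase₁ A c (SSym.ofBase A L.odd L.even x) = SSym.ofBase A L.odd L.even (L.ad₁ c x) := by
  have h : (L.adBase₁ A c).restrictScalars R ∘ₗ (SSym.ofBase A L.odd L.even).toLinearMap =
      (SSym.ofBase A L.odd L.even).toLinearMap ∘ₗ L.ad₁ c := by
    apply SSym.linearMap_ext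
    · simp only [LinearMap.comp_apply, AlgHom.toLinearMap_apply, map_one, ad₁_one, map_zero]
      exact ad₁_one (L.baseChange A) _
    · intro z x hx
      simp only [LinearMap.comp_apply, AlgHom.toLinearMap_apply,
        LinearMap.restrictScalars_apply] at hx ⊢
      rw [ofBase_i_mul, adBase₁_mul, ad₁_mul, map_add, ofBase_i_mul, ofBase_i_mul, hx]
  exact LinearMap.congr_fun h x

theorem ceBase_ofBase (x : L.S) :
    L.ceBase A (SSym.ofBase A L.odd L.even x) = SSym.ofBase A L.odd L.even (L.ce x) := by
  have h : (L.ceBase A).restrictScalars R ∘ₗ (SSym.ofBase A L.odd L.even).toLinearMap =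
      (SSym.ofBase A L.odd L.even).toLinearMap ∘ₗ L.ce := by
    apply SSym.linearMap_ext
    · simp only [LinearMap.comp_apply, AlgHom.toLinearMap_apply, map_one, ce_one, map_zero]
      exact ce_one (L.baseChange A)
    · intro z x hx
      simp only [LinearMap.comp_apply, AlgHom.toLinearMap_apply,
        LinearMap.restrictScalars_apply] at hx ⊢
      rw [ofBase_i_mul, ceBase_mul, ce_mul, map_add, map_add, map_add, ofBase_i_mul,
        ofBase_i_mul, hx, adBase₀_ofBase, adBase₁_ofBase]
  exact LinearMap.congr_fun h x

/-- The two ways to form the `L∞`-algebra of a base change of a dg Lie algebra agree. -/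
theorem toLInfAlg_baseChange : (L.baseChange A).toLInfAlg = L.toLInfAlg.baseChange A := by
  have h : L.ceBase A = SSym.baseChangeMap A L.odd L.even L.ce := by
    apply SSym.linearMap_ext_ofBase
    intro x
    rw [ceBase_ofBase, SSym.baseChangeMap_ofBase]
  have h' : (L.baseChange A).toLInfAlg.Q = (L.toLInfAlg.baseChange A).Q := h
  unfold toLInfAlg LInfAlg.baseChange
  congr 1

end baseChange

end DGLie

namespace LInfAlg

/-- An `L∞`-algebra is homotopy abelian if it is `L∞` quasi-isomorphic to an abelian dg Lie
algebra. -/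
def IsHomotopyAbelian {R : Type u} [CommRing R] [Algebra ℚ R] (g : LInfAlg.{u, v} R) : Prop :=
  ∃ L : DGLie.{u, v} R, L.IsAbelian ∧ g.QuasiIsomorphic L.toLInfAlg

/-- The generic fibre `𝔤 ⊗ ℂ((u))` of a family over `ℂ[[u]]`. -/
def genericFibre (g : LInfAlg.{0, v} (PowerSeries ℂ)) : LInfAlg.{0, v} (LaurentSeries ℂ) :=
  g.baseChange (LaurentSeries ℂ)

/-- The special fibre `𝔤 ⊗ ℂ = 𝔤 / u𝔤` of a family over `ℂ[[u]]`. Here `ℂ[[u]]` acts on `ℂ` by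
the constant coefficient. -/
def specialFibre (g : LInfAlg.{0, v} (PowerSeries ℂ)) : LInfAlg.{0, v} ℂ :=
  letI : Algebra (PowerSeries ℂ) ℂ := RingHom.toAlgebra PowerSeries.constantCoeff
  g.baseChange ℂ

end LInfAlg

namespace DGLie

/-- A dg Lie algebra is homotopy abelian if it is `L∞` quasi-isomorphic to an abelian dg Lie
algebra. -/
def IsHomotopyAbelian {R : Type u} [CommRing R] [Algebra ℚ R] (L : DGLie.{u, v} R) : Prop :=
  L.toLInfAlg.IsHomotopyAbelian

/-- The cohomology `ker d / im d` of a dg Lie algebra. -/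
abbrev cohomology {R : Type u} [CommRing R] (L : DGLie.{u, v} R) : Type v :=
  LinearMap.ker L.d ⧸ (LinearMap.range L.d).submoduleOf (LinearMap.ker L.d)

/-- The generic fibre `𝔤 ⊗ ℂ((u))` of a family over `ℂ[[u]]`. -/
def genericFibre (L : DGLie.{0, v} (PowerSeries ℂ)) : DGLie.{0, v} (LaurentSeries ℂ) :=
  L.baseChange (LaurentSeries ℂ)

/-- The special fibre `𝔤 ⊗ ℂ = 𝔤 / u𝔤` of a family over `ℂ[[u]]`. Here `ℂ[[u]]` acts on `ℂ` by
the constant coefficient. -/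
def specialFibre (L : DGLie.{0, v} (PowerSeries ℂ)) : DGLie.{0, v} ℂ :=
  letI : Algebra (PowerSeries ℂ) ℂ := RingHom.toAlgebra PowerSeries.constantCoeff
  L.baseChange ℂ

end DGLie

end

/-!
An `L∞`-algebra `𝔤` with `V = Π𝔤` is homotopy abelian over a field of characteristic zero if and only
if the map `H(V, d) → H(Sym V, Q)` induced by `V ⊆ Sym V` is injective (`LInfAlg.InjectiveUnit`); this
is `LInfAlg.isHomotopyAbelian_iff`. All parts of the theorem are read off from this criterion.

If the map is injective, linear algebra over the field gives a chain map `Sym V → V` which is the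
identity on `V` (`InjectiveUnit.exists_retraction`). As `Sym V` is cofree, with coalgebra maps into
it given by convolution exponentials (`SSym.coalgLift`), this chain map extends to an `L∞`-morphism
from `𝔤` to the abelian dg Lie algebra `(𝔤, d)` with linear part the identity
(`InjectiveUnit.exists_hom`). In the abelian case the projection to `V` is a chain map, so the
criterion holds (`DGLie.IsAbelian.injectiveUnit`).

For the invariance under quasi-isomorphisms it is shown that the criterion passes to the source of a
morphism which is injective on cohomology, which is immediate, and to the target of a morphism which
is surjective on cohomology. For the latter the criterion is replaced by an equivalent one: every
cocycle of `Symⁿ V` for the linear part of `Q` is the leading term, for the filtration by word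
length, of a cocycle of `Sym V` for `Q` (`LInfAlg.LiftsCocycles`). By the Künneth theorem
(`LInfAlg.exists_kunneth`) a cocycle of `Symⁿ V` is, up to exact cochains, a polynomial in cocycles of
`V` which come from the source, so it can be lifted there. These two statements are (ii) and (iii).

For (i), let `t = u` be the parameter, and suppose that `Q x = v` modulo `t`, so that
`Q x = v + t y` over `ℂ[[u]]`. The cohomology of `V` has no torsion, and by the Künneth theorem for the
special fibre neither has that of `Symⁿ V` (`LInfAlg.exists_eq_linQ_of_smul_eq_linQ`). Hence the
leading term of `y` is exact and can be removed, after which the leading term of `x` is a cocycle.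
Over the generic fibre it lifts to a cocycle for `Q`; clearing denominators, one removes the leading
term of `x` at the cost of multiplying the relation by a power of `t`
(`LInfAlg.eq_diff_add_smul_of_filt`). When only words of length one are left, absence of
torsion in `H(V)` gives `v = d a + t b`, which is the criterion for the special fibre.
-/

noncomputable section

/-! ### Word length -/

/-- Division by positive integers is possible in modules over a `ℚ`-algebra. -/
theorem eq_inv_smul_of_succ_nsmul_eq {R : Type u} [CommRing R] [Algebra ℚ R] {M : Type*}
    [AddCommGroup M] [Module R M] {n : ℕ} {x y : M} (h : (n + 1) • x = y) :
    x = algebraMap ℚ R ((n + 1 : ℚ)⁻¹) • y := by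
  rw [← h, ← Nat.cast_smul_eq_nsmul R (n + 1), smul_smul]
  have : ((n + 1 : ℕ) : R) = algebraMap ℚ R (n + 1 : ℚ) := by simp
  rw [this, ← map_mul, inv_mul_cancel₀ (by positivity), map_one, one_smul]

theorem succ_nsmul_inv_smul {R : Type u} [CommRing R] [Algebra ℚ R] {M : Type*}
    [AddCommGroup M] [Module R M] (n : ℕ) (y : M) :
    (n + 1) • algebraMap ℚ R ((n + 1 : ℚ)⁻¹) • y = y := by
  rw [← Nat.cast_smul_eq_nsmul R (n + 1), smul_smul]
  have : ((n + 1 : ℕ) : R) = algebraMap ℚ R (n + 1 : ℚ) := by simp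
  rw [this, ← map_mul, mul_inv_cancel₀ (by positivity), map_one, one_smul]

theorem succ_nsmul_cancel (R : Type u) [CommRing R] [Algebra ℚ R] {M : Type*}
    [AddCommGroup M] [Module R M] {n : ℕ} {x y : M} (h : (n + 1) • x = (n + 1) • y) : x = y := by
  rw [eq_inv_smul_of_succ_nsmul_eq (R := R) h, ← eq_inv_smul_of_succ_nsmul_eq (R := R) rfl]

namespace SSym

variable {R : Type u} [CommRing R]
variable {V₀ V₁ : Type v} [AddCommGroup V₀] [Module R V₀] [AddCommGroup V₁] [Module R V₁]

variable (R V₀ V₁) in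
/-- The homogeneous part `Symⁿ V` of `Sym V`: the span of the words of length `n`. -/
def words (n : ℕ) : Submodule R (SSym R V₀ V₁) := LinearMap.range (ι R V₀ V₁) ^ n

variable (R V₀ V₁) in
/-- The projection of `Sym V` onto `Symⁿ V`. -/
def comp (n : ℕ) : SSym R V₀ V₁ →ₗ[R] SSym R V₀ V₁ :=
  ((Polynomial.lcoeff (SSym R V₀ V₁) n).restrictScalars R).comp (weight R V₀ V₁).toLinearMap

theorem comp_apply (n : ℕ) (x : SSym R V₀ V₁) :
    comp R V₀ V₁ n x = (weight R V₀ V₁ x).coeff n := rfl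

theorem comp_zero (x : SSym R V₀ V₁) : comp R V₀ V₁ 0 x = counit R V₀ V₁ x • 1 :=
  coeff_weight_zero x

theorem comp_zero_ι_mul (v : V₀ × V₁) (x : SSym R V₀ V₁) :
    comp R V₀ V₁ 0 (ι R V₀ V₁ v * x) = 0 := coeff_weight_ι_mul_zero v x

theorem comp_succ_ι_mul (v : V₀ × V₁) (x : SSym R V₀ V₁) (n : ℕ) :
    comp R V₀ V₁ (n + 1) (ι R V₀ V₁ v * x) = ι R V₀ V₁ v * comp R V₀ V₁ n x :=
  coeff_weight_ι_mul_succ v x n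

theorem comp_one (n : ℕ) : comp R V₀ V₁ n 1 = if n = 0 then 1 else 0 := by
  rw [comp_apply, map_one, Polynomial.coeff_one]

theorem one_mem_words : (1 : SSym R V₀ V₁) ∈ words R V₀ V₁ 0 := by
  rw [words, pow_zero]
  exact Submodule.one_le.mp le_rfl

theorem ι_mul_mem_words {n : ℕ} (v : V₀ × V₁) {x : SSym R V₀ V₁} (hx : x ∈ words R V₀ V₁ n) :
    ι R V₀ V₁ v * x ∈ words R V₀ V₁ (n + 1) := by
  rw [words, pow_succ']
  exact Submodule.mul_mem_mul ⟨v, rfl⟩ hx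

theorem ι_mem_words (v : V₀ × V₁) : ι R V₀ V₁ v ∈ words R V₀ V₁ 1 := by
  simpa using ι_mul_mem_words v (one_mem_words (R := R))

@[elab_as_elim]
theorem words_zero_induction {P : SSym R V₀ V₁ → Prop} (h : ∀ r : R, P (r • 1))
    {x : SSym R V₀ V₁} (hx : x ∈ words R V₀ V₁ 0) : P x := by
  rw [words, pow_zero, Submodule.mem_one] at hx
  obtain ⟨r, rfl⟩ := hx
  rw [Algebra.algebraMap_eq_smul_one]
  exact h r

@[elab_as_elim]
theorem words_succ_induction {n : ℕ} {P : SSym R V₀ V₁ → Prop}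
    (add : ∀ x y, P x → P y → P (x + y))
    (mul : ∀ v, ∀ x ∈ words R V₀ V₁ n, P (ι R V₀ V₁ v * x))
    {x : SSym R V₀ V₁} (hx : x ∈ words R V₀ V₁ (n + 1)) : P x := by
  rw [words, pow_succ'] at hx
  induction hx using Submodule.mul_induction_on' with
  | mem_mul_mem m hm y hy =>
    obtain ⟨v, rfl⟩ := hm
    exact mul v y hy
  | add x _ y _ hx hy => exact add x y hx hy

theorem comp_mem (n : ℕ) (x : SSym R V₀ V₁) : comp R V₀ V₁ n x ∈ words R V₀ V₁ n := by
  induction x using induction_left generalizing n with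
  | one =>
    rw [comp_one]
    split_ifs with h
    · rw [h]; exact one_mem_words
    · exact zero_mem _
  | add x y hx hy => rw [map_add]; exact add_mem (hx n) (hy n)
  | smul r x hx => rw [map_smul]; exact Submodule.smul_mem _ r (hx n)
  | mul v x hx =>
    cases n with
    | zero => rw [comp_zero_ι_mul]; exact zero_mem _
    | succ n => rw [comp_succ_ι_mul]; exact ι_mul_mem_words v (hx n)

theorem comp_of_mem {n : ℕ} {x : SSym R V₀ V₁} (hx : x ∈ words R V₀ V₁ n) (m : ℕ) :
    comp R V₀ V₁ m x = if m = n then x else 0 := by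
  induction n generalizing m x with
  | zero =>
    refine words_zero_induction (fun r => ?_) hx
    rw [map_smul, comp_one]
    split_ifs <;> simp
  | succ n ih =>
    refine words_succ_induction (fun x y hx hy => ?_) (fun v x hx => ?_) hx
    · rw [map_add, hx, hy]
      split_ifs <;> simp
    · cases m with
      | zero => simp [comp_zero_ι_mul]
      | succ m =>
        rw [comp_succ_ι_mul, ih hx]
        simp

theorem comp_self {n : ℕ} {x : SSym R V₀ V₁} (hx : x ∈ words R V₀ V₁ n) :
    comp R V₀ V₁ n x = x := by
  rw [comp_of_mem hx, if_pos rfl]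

theorem comp_of_ne {n m : ℕ} (h : m ≠ n) {x : SSym R V₀ V₁} (hx : x ∈ words R V₀ V₁ n) :
    comp R V₀ V₁ m x = 0 := by
  rw [comp_of_mem hx, if_neg h]

variable (R V₀ V₁) in
/-- The part `⨁_{m ≤ n} Symᵐ V` of the word length filtration of `Sym V`. -/
def filt (n : ℕ) : Submodule R (SSym R V₀ V₁) where
  carrier := {x | ∀ m, n < m → comp R V₀ V₁ m x = 0}
  add_mem' hx hy m hm := by rw [map_add, hx m hm, hy m hm, add_zero]
  zero_mem' m _ := map_zero _
  smul_mem' r x hx m hm := by rw [map_smul, hx m hm, smul_zero]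

theorem filt_mono {n m : ℕ} (h : n ≤ m) : filt R V₀ V₁ n ≤ filt R V₀ V₁ m :=
  fun _ hx k hk => hx k (h.trans_lt hk)

theorem words_le_filt (n : ℕ) : words R V₀ V₁ n ≤ filt R V₀ V₁ n :=
  fun _ hx _ hm => comp_of_ne hm.ne' hx

theorem mem_filt_of_succ {n : ℕ} {x : SSym R V₀ V₁} (hx : x ∈ filt R V₀ V₁ (n + 1))
    (h : comp R V₀ V₁ (n + 1) x = 0) : x ∈ filt R V₀ V₁ n := by
  intro m hm
  rcases Nat.eq_or_lt_of_le (Nat.succ_le_of_lt hm) with rfl | hm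
  · exact h
  · exact hx m hm

theorem exists_mem_filt (x : SSym R V₀ V₁) : ∃ n, x ∈ filt R V₀ V₁ n :=
  ⟨(weight R V₀ V₁ x).natDegree, fun _ hm => Polynomial.coeff_eq_zero_of_natDegree_lt hm⟩

theorem sum_comp {n : ℕ} {x : SSym R V₀ V₁} (hx : x ∈ filt R V₀ V₁ n) :
    ∑ m ∈ Finset.range (n + 1), comp R V₀ V₁ m x = x := by
  conv_rhs => rw [← sum_weight x, Polynomial.lsum_apply]
  rw [Polynomial.sum_over_range' _ (by simp) (n + 1)]
  · rfl
  · rw [Nat.lt_succ_iff, Polynomial.natDegree_le_iff_coeff_eq_zero]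
    exact hx

/-- A property of elements of `Sym V` may be checked on the homogeneous elements. -/
theorem words_induction {P : SSym R V₀ V₁ → Prop} (add : ∀ x y, P x → P y → P (x + y))
    (mem : ∀ n, ∀ x ∈ words R V₀ V₁ n, P x) (x : SSym R V₀ V₁) : P x := by
  obtain ⟨n, hn⟩ := exists_mem_filt x
  rw [← sum_comp hn]
  exact Finset.sum_induction _ P add (mem 0 0 (zero_mem _)) (fun m _ => mem m _ (comp_mem m x))

theorem eq_zero_of_comp {x : SSym R V₀ V₁} (h : ∀ n, comp R V₀ V₁ n x = 0) : x = 0 := by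
  obtain ⟨n, hn⟩ := exists_mem_filt x
  rw [← sum_comp hn]
  exact Finset.sum_eq_zero fun m _ => h m

theorem counit_of_mem_words {n : ℕ} {x : SSym R V₀ V₁} (hx : x ∈ words R V₀ V₁ (n + 1)) :
    counit R V₀ V₁ x = 0 := by
  refine words_succ_induction (fun x y hx hy => ?_) (fun v x _ => ?_) hx
  · rw [map_add, hx, hy, add_zero]
  · rw [map_mul, counit_ι, zero_mul]

theorem proj_of_mem_words {n : ℕ} (h : n ≠ 1) {x : SSym R V₀ V₁} (hx : x ∈ words R V₀ V₁ n) :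
    proj R V₀ V₁ x = 0 := by
  rcases n with _ | _ | n
  · refine words_zero_induction (fun r => ?_) hx
    rw [map_smul, proj_one, smul_zero]
  · exact absurd rfl h
  · refine words_succ_induction (fun x y hx hy => ?_) (fun v x hx => ?_) hx
    · rw [map_add, hx, hy, add_zero]
    · rw [proj_ι_mul, counit_of_mem_words hx, zero_smul]

theorem comp_one_eq (x : SSym R V₀ V₁) :
    comp R V₀ V₁ 1 x = ι R V₀ V₁ (proj R V₀ V₁ x) := by
  induction x using induction_left with
  | one => simp [SSym.comp_one]
  | add x y hx hy => simp only [map_add, hx, hy]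
  | smul r x hx => simp only [map_smul, hx]
  | mul v x hx => rw [comp_succ_ι_mul, comp_zero, proj_ι_mul, map_smul, mul_smul_comm, mul_one]

theorem ι_injective : Function.Injective (ι R V₀ V₁) := fun v w h => by
  simpa using congrArg (proj R V₀ V₁) h

theorem eq_ι_proj_of_mem_words {x : SSym R V₀ V₁} (hx : x ∈ words R V₀ V₁ 1) :
    x = ι R V₀ V₁ (proj R V₀ V₁ x) := by
  rw [← comp_one_eq, comp_self hx]

theorem eq_smul_of_mem_words_zero {x : SSym R V₀ V₁} (hx : x ∈ words R V₀ V₁ 0) :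
    x = counit R V₀ V₁ x • 1 := by
  rw [← comp_zero, comp_self hx]

/-! ### The comultiplication and word length -/

theorem map_comulGen {M N : Type*} [AddCommGroup M] [Module R M] [AddCommGroup N] [Module R N]
    (A : SSym R V₀ V₁ →ₗ[R] M) (B : SSym R V₀ V₁ →ₗ[R] N) (v : V₀ × V₁)
    (t : SSym R V₀ V₁ ⊗[R] SSym R V₀ V₁) :
    TensorProduct.map A B (comulGen R V₀ V₁ v t) =
      TensorProduct.map (A ∘ₗ LinearMap.mulLeft R (ι R V₀ V₁ v)) B t +
      TensorProduct.map A (B ∘ₗ LinearMap.mulLeft R (ι R V₀ V₁ (v.1, 0))) t +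
      TensorProduct.map (A ∘ₗ (parity R V₀ V₁).toLinearMap)
        (B ∘ₗ LinearMap.mulLeft R (ι R V₀ V₁ (0, v.2))) t := by
  induction t with
  | zero => simp
  | add x y hx hy =>
    simp only [map_add, hx, hy]
    abel
  | tmul x y => simp [comulGen_tmul]

theorem parity_mem_words {n : ℕ} {x : SSym R V₀ V₁} (hx : x ∈ words R V₀ V₁ n) :
    parity R V₀ V₁ x ∈ words R V₀ V₁ n := by
  induction n generalizing x with
  | zero =>
    refine words_zero_induction (fun r => ?_) hx
    rw [map_smul, map_one]
    exact Submodule.smul_mem _ r one_mem_words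
  | succ n ih =>
    refine words_succ_induction (fun x y hx hy => ?_) (fun v x hx => ?_) hx
    · rw [map_add]; exact add_mem hx hy
    · rw [map_mul, parity_ι]; exact ι_mul_mem_words _ (ih hx)

/-- The comultiplication is homogeneous: `(A ⊗ B) Δ` vanishes on `Symⁿ V` as soon as, for all
`i + j = n`, the map `A` vanishes on `Symⁱ V` or `B` vanishes on `Symʲ V`. -/
theorem map_comul_eq_zero {M N : Type*} [AddCommGroup M] [Module R M] [AddCommGroup N] [Module R N]
    {n : ℕ} {A : SSym R V₀ V₁ →ₗ[R] M} {B : SSym R V₀ V₁ →ₗ[R] N}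
    (h : ∀ i j, i + j = n → (∀ x ∈ words R V₀ V₁ i, A x = 0) ∨ (∀ x ∈ words R V₀ V₁ j, B x = 0))
    {x : SSym R V₀ V₁} (hx : x ∈ words R V₀ V₁ n) :
    TensorProduct.map A B (comul R V₀ V₁ x) = 0 := by
  induction n generalizing x A B with
  | zero =>
    refine words_zero_induction (fun r => ?_) hx
    rw [map_smul, map_smul, comul_one, TensorProduct.map_tmul]
    rcases h 0 0 rfl with h | h <;> simp [h 1 one_mem_words]
  | succ n ih =>
    refine words_succ_induction (fun x y hx hy => ?_) (fun v x hx => ?_) hx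
    · rw [map_add, map_add, hx, hy, add_zero]
    · rw [comul_ι_mul, map_comulGen, ih _ hx, ih _ hx, ih _ hx, add_zero, add_zero]
      · rintro i j rfl
        refine (h i (j + 1) (by ring)).imp (fun h x hx => ?_) (fun h x hx => ?_)
        · exact h _ (parity_mem_words hx)
        · exact h _ (ι_mul_mem_words _ hx)
      · rintro i j rfl
        refine (h i (j + 1) (by ring)).imp (fun h x hx => ?_) (fun h x hx => ?_)
        · exact h _ hx
        · exact h _ (ι_mul_mem_words _ hx)
      · rintro i j rfl
        refine (h (i + 1) j (by ring)).imp (fun h x hx => ?_) (fun h x hx => ?_)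
        · exact h _ (ι_mul_mem_words _ hx)
        · exact h _ hx

variable (R V₀ V₁) in
/-- The map `x ⊗ y ↦ (projection of x to V) · (component of y of length n)`. -/
def eulerMap (n : ℕ) : SSym R V₀ V₁ ⊗[R] SSym R V₀ V₁ →ₗ[R] SSym R V₀ V₁ :=
  (LinearMap.mul' R _).comp
    (TensorProduct.map ((ι R V₀ V₁).comp (proj R V₀ V₁)) (comp R V₀ V₁ n))

@[simp] theorem eulerMap_tmul (n : ℕ) (x y : SSym R V₀ V₁) :
    eulerMap R V₀ V₁ n (x ⊗ₜ y) = ι R V₀ V₁ (proj R V₀ V₁ x) * comp R V₀ V₁ n y := by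
  simp [eulerMap]

theorem comp_projMul (n : ℕ) (t : SSym R V₀ V₁ ⊗[R] SSym R V₀ V₁) :
    comp R V₀ V₁ (n + 1) (projMul R V₀ V₁ t) = eulerMap R V₀ V₁ n t := by
  induction t with
  | zero => simp
  | add x y hx hy => simp only [map_add, hx, hy]
  | tmul x y => simp [projMul, comp_succ_ι_mul]

/-- Euler's formula: the component of length `n + 1` of `x`, multiplied by `n + 1`, is determined
by the comultiplication of `x`. This is what makes inductions on the word length in the target of
a coalgebra map or of a coderivation possible. -/
theorem succ_nsmul_comp (n : ℕ) (x : SSym R V₀ V₁) :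
    (n + 1) • comp R V₀ V₁ (n + 1) x = eulerMap R V₀ V₁ n (comul R V₀ V₁ x) := by
  rw [← comp_projMul, comp_apply, comp_apply, coeff_weight_euler]

end SSym

namespace SSym

variable {R : Type u} [CommRing R]
variable {V₀ V₁ : Type v} [AddCommGroup V₀] [Module R V₀] [AddCommGroup V₁] [Module R V₁]

/-! ### Coassociativity and cocommutativity -/

theorem parity_comulGen (v : V₀ × V₁) (t : SSym R V₀ V₁ ⊗[R] SSym R V₀ V₁) :
    TensorProduct.map (parity R V₀ V₁).toLinearMap (parity R V₀ V₁).toLinearMap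
      (comulGen R V₀ V₁ v t) =
    comulGen R V₀ V₁ (v.1, -v.2) (TensorProduct.map (parity R V₀ V₁).toLinearMap
      (parity R V₀ V₁).toLinearMap t) := by
  induction t with
  | zero => simp
  | add x y hx hy => simp only [map_add, hx, hy]
  | tmul x y => simp [comulGen_tmul]

theorem comul_parity (x : SSym R V₀ V₁) :
    comul R V₀ V₁ (parity R V₀ V₁ x) = TensorProduct.map (parity R V₀ V₁).toLinearMap
      (parity R V₀ V₁).toLinearMap (comul R V₀ V₁ x) := by
  have h : comul R V₀ V₁ ∘ₗ (parity R V₀ V₁).toLinearMap =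
      TensorProduct.map (parity R V₀ V₁).toLinearMap (parity R V₀ V₁).toLinearMap ∘ₗ
        comul R V₀ V₁ := by
    apply linearMap_ext
    · simp
    · intro v x hx
      simp only [LinearMap.comp_apply, AlgHom.toLinearMap_apply] at hx ⊢
      rw [map_mul, parity_ι, comul_ι_mul, comul_ι_mul, hx, parity_comulGen]
  exact LinearMap.congr_fun h x

variable (R V₀ V₁) in
/-- The iterated comultiplication `Sym V → Sym V ⊗ (Sym V ⊗ Sym V)`. -/
def comul₃ : SSym R V₀ V₁ →ₗ[R] SSym R V₀ V₁ ⊗[R] (SSym R V₀ V₁ ⊗[R] SSym R V₀ V₁) :=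
  (TensorProduct.map LinearMap.id (comul R V₀ V₁)).comp (comul R V₀ V₁)

variable (R V₀ V₁) in
/-- Multiplication by `v` on the threefold tensor product, through the comultiplication. -/
def comulGen₃ (v : V₀ × V₁) :
    Module.End R (SSym R V₀ V₁ ⊗[R] (SSym R V₀ V₁ ⊗[R] SSym R V₀ V₁)) :=
  TensorProduct.map (LinearMap.mulLeft R (ι R V₀ V₁ v)) LinearMap.id +
    TensorProduct.map LinearMap.id (comulGen R V₀ V₁ (v.1, 0)) +
    TensorProduct.map (parity R V₀ V₁).toLinearMap (comulGen R V₀ V₁ (0, v.2))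

theorem comulGen₃_tmul (v : V₀ × V₁) (x : SSym R V₀ V₁)
    (t : SSym R V₀ V₁ ⊗[R] SSym R V₀ V₁) :
    comulGen₃ R V₀ V₁ v (x ⊗ₜ t) = (ι R V₀ V₁ v * x) ⊗ₜ t + x ⊗ₜ comulGen R V₀ V₁ (v.1, 0) t +
      parity R V₀ V₁ x ⊗ₜ comulGen R V₀ V₁ (0, v.2) t := rfl

theorem comul₃_one : comul₃ R V₀ V₁ 1 = 1 ⊗ₜ (1 ⊗ₜ 1) := by simp [comul₃]

theorem comul₃_ι_mul (v : V₀ × V₁) (x : SSym R V₀ V₁) :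
    comul₃ R V₀ V₁ (ι R V₀ V₁ v * x) = comulGen₃ R V₀ V₁ v (comul₃ R V₀ V₁ x) := by
  rw [comul₃, LinearMap.comp_apply, LinearMap.comp_apply, comul_ι_mul]
  generalize comul R V₀ V₁ x = t
  induction t with
  | zero => simp
  | add x y hx hy => simp only [map_add, hx, hy]
  | tmul x y => simp [comulGen_tmul, comulGen₃_tmul, comul_ι_mul]

theorem ι_zero_pair : ι R V₀ V₁ ((0 : V₀), (0 : V₁)) = 0 := map_zero _

/-- The comultiplication of `Sym V` is coassociative. -/
theorem comul_coassoc (x : SSym R V₀ V₁) :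
    TensorProduct.assoc R _ _ _ (TensorProduct.map (comul R V₀ V₁) LinearMap.id
      (comul R V₀ V₁ x)) = comul₃ R V₀ V₁ x := by
  have h : (TensorProduct.assoc R _ _ _).toLinearMap ∘ₗ
      TensorProduct.map (comul R V₀ V₁) LinearMap.id ∘ₗ comul R V₀ V₁ = comul₃ R V₀ V₁ := by
    apply linearMap_ext
    · simp [comul₃_one]
    · intro v x hx
      simp only [LinearMap.comp_apply, LinearEquiv.coe_coe] at hx ⊢
      rw [comul₃_ι_mul, ← hx, comul_ι_mul]
      generalize comul R V₀ V₁ x = t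
      induction t with
      | zero => simp
      | add x y hx hy => simp only [map_add, hx, hy]
      | tmul x y =>
        simp only [comulGen_tmul, map_add, TensorProduct.map_tmul, comul_ι_mul, comul_parity,
          LinearMap.id_apply]
        generalize comul R V₀ V₁ x = t
        induction t with
        | zero => simp
        | add x y hx hy =>
          simp only [map_add, TensorProduct.add_tmul] at hx hy ⊢
          rw [← hx, ← hy]
          abel
        | tmul x z =>
          simp only [comulGen_tmul, TensorProduct.add_tmul, map_add, TensorProduct.assoc_tmul,
            TensorProduct.map_tmul, comulGen₃_tmul, TensorProduct.tmul_add, ι_zero_pair,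
            zero_mul, TensorProduct.tmul_zero, add_zero,
            AlgHom.toLinearMap_apply]
          abel
  exact LinearMap.congr_fun h x

variable (R V₀ V₁) in
/-- Twice the interchange `x ⊗ (y ⊗ z) ↦ (-1) ^ (|x| |y|) y ⊗ (x ⊗ z)` of the first two factors. The
even and odd parts of `x` enter as `x ± P x`, with the parity involution `P`. -/
def swap₃ : Module.End R (SSym R V₀ V₁ ⊗[R] (SSym R V₀ V₁ ⊗[R] SSym R V₀ V₁)) :=
  (TensorProduct.leftComm R _ _ _).toLinearMap ∘ₗ
    (TensorProduct.map (LinearMap.id + (parity R V₀ V₁).toLinearMap) LinearMap.id +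
      TensorProduct.map (LinearMap.id - (parity R V₀ V₁).toLinearMap)
        (TensorProduct.map (parity R V₀ V₁).toLinearMap LinearMap.id))

theorem swap₃_tmul (x y z : SSym R V₀ V₁) :
    swap₃ R V₀ V₁ (x ⊗ₜ (y ⊗ₜ z)) = y ⊗ₜ ((x + parity R V₀ V₁ x) ⊗ₜ z) +
      parity R V₀ V₁ y ⊗ₜ ((x - parity R V₀ V₁ x) ⊗ₜ z) := by
  simp [swap₃]

theorem swap₃_comulGen₃ (v : V₀ × V₁)
    (t : SSym R V₀ V₁ ⊗[R] (SSym R V₀ V₁ ⊗[R] SSym R V₀ V₁)) :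
    swap₃ R V₀ V₁ (comulGen₃ R V₀ V₁ v t) = comulGen₃ R V₀ V₁ v (swap₃ R V₀ V₁ t) := by
  induction t with
  | zero => simp
  | add x y hx hy => simp only [map_add, hx, hy]
  | tmul x s =>
    induction s with
    | zero => simp
    | add x y hx hy => simp only [map_add, TensorProduct.tmul_add, hx, hy]
    | tmul y z =>
      have hn : ∀ d : V₁, ι R V₀ V₁ ((0 : V₀), -d) = -ι R V₀ V₁ (0, d) := by
        intro d
        rw [← map_neg]
        simp
      simp only [comulGen₃_tmul, comulGen_tmul, map_add, TensorProduct.tmul_add, swap₃_tmul,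
        map_mul, parity_ι, hn, ι_split v, ι_zero_pair, zero_mul, TensorProduct.tmul_zero,
        add_zero, add_mul, neg_zero, parity_parity, map_sub,
        TensorProduct.add_tmul, TensorProduct.sub_tmul, TensorProduct.tmul_sub,
        neg_mul, TensorProduct.neg_tmul, TensorProduct.tmul_neg]
      abel

/-- The comultiplication of `Sym V` is cocommutative in the super sense. -/
theorem swap₃_comul₃ (x : SSym R V₀ V₁) :
    swap₃ R V₀ V₁ (comul₃ R V₀ V₁ x) = (2 : ℕ) • comul₃ R V₀ V₁ x := by
  have h : swap₃ R V₀ V₁ ∘ₗ comul₃ R V₀ V₁ = (2 : ℕ) • comul₃ R V₀ V₁ := by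
    apply linearMap_ext
    · simp [comul₃_one, swap₃_tmul, two_nsmul, TensorProduct.add_tmul, TensorProduct.tmul_add]
    · intro v x hx
      simp only [LinearMap.comp_apply, LinearMap.smul_apply] at hx ⊢
      rw [comul₃_ι_mul, swap₃_comulGen₃, hx, map_nsmul]
  exact LinearMap.congr_fun h x

end SSym

namespace SSym

variable {R : Type u} [CommRing R]
variable {V₀ V₁ : Type v} [AddCommGroup V₀] [Module R V₀] [AddCommGroup V₁] [Module R V₁]
variable {W₀ W₁ : Type v} [AddCommGroup W₀] [Module R W₀] [AddCommGroup W₁] [Module R W₁]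

/-! ### Coalgebra maps and coderivations are determined by their projections -/

theorem eulerMap_map (n : ℕ) (A B : SSym R V₀ V₁ →ₗ[R] SSym R W₀ W₁)
    (t : SSym R V₀ V₁ ⊗[R] SSym R V₀ V₁) :
    eulerMap R W₀ W₁ n (TensorProduct.map A B t) =
      LinearMap.mul' R _ (TensorProduct.map (ι R W₀ W₁ ∘ₗ proj R W₀ W₁ ∘ₗ A)
        (comp R W₀ W₁ n ∘ₗ B) t) := by
  induction t with
  | zero => simp
  | add x y hx hy => simp only [map_add, hx, hy]
  | tmul x y => simp

section relative

variable [Algebra ℚ R] {T A B : SSym R V₀ V₁ →ₗ[R] SSym R W₀ W₁}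

/-- A map `T` with `Δ T = (T ⊗ A + B ⊗ T) Δ` (for example the difference of two coalgebra maps or
of two coderivations) which has no component in word lengths `0` and `1` is zero. -/
theorem eq_zero_of_proj
    (hT : ∀ x, comul R W₀ W₁ (T x) = TensorProduct.map T A (comul R V₀ V₁ x) +
      TensorProduct.map B T (comul R V₀ V₁ x))
    (h₀ : ∀ x, counit R W₀ W₁ (T x) = 0) (h₁ : ∀ x, proj R W₀ W₁ (T x) = 0) : T = 0 := by
  have key : ∀ n, comp R W₀ W₁ n ∘ₗ T = 0 := by
    intro n
    induction n with
    | zero =>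
      ext x
      simp [comp_zero, h₀]
    | succ n ih =>
      ext x
      apply succ_nsmul_cancel R (n := n)
      have e : proj R W₀ W₁ ∘ₗ T = 0 := LinearMap.ext h₁
      rw [LinearMap.comp_apply, succ_nsmul_comp, hT, map_add, eulerMap_map, eulerMap_map, ih, e]
      simp
  ext x
  exact eq_zero_of_comp fun n => LinearMap.congr_fun (key n) x

/-- A map `T` with `Δ T = (T ⊗ A + B ⊗ T) Δ` whose linear part is zero lowers the word
length. -/
theorem comp_eq_zero_of_linear
    (hT : ∀ x, comul R W₀ W₁ (T x) = TensorProduct.map T A (comul R V₀ V₁ x) +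
      TensorProduct.map B T (comul R V₀ V₁ x))
    (hA : ∀ n m, n < m → ∀ x ∈ words R V₀ V₁ n, comp R W₀ W₁ m (A x) = 0)
    (hB : proj R W₀ W₁ (B 1) = 0) (h₀ : T 1 = 0)
    (h₁ : ∀ v, proj R W₀ W₁ (T (ι R V₀ V₁ v)) = 0) {n m : ℕ} (hnm : n ≤ m)
    {x : SSym R V₀ V₁} (hx : x ∈ words R V₀ V₁ n) : comp R W₀ W₁ m (T x) = 0 := by
  have hw₀ : ∀ x ∈ words R V₀ V₁ 0, T x = 0 := fun x hx => by
    rw [eq_smul_of_mem_words_zero hx, map_smul, h₀, smul_zero]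
  induction m generalizing n x with
  | zero =>
    obtain rfl : n = 0 := by omega
    rw [hw₀ x hx, map_zero]
  | succ m ih =>
    apply succ_nsmul_cancel R (n := m)
    rw [succ_nsmul_comp, hT, map_add, eulerMap_map, eulerMap_map, smul_zero, map_comul_eq_zero _ hx,
      map_comul_eq_zero _ hx, map_zero, add_zero]
    · intro i j hij
      rcases Nat.eq_zero_or_pos i with rfl | hi
      · left
        intro y hy
        rw [eq_smul_of_mem_words_zero hy]
        simp [hB]
      · right
        intro y hy
        exact ih (by omega) hy
    · intro i j hij
      rcases i with _ | _ | i
      · left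
        intro y hy
        simp [hw₀ y hy]
      · left
        intro y hy
        rw [eq_ι_proj_of_mem_words hy]
        simp [h₁]
      · right
        intro y hy
        exact hA _ _ (by omega) y hy

end relative

/-! ### Cofreeness of the symmetric coalgebra -/

variable (R V₀ V₁) in
/-- Contraction of the right factor with the counit. -/
def counitRight : SSym R V₀ V₁ ⊗[R] SSym R V₀ V₁ →ₗ[R] SSym R V₀ V₁ :=
  (TensorProduct.rid R _).toLinearMap.comp
    (TensorProduct.map LinearMap.id (counit R V₀ V₁).toLinearMap)

theorem counitRight_tmul (x y : SSym R V₀ V₁) :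
    counitRight R V₀ V₁ (x ⊗ₜ y) = counit R V₀ V₁ y • x := by
  simp [counitRight]

theorem counitRight_comul (x : SSym R V₀ V₁) :
    counitRight R V₀ V₁ (comul R V₀ V₁ x) = x := by
  have h : (counitRight R V₀ V₁).comp (comul R V₀ V₁) = LinearMap.id := by
    apply linearMap_ext
    · simp [counitRight]
    · intro v x hx
      simp only [LinearMap.comp_apply, LinearMap.id_apply] at hx ⊢
      rw [comul_ι_mul]
      conv_rhs => rw [← hx]
      generalize comul R V₀ V₁ x = t
      induction t with
      | zero => simp
      | add x y hx hy => simp only [map_add, hx, hy, mul_add]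
      | tmul x y => simp [comulGen_tmul, counitRight_tmul]
  exact LinearMap.congr_fun h x

variable (r : SSym R V₀ V₁ →ₗ[R] W₀ × W₁)

/-- The map `x ⊗ y ↦ r(x) · B(y)`. -/
def mulMap (B : SSym R V₀ V₁ →ₗ[R] SSym R W₀ W₁) :
    SSym R V₀ V₁ ⊗[R] SSym R V₀ V₁ →ₗ[R] SSym R W₀ W₁ :=
  (LinearMap.mul' R _).comp (TensorProduct.map (ι R W₀ W₁ ∘ₗ r) B)

@[simp] theorem mulMap_tmul (B : SSym R V₀ V₁ →ₗ[R] SSym R W₀ W₁) (x y : SSym R V₀ V₁) :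
    mulMap r B (x ⊗ₜ y) = ι R W₀ W₁ (r x) * B y := by
  simp [mulMap]

/-- The map `x ⊗ (y ⊗ z) ↦ Δ(r x) (A y ⊗ B z)`. -/
def comulMulMap (A B : SSym R V₀ V₁ →ₗ[R] SSym R W₀ W₁) :
    SSym R V₀ V₁ ⊗[R] (SSym R V₀ V₁ ⊗[R] SSym R V₀ V₁) →ₗ[R]
      SSym R W₀ W₁ ⊗[R] SSym R W₀ W₁ :=
  TensorProduct.lift ((comulGen R W₀ W₁ ∘ₗ r).compl₂ (TensorProduct.map A B))

@[simp] theorem comulMulMap_tmul (A B : SSym R V₀ V₁ →ₗ[R] SSym R W₀ W₁) (x : SSym R V₀ V₁)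
    (t : SSym R V₀ V₁ ⊗[R] SSym R V₀ V₁) :
    comulMulMap r A B (x ⊗ₜ t) = comulGen R W₀ W₁ (r x) (TensorProduct.map A B t) := rfl

variable [Algebra ℚ R] {r}

/-- The identity `Δ(r * B) = (r * A) ⊗ B + A ⊗ (r * B)`, with both sides evaluated on the iterated
comultiplication. The second summand needs cocommutativity, to move the argument of `r` past that of
`A`; the identity is proved after doubling, as `swap₃` is twice the interchange. -/
theorem comulMulMap_comul₃ (hr : ∀ x, r (parity R V₀ V₁ x) = inv R W₀ W₁ (r x))
    {A : SSym R V₀ V₁ →ₗ[R] SSym R W₀ W₁} (B : SSym R V₀ V₁ →ₗ[R] SSym R W₀ W₁)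
    (hA : ∀ x, A (parity R V₀ V₁ x) = parity R W₀ W₁ (A x)) (x : SSym R V₀ V₁) :
    comulMulMap r A B (comul₃ R V₀ V₁ x) =
      TensorProduct.map (mulMap r A ∘ₗ comul R V₀ V₁) B (comul R V₀ V₁ x) +
      TensorProduct.map A (mulMap r B ∘ₗ comul R V₀ V₁) (comul R V₀ V₁ x) := by
  have e1 : TensorProduct.map (mulMap r A ∘ₗ comul R V₀ V₁) B (comul R V₀ V₁ x) =
      TensorProduct.map (mulMap r A) B ((TensorProduct.assoc R _ _ _).symm
        (comul₃ R V₀ V₁ x)) := by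
    rw [← comul_coassoc, LinearEquiv.symm_apply_apply, TensorProduct.map_map,
      LinearMap.comp_id]
  have e2 : TensorProduct.map A (mulMap r B ∘ₗ comul R V₀ V₁) (comul R V₀ V₁ x) =
      TensorProduct.map A (mulMap r B) (comul₃ R V₀ V₁ x) := by
    rw [comul₃, LinearMap.comp_apply, TensorProduct.map_map, LinearMap.comp_id]
  apply succ_nsmul_cancel R (n := 1)
  rw [e1, e2, nsmul_add, one_add_one_eq_two, ← map_nsmul (TensorProduct.map A (mulMap r B)),
    ← swap₃_comul₃]
  generalize comul₃ R V₀ V₁ x = t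
  induction t with
  | zero => simp
  | add x y hx hy =>
    simp only [map_add, smul_add] at hx hy ⊢
    rw [hx, hy]
    abel
  | tmul x s =>
    induction s with
    | zero => simp
    | add x y hx hy =>
      simp only [map_add, TensorProduct.tmul_add, smul_add] at hx hy ⊢
      rw [hx, hy]
      abel
    | tmul y z =>
      have s1 : r x + inv R W₀ W₁ (r x) = (2 : ℕ) • ((r x).1, (0 : W₁)) := by
        ext <;> simp [two_nsmul]
      have s2 : r x - inv R W₀ W₁ (r x) = (2 : ℕ) • ((0 : W₀), (r x).2) := by
        ext <;> simp [two_nsmul]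
      simp only [comulMulMap_tmul, TensorProduct.map_tmul, comulGen_tmul,
        TensorProduct.assoc_symm_tmul, mulMap_tmul, swap₃_tmul, map_add, hA, map_sub, hr]
      rw [← map_add, ← map_sub, s1, s2]
      simp only [map_nsmul, smul_mul_assoc, TensorProduct.tmul_smul, smul_add]
      abel

variable (r) in
/-- The component of word length `n` of the coalgebra map with projection `r`: the convolution
power `r ^ n / n!`. -/
def liftComp : ℕ → SSym R V₀ V₁ →ₗ[R] SSym R W₀ W₁
  | 0 => (LinearMap.toSpanSingleton R _ 1).comp (counit R V₀ V₁).toLinearMap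
  | n + 1 => algebraMap ℚ R ((n + 1 : ℚ)⁻¹) • mulMap r (liftComp n) ∘ₗ comul R V₀ V₁

theorem liftComp_zero (x : SSym R V₀ V₁) : liftComp r 0 x = counit R V₀ V₁ x • 1 := by
  simp [liftComp]

theorem liftComp_succ (n : ℕ) (x : SSym R V₀ V₁) :
    (n + 1) • liftComp r (n + 1) x = mulMap r (liftComp r n) (comul R V₀ V₁ x) :=
  succ_nsmul_inv_smul (R := R) n _

theorem liftComp_mem_words (n : ℕ) (x : SSym R V₀ V₁) :
    liftComp r n x ∈ words R W₀ W₁ n := by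
  induction n generalizing x with
  | zero => rw [liftComp_zero]; exact Submodule.smul_mem _ _ one_mem_words
  | succ n ih =>
    rw [eq_inv_smul_of_succ_nsmul_eq (R := R) (liftComp_succ n x)]
    apply Submodule.smul_mem
    induction comul R V₀ V₁ x with
    | zero => rw [map_zero]; exact zero_mem _
    | add x y hx hy => rw [map_add]; exact add_mem hx hy
    | tmul x y => rw [mulMap_tmul]; exact ι_mul_mem_words _ (ih y)

theorem liftComp_eq_zero (h1 : r 1 = 0) {n m : ℕ} (hmn : m < n) {x : SSym R V₀ V₁}
    (hx : x ∈ words R V₀ V₁ m) : liftComp r n x = 0 := by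
  induction n generalizing m x with
  | zero => omega
  | succ n ih =>
    apply succ_nsmul_cancel R (n := n)
    rw [liftComp_succ, smul_zero, mulMap, LinearMap.comp_apply, map_comul_eq_zero _ hx, map_zero]
    intro i j hij
    rcases Nat.eq_zero_or_pos i with rfl | hi
    · left
      intro y hy
      rw [eq_smul_of_mem_words_zero hy]
      simp [h1]
    · right
      intro y hy
      exact ih (by omega) hy

theorem liftComp_parity (hr : ∀ x, r (parity R V₀ V₁ x) = inv R W₀ W₁ (r x)) (n : ℕ)
    (x : SSym R V₀ V₁) :
    liftComp r n (parity R V₀ V₁ x) = parity R W₀ W₁ (liftComp r n x) := by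
  induction n generalizing x with
  | zero => simp [liftComp_zero]
  | succ n ih =>
    apply succ_nsmul_cancel R (n := n)
    rw [← map_nsmul (parity R W₀ W₁), liftComp_succ, liftComp_succ, comul_parity]
    induction comul R V₀ V₁ x with
    | zero => simp
    | add x y hx hy => simp only [map_add, hx, hy]
    | tmul x y => simp [hr, ih]

/-- The binomial formula `Δ (rⁿ / n!) = ∑ rⁱ / i! ⊗ rʲ / j!`, the sum being over `i + j = n`. -/
theorem comul_liftComp (hr : ∀ x, r (parity R V₀ V₁ x) = inv R W₀ W₁ (r x)) (n : ℕ)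
    (x : SSym R V₀ V₁) :
    comul R W₀ W₁ (liftComp r n x) = ∑ p ∈ Finset.HasAntidiagonal.antidiagonal n,
      TensorProduct.map (liftComp r p.1) (liftComp r p.2) (comul R V₀ V₁ x) := by
  induction n generalizing x with
  | zero =>
    rw [liftComp_zero, map_smul, comul_one, Finset.Nat.antidiagonal_zero, Finset.sum_singleton]
    conv_lhs => rw [← counitLeft_comul x]
    induction comul R V₀ V₁ x with
    | zero => simp
    | add x y hx hy => simp only [map_add, add_smul, hx, hy]
    | tmul x y =>
      simp [counitLeft, liftComp_zero, mul_smul, TensorProduct.smul_tmul',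
        smul_comm (counit R V₀ V₁ x) (counit R V₀ V₁ y)]
  | succ n ih =>
    apply succ_nsmul_cancel R (n := n)
    have e : ∀ t, comul R W₀ W₁ (mulMap r (liftComp r n) t) =
        ∑ p ∈ Finset.HasAntidiagonal.antidiagonal n, comulMulMap r (liftComp r p.1) (liftComp r p.2)
          (TensorProduct.map LinearMap.id (comul R V₀ V₁) t) := by
      intro t
      induction t with
      | zero => simp
      | add x y hx hy => simp only [map_add, hx, hy, Finset.sum_add_distrib]
      | tmul x y => simp [comul_ι_mul, ih, map_sum]
    have e' : ∀ n, mulMap r (liftComp r n) ∘ₗ comul R V₀ V₁ = (n + 1) • liftComp r (n + 1) :=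
      fun n => LinearMap.ext fun x => (liftComp_succ n x).symm
    rw [← map_nsmul (comul R W₀ W₁), liftComp_succ, e]
    let f : ℕ × ℕ → SSym R W₀ W₁ ⊗[R] SSym R W₀ W₁ := fun p =>
      TensorProduct.map (liftComp r p.1) (liftComp r p.2) (comul R V₀ V₁ x)
    have h1 : ∑ p ∈ Finset.HasAntidiagonal.antidiagonal (n + 1), p.1 • f p =
        ∑ p ∈ Finset.HasAntidiagonal.antidiagonal n, (p.1 + 1) • f (p.1 + 1, p.2) := by
      rw [Finset.Nat.sum_antidiagonal_succ]
      simp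
    have h2 : ∑ p ∈ Finset.HasAntidiagonal.antidiagonal (n + 1), p.2 • f p =
        ∑ p ∈ Finset.HasAntidiagonal.antidiagonal n, (p.2 + 1) • f (p.1, p.2 + 1) := by
      rw [Finset.Nat.sum_antidiagonal_succ']
      simp
    have h3 : (n + 1) • ∑ p ∈ Finset.HasAntidiagonal.antidiagonal (n + 1), f p =
        ∑ p ∈ Finset.HasAntidiagonal.antidiagonal (n + 1), p.1 • f p +
          ∑ p ∈ Finset.HasAntidiagonal.antidiagonal (n + 1), p.2 • f p := by
      rw [Finset.smul_sum, ← Finset.sum_add_distrib]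
      refine Finset.sum_congr rfl fun p hp => ?_
      rw [← add_smul, Finset.HasAntidiagonal.mem_antidiagonal.mp hp]
    refine Eq.trans ?_ h3.symm
    rw [h1, h2, ← Finset.sum_add_distrib]
    refine Finset.sum_congr rfl fun p _ => ?_
    have h4 := comulMulMap_comul₃ hr (liftComp r p.2) (liftComp_parity hr p.1) x
    rw [e', e'] at h4
    refine h4.trans ?_
    simp only [TensorProduct.map_smul_left, TensorProduct.map_smul_right, f,
      ← Nat.cast_smul_eq_nsmul R, LinearMap.smul_apply]

variable (r) in
/-- The coalgebra map `Sym V → Sym W` with projection `r : Sym V → W`, the exponential of `r` for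
the convolution product. -/
def coalgLift : SSym R V₀ V₁ →ₗ[R] SSym R W₀ W₁ :=
  (Polynomial.lsum fun n => ∑ k ∈ Finset.range (n + 1), liftComp r k).comp
    (weight R V₀ V₁).toLinearMap

theorem coalgLift_of_mem_words {n : ℕ} {x : SSym R V₀ V₁} (hx : x ∈ words R V₀ V₁ n) :
    coalgLift r x = ∑ k ∈ Finset.range (n + 1), liftComp r k x := by
  have h : weight R V₀ V₁ x = Polynomial.monomial n x := by
    ext m
    rw [← comp_apply, comp_of_mem hx, Polynomial.coeff_monomial]
    simp [eq_comm]
  rw [coalgLift, LinearMap.comp_apply, AlgHom.toLinearMap_apply, h, Polynomial.lsum_apply]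
  refine (Polynomial.sum_monomial_index x _ (LinearMap.map_zero _)).trans ?_
  rw [LinearMap.sum_apply]

theorem coalgLift_eq_sum (h1 : r 1 = 0) {n N : ℕ} (hN : n < N) {x : SSym R V₀ V₁}
    (hx : x ∈ words R V₀ V₁ n) :
    coalgLift r x = ∑ k ∈ Finset.range N, liftComp r k x := by
  rw [coalgLift_of_mem_words hx]
  refine Finset.sum_subset (Finset.range_mono hN) fun k _ hk => ?_
  exact liftComp_eq_zero h1 (by simpa using hk) hx

theorem coalgLift_one (h1 : r 1 = 0) : coalgLift r 1 = 1 := by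
  rw [coalgLift_eq_sum h1 one_pos one_mem_words]
  simp [liftComp_zero]

theorem coalgLift_parity (hr : ∀ x, r (parity R V₀ V₁ x) = inv R W₀ W₁ (r x))
    (x : SSym R V₀ V₁) :
    coalgLift r (parity R V₀ V₁ x) = parity R W₀ W₁ (coalgLift r x) := by
  induction x using words_induction with
  | add x y hx hy => simp only [map_add, hx, hy]
  | mem n x hx =>
    rw [coalgLift_of_mem_words hx, coalgLift_of_mem_words (parity_mem_words hx), map_sum]
    simp only [liftComp_parity hr]

theorem counit_coalgLift (x : SSym R V₀ V₁) :
    counit R W₀ W₁ (coalgLift r x) = counit R V₀ V₁ x := by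
  induction x using words_induction with
  | add x y hx hy => simp only [map_add, hx, hy]
  | mem n x hx =>
    rw [coalgLift_of_mem_words hx, map_sum, Finset.sum_range_succ', Finset.sum_eq_zero]
    · simp [liftComp_zero]
    · intro k _
      exact counit_of_mem_words (liftComp_mem_words (k + 1) x)

theorem liftComp_one (x : SSym R V₀ V₁) : liftComp r 1 x = ι R W₀ W₁ (r x) := by
  have h := liftComp_succ (r := r) 0 x
  rw [zero_add, one_smul] at h
  rw [h]
  conv_rhs => rw [← counitRight_comul x]
  induction comul R V₀ V₁ x with
  | zero => simp
  | add x y hx hy => simp only [map_add, hx, hy]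
  | tmul x y => simp [counitRight_tmul, liftComp_zero]

theorem proj_coalgLift (h1 : r 1 = 0) (x : SSym R V₀ V₁) :
    proj R W₀ W₁ (coalgLift r x) = r x := by
  induction x using words_induction with
  | add x y hx hy => simp only [map_add, hx, hy]
  | mem n x hx =>
    rw [coalgLift_eq_sum h1 (Nat.lt_succ_of_lt (Nat.lt_succ_self n)) hx, map_sum,
      Finset.sum_eq_single 1]
    · rw [liftComp_one, proj_ι]
    · intro k _ hk
      exact proj_of_mem_words hk (liftComp_mem_words k x)
    · intro h
      simp at h

theorem comul_coalgLift (hr : ∀ x, r (parity R V₀ V₁ x) = inv R W₀ W₁ (r x)) (h1 : r 1 = 0)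
    (x : SSym R V₀ V₁) : comul R W₀ W₁ (coalgLift r x) =
      TensorProduct.map (coalgLift r) (coalgLift r) (comul R V₀ V₁ x) := by
  induction x using words_induction with
  | add x y hx hy => simp only [map_add, hx, hy]
  | mem n x hx =>
    let T := ∑ k ∈ Finset.range (n + 1), liftComp r k
    -- on words of length at most `n` the lift agrees with its truncation
    have hT : ∀ m ≤ n, ∀ y ∈ words R V₀ V₁ m, (coalgLift r - T) y = 0 := by
      intro m hm y hy
      rw [LinearMap.sub_apply, coalgLift_eq_sum h1 (Nat.lt_succ_of_le hm) hy,
        LinearMap.sum_apply, sub_self]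
    have e1 : TensorProduct.map (coalgLift r) (coalgLift r) (comul R V₀ V₁ x) =
        TensorProduct.map T T (comul R V₀ V₁ x) := by
      have a1 : TensorProduct.map (coalgLift r - T) (coalgLift r) (comul R V₀ V₁ x) = 0 :=
        map_comul_eq_zero (fun i j hij => Or.inl (hT i (by omega))) hx
      have a2 : TensorProduct.map T (coalgLift r - T) (comul R V₀ V₁ x) = 0 :=
        map_comul_eq_zero (fun i j hij => Or.inr (hT j (by omega))) hx
      have a3 := LinearMap.congr_fun
        (TensorProduct.map_add_left (coalgLift r - T) T (coalgLift r)) (comul R V₀ V₁ x)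
      have a4 := LinearMap.congr_fun
        (TensorProduct.map_add_right T (coalgLift r - T) T) (comul R V₀ V₁ x)
      rw [LinearMap.add_apply, a1, zero_add, sub_add_cancel] at a3
      rw [LinearMap.add_apply, a2, zero_add, sub_add_cancel] at a4
      rw [a3, a4]
    let f : ℕ → ℕ → SSym R W₀ W₁ ⊗[R] SSym R W₀ W₁ := fun i j =>
      TensorProduct.map (liftComp r i) (liftComp r j) (comul R V₀ V₁ x)
    have e2 : TensorProduct.map T T (comul R V₀ V₁ x) =
        ∑ i ∈ Finset.range (n + 1), ∑ j ∈ Finset.range (n + 1), f i j := by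
      simp only [T, f]
      generalize comul R V₀ V₁ x = t
      induction t with
      | zero => simp
      | add x y hx hy => simp only [map_add, hx, hy, Finset.sum_add_distrib]
      | tmul x y =>
        simp only [TensorProduct.map_tmul, LinearMap.sum_apply, TensorProduct.sum_tmul,
          TensorProduct.tmul_sum]
        exact Finset.sum_comm
    rw [e1, e2, coalgLift_of_mem_words hx, map_sum]
    simp only [comul_liftComp hr]
    have e3 : ∀ m, ∑ p ∈ Finset.HasAntidiagonal.antidiagonal m, f p.1 p.2 =
        ∑ i ∈ Finset.range (m + 1), f i (m - i) := fun m =>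
      Finset.Nat.sum_antidiagonal_eq_sum_range_succ f m
    refine (Finset.sum_congr rfl fun m _ => e3 m).trans ?_
    rw [Finset.sum_range_diag_flip]
    refine Finset.sum_congr rfl fun i _ => ?_
    refine Finset.sum_subset (Finset.range_mono (Nat.sub_le _ _)) fun j _ hj => ?_
    refine map_comul_eq_zero (fun a b hab => ?_) hx
    simp only [Finset.mem_range, not_lt] at hj
    rcases lt_or_ge a i with h | h
    · exact Or.inl fun y hy => liftComp_eq_zero h1 h hy
    · exact Or.inr fun y hy => liftComp_eq_zero h1 (by omega) hy

end SSym

theorem eq_zero_of_eq_neg (R : Type u) [CommRing R] [Algebra ℚ R] {M : Type*} [AddCommGroup M]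
    [Module R M] {x : M} (h : x = -x) : x = 0 := by
  apply succ_nsmul_cancel R (n := 1)
  rw [smul_zero, one_add_one_eq_two, two_nsmul]
  nth_rewrite 1 [h]
  exact neg_add_cancel x

namespace SSym

variable {R : Type u} [CommRing R]
variable {V₀ V₁ : Type v} [AddCommGroup V₀] [Module R V₀] [AddCommGroup V₁] [Module R V₁]
variable {W₀ W₁ : Type v} [AddCommGroup W₀] [Module R W₀] [AddCommGroup W₁] [Module R W₁]

/-! ### Functoriality of the symmetric coalgebra -/

theorem inv_inv_apply (v : V₀ × V₁) : inv R V₀ V₁ (inv R V₀ V₁ v) = v := by simp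

section map

variable [Algebra ℚ R] (f : V₀ × V₁ →ₗ[R] W₀ × W₁)

theorem snd_eq_zero_of_even {f : V₀ × V₁ →ₗ[R] W₀ × W₁}
    (hf : ∀ v, f (inv R V₀ V₁ v) = inv R W₀ W₁ (f v)) (a : V₀) : (f (a, 0)).2 = 0 := by
  apply eq_zero_of_eq_neg R
  have h := congrArg Prod.snd (hf (a, 0))
  simpa using h

theorem fst_eq_zero_of_even {f : V₀ × V₁ →ₗ[R] W₀ × W₁}
    (hf : ∀ v, f (inv R V₀ V₁ v) = inv R W₀ W₁ (f v)) (b : V₁) : (f (0, b)).1 = 0 := by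
  apply eq_zero_of_eq_neg R
  have h := congrArg Prod.fst (hf (0, b))
  have e : inv R V₀ V₁ ((0 : V₀), b) = -(0, b) := by simp
  rw [e, map_neg] at h
  simpa using h.symm

/-- The map `Sym V → Sym W` induced by an even linear map `V → W`. -/
def map (hf : ∀ v, f (inv R V₀ V₁ v) = inv R W₀ W₁ (f v)) : SSym R V₀ V₁ →ₐ[R] SSym R W₀ W₁ :=
  lift (ι R W₀ W₁ ∘ₗ f)
    (fun a v => by
      have e : f (a, 0) = ((f (a, 0)).1, 0) := Prod.ext rfl (snd_eq_zero_of_even hf a)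
      rw [LinearMap.comp_apply, LinearMap.comp_apply, e, ι_even_mul])
    (fun b c => by
      have e : ∀ b, f (0, b) = (0, (f (0, b)).2) := fun b =>
        Prod.ext (fst_eq_zero_of_even hf b) rfl
      rw [LinearMap.comp_apply, LinearMap.comp_apply, e b, e c, ι_odd_mul])

variable {f} (hf : ∀ v, f (inv R V₀ V₁ v) = inv R W₀ W₁ (f v))

@[simp] theorem map_ι (v : V₀ × V₁) : map f hf (ι R V₀ V₁ v) = ι R W₀ W₁ (f v) := by
  simp [map]

theorem map_parity (x : SSym R V₀ V₁) :
    map f hf (parity R V₀ V₁ x) = parity R W₀ W₁ (map f hf x) := by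
  have h : (map f hf).comp (parity R V₀ V₁) = (parity R W₀ W₁).comp (map f hf) := by
    apply algHom_ext
    intro v
    simpa using congrArg (ι R W₀ W₁) (hf v)
  exact DFunLike.congr_fun h x

theorem comul_map (x : SSym R V₀ V₁) : comul R W₀ W₁ (map f hf x) =
    TensorProduct.map (map f hf).toLinearMap (map f hf).toLinearMap (comul R V₀ V₁ x) := by
  have h : comul R W₀ W₁ ∘ₗ (map f hf).toLinearMap =
      TensorProduct.map (map f hf).toLinearMap (map f hf).toLinearMap ∘ₗ comul R V₀ V₁ := by
    apply linearMap_ext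
    · simp
    · intro v x hx
      simp only [LinearMap.comp_apply, AlgHom.toLinearMap_apply] at hx ⊢
      rw [map_mul, map_ι, comul_ι_mul, comul_ι_mul, hx]
      generalize comul R V₀ V₁ x = t
      have e0 : f (v.1, 0) = ((f v).1, 0) := by
        refine Prod.ext ?_ (snd_eq_zero_of_even hf _)
        conv_rhs => rw [DGLie.split' v, map_add, Prod.fst_add, fst_eq_zero_of_even hf, add_zero]
      have e1 : f (0, v.2) = (0, (f v).2) := by
        refine Prod.ext (fst_eq_zero_of_even hf _) ?_
        conv_rhs => rw [DGLie.split' v, map_add, Prod.snd_add, snd_eq_zero_of_even hf, zero_add]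
      induction t with
      | zero => simp
      | add x y hx hy => simp only [map_add, hx, hy]
      | tmul x y => simp [comulGen_tmul, map_parity, e0, e1]
  exact LinearMap.congr_fun h x

theorem map_mem_words {n : ℕ} {x : SSym R V₀ V₁} (hx : x ∈ words R V₀ V₁ n) :
    map f hf x ∈ words R W₀ W₁ n := by
  induction n generalizing x with
  | zero =>
    refine words_zero_induction (fun r => ?_) hx
    rw [map_smul, map_one]
    exact Submodule.smul_mem _ r one_mem_words
  | succ n ih =>
    refine words_succ_induction (fun x y hx hy => ?_) (fun v x hx => ?_) hx
    · rw [map_add]; exact add_mem hx hy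
    · rw [map_mul, map_ι]; exact ι_mul_mem_words _ (ih hx)

end map

/-- A linear map that preserves the word length commutes with the projections onto the
homogeneous parts. -/
theorem comp_comm {T : SSym R V₀ V₁ →ₗ[R] SSym R W₀ W₁}
    (hT : ∀ n, ∀ x ∈ words R V₀ V₁ n, T x ∈ words R W₀ W₁ n) (n : ℕ) (x : SSym R V₀ V₁) :
    comp R W₀ W₁ n (T x) = T (comp R V₀ V₁ n x) := by
  induction x using words_induction with
  | add x y hx hy => simp only [map_add, hx, hy]
  | mem m x hx =>
    rw [comp_of_mem hx, comp_of_mem (hT m x hx)]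
    split_ifs <;> simp

theorem comp_eq_zero_of_mem_filt {T : SSym R V₀ V₁ →ₗ[R] SSym R W₀ W₁} {n m : ℕ}
    (hT : ∀ k ≤ n, ∀ x ∈ words R V₀ V₁ k, comp R W₀ W₁ m (T x) = 0) {x : SSym R V₀ V₁}
    (hx : x ∈ filt R V₀ V₁ n) : comp R W₀ W₁ m (T x) = 0 := by
  rw [← sum_comp hx, map_sum, map_sum]
  refine Finset.sum_eq_zero fun k hk => hT k ?_ _ (comp_mem k x)
  simpa [Nat.lt_succ_iff] using hk

end SSym

namespace LInfAlg

open SSym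

variable {R : Type u} [CommRing R]

/-! ### The linear part of an `L∞`-algebra -/

theorem counit_Q (g : LInfAlg.{u, v} R) (x : g.S) : counit R g.even g.odd (g.Q x) = 0 := by
  have h := counitLeft_comul (g.Q x)
  have e : counitLeft R g.even g.odd (TensorProduct.map (parity R g.even g.odd).toLinearMap g.Q
      (comul R g.even g.odd x)) = g.Q x := by
    conv_rhs => rw [← counitLeft_comul x]
    induction comul R g.even g.odd x with
    | zero => simp
    | add x y hx hy => simp only [map_add, hx, hy]
    | tmul x y => simp [counitLeft]
  rw [g.Q_comul, map_add, e, add_eq_right] at h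
  have h' := congrArg (counit R g.even g.odd) h
  rw [map_zero] at h'
  rw [← h']
  conv_lhs => rw [← counitRight_comul x]
  induction comul R g.even g.odd x with
  | zero => simp
  | add x y hx hy => simp only [map_add, hx, hy]
  | tmul x y => simp [counitLeft, counitRight_tmul, mul_comm]

theorem diff_inv (g : LInfAlg.{u, v} R) (v : g.V) :
    g.diff (inv R g.even g.odd v) = -inv R g.even g.odd (g.diff v) := by
  have h := congrArg (proj R g.even g.odd) (g.Q_parity (ι R g.even g.odd v))
  rwa [map_neg, proj_parity, parity_ι] at h

theorem Hom.linear_inv {g h : LInfAlg.{u, v} R} (f : Hom g h) (v : g.V) :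
    f.linear (inv R g.even g.odd v) = inv R h.even h.odd (f.linear v) := by
  have e := congrArg (proj R h.even h.odd) (f.F_parity (ι R g.even g.odd v))
  rwa [proj_parity, parity_ι] at e

variable [Algebra ℚ R]

theorem diff_diff (g : LInfAlg.{u, v} R) (v : g.V) : g.diff (g.diff v) = 0 := by
  apply ι_injective (R := R)
  rw [← g.Q_ι, ← g.Q_ι, g.Q_Q, map_zero]

theorem diff_even (g : LInfAlg.{u, v} R) (a : g.even) : (g.diff (a, 0)).1 = 0 := by
  apply eq_zero_of_eq_neg R
  simpa using congrArg Prod.fst (g.diff_inv (a, 0))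

theorem diff_odd (g : LInfAlg.{u, v} R) (b : g.odd) : (g.diff (0, b)).2 = 0 := by
  apply eq_zero_of_eq_neg R
  have h := congrArg Prod.snd (g.diff_inv (0, b))
  have e : inv R g.even g.odd ((0 : g.even), b) = -(0, b) := by simp
  rw [e, map_neg] at h
  simpa [eq_comm] using congrArg Neg.neg h

/-- The abelian dg Lie algebra which consists of the complex underlying an `L∞`-algebra. -/
@[reducible] def linearPart (g : LInfAlg.{u, v} R) : DGLie.{u, v} R where
  even := g.odd
  odd := g.even
  d := (LinearEquiv.prodComm R g.even g.odd).toLinearMap.comp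
    (g.diff.comp (LinearEquiv.prodComm R g.odd g.even).toLinearMap)
  br := 0
  d_even a := g.diff_odd a
  d_odd b := g.diff_even b
  br_even_even _ _ := rfl
  br_even_odd _ _ := rfl
  br_odd_odd _ _ := rfl
  skew_even _ _ := by simp
  skew_odd _ _ := rfl
  d_d x := congrArg Prod.swap (g.diff_diff x.swap)
  leibniz _ _ := by simp
  jacobi_even _ _ _ := by simp
  jacobi_odd _ _ _ := by simp

theorem linearPart_isAbelian (g : LInfAlg.{u, v} R) : g.linearPart.IsAbelian := fun _ _ => rfl

end LInfAlg

namespace DGLie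

open SSym

variable {R : Type u} [CommRing R] (L : DGLie.{u, v} R)

theorem toLInfAlg_diff : L.toLInfAlg.diff = L.q₁ := by
  have h : ∀ v : L.odd × L.even, proj R L.odd L.even (L.ce (L.i v)) = L.q₁ v := by
    intro v
    rw [← mul_one (L.i v), ce_mul]
    simp
  exact LinearMap.ext h

theorem ad₀_eq_zero (h : L.IsAbelian) (a : L.odd) : L.ad₀ a = 0 := by
  apply linearMap_ext
  · simp
  · intro z x hx
    have e : L.q₂ (a, 0) z = 0 := by rw [q₂_apply, h]; rfl
    rw [ad₀_mul, hx, e]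
    simp

theorem ad₁_eq_zero (h : L.IsAbelian) (c : L.even) : L.ad₁ c = 0 := by
  apply linearMap_ext
  · simp
  · intro z x hx
    have e : L.q₂ (0, c) z = 0 := by rw [q₂_apply, h]; rfl
    rw [ad₁_mul, hx, e]
    simp

theorem ce_mul_of_isAbelian (h : L.IsAbelian) (v : L.odd × L.even) (x : L.S) :
    L.ce (L.i v * x) = L.i (L.q₁ v) * x + L.i (v.1, -v.2) * L.ce x := by
  rw [ce_mul, L.ad₀_eq_zero h, L.ad₁_eq_zero h]
  simp

theorem proj_ce (h : L.IsAbelian) (x : L.S) :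
    proj R L.odd L.even (L.ce x) = L.q₁ (proj R L.odd L.even x) := by
  have e : proj R L.odd L.even ∘ₗ L.ce = L.q₁ ∘ₗ proj R L.odd L.even := by
    apply linearMap_ext
    · simp
    · intro v x _
      have hc : counit R L.odd L.even (L.ce x) = 0 := L.toLInfAlg.counit_Q x
      simp only [LinearMap.comp_apply]
      rw [L.ce_mul_of_isAbelian h, map_add, proj_ι_mul, proj_ι_mul, proj_ι_mul, hc, zero_smul,
        add_zero, map_smul]
  exact LinearMap.congr_fun e x

end DGLie

namespace LInfAlg

open SSym

variable {R : Type u} [CommRing R] [Algebra ℚ R] (g : LInfAlg.{u, v} R)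

/-- The linear part of the codifferential, as a coderivation of `Sym V`; it is also a
derivation. -/
def linQ : g.S →ₗ[R] g.S := g.linearPart.ce

theorem linQ_one : g.linQ 1 = 0 := g.linearPart.ce_one

theorem linQ_ι_mul (v : g.V) (x : g.S) : g.linQ (ι R g.even g.odd v * x) =
    ι R g.even g.odd (g.diff v) * x + ι R g.even g.odd (inv R g.even g.odd v) * g.linQ x :=
  g.linearPart.ce_mul_of_isAbelian g.linearPart_isAbelian v x

theorem linQ_ι (v : g.V) : g.linQ (ι R g.even g.odd v) = ι R g.even g.odd (g.diff v) := by
  rw [← mul_one (ι R g.even g.odd v), linQ_ι_mul, linQ_one]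
  simp

theorem linQ_comul (x : g.S) : comul R g.even g.odd (g.linQ x) =
    TensorProduct.map g.linQ LinearMap.id (comul R g.even g.odd x) +
      TensorProduct.map (parity R g.even g.odd).toLinearMap g.linQ (comul R g.even g.odd x) :=
  g.linearPart.comul_ce x

theorem linQ_linQ (x : g.S) : g.linQ (g.linQ x) = 0 := g.linearPart.ce_ce x

theorem counit_linQ (x : g.S) : counit R g.even g.odd (g.linQ x) = 0 :=
  g.linearPart.toLInfAlg.counit_Q x

theorem proj_linQ (x : g.S) :
    proj R g.even g.odd (g.linQ x) = g.diff (proj R g.even g.odd x) :=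
  g.linearPart.proj_ce g.linearPart_isAbelian x

theorem linQ_mem_words {n : ℕ} {x : g.S} (hx : x ∈ words R g.even g.odd n) :
    g.linQ x ∈ words R g.even g.odd n := by
  induction n generalizing x with
  | zero =>
    refine words_zero_induction (fun r => ?_) hx
    rw [map_smul, linQ_one, smul_zero]
    exact zero_mem _
  | succ n ih =>
    refine words_succ_induction (fun x y hx hy => ?_) (fun v x hx => ?_) hx
    · rw [map_add]; exact add_mem hx hy
    · rw [linQ_ι_mul]
      exact add_mem (ι_mul_mem_words _ hx) (ι_mul_mem_words _ (ih hx))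

theorem comp_linQ (n : ℕ) (x : g.S) :
    comp R g.even g.odd n (g.linQ x) = g.linQ (comp R g.even g.odd n x) :=
  comp_comm (fun _ _ => g.linQ_mem_words) n x

/-! ### Leading terms -/

/-- The leading term of `Q x` is that of the linear part of `Q`. -/
theorem comp_Q {n m : ℕ} (h : n ≤ m) {x : g.S} (hx : x ∈ filt R g.even g.odd n) :
    comp R g.even g.odd m (g.Q x) = g.linQ (comp R g.even g.odd m x) := by
  have hT : comp R g.even g.odd m ((g.Q - g.linQ) x) = 0 := by
    refine comp_eq_zero_of_mem_filt (fun k hk y hy => ?_) hx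
    refine comp_eq_zero_of_linear (A := LinearMap.id)
      (B := (parity R g.even g.odd).toLinearMap) (fun x => ?_) ?_ ?_ ?_ ?_ (hk.trans h) hy
    · rw [LinearMap.sub_apply, map_sub, g.Q_comul, linQ_comul]
      induction comul R g.even g.odd x with
      | zero => simp
      | add x y hx hy =>
        simp only [map_add] at hx hy ⊢
        rw [← sub_eq_zero] at hx hy ⊢
        apply DGLie.eq_zero_of_add hx hy
        abel
      | tmul x y =>
        simp only [TensorProduct.map_tmul, LinearMap.sub_apply, TensorProduct.sub_tmul,
          TensorProduct.tmul_sub]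
        abel
    · intro n m h x hx
      exact comp_of_ne h.ne' hx
    · simp
    · rw [LinearMap.sub_apply, g.Q_one, linQ_one, sub_zero]
    · intro v
      rw [LinearMap.sub_apply, g.Q_ι, linQ_ι, sub_self, map_zero]
  rw [LinearMap.sub_apply, map_sub, comp_linQ, sub_eq_zero] at hT
  exact hT

theorem Q_mem_filt {n : ℕ} {x : g.S} (hx : x ∈ filt R g.even g.odd n) :
    g.Q x ∈ filt R g.even g.odd n := fun m hm => by
  rw [g.comp_Q hm.le hx, hx m hm, map_zero]

namespace Hom

variable {g} {h : LInfAlg.{u, v} R} (f : Hom g h)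

/-- The leading term of an `L∞`-morphism is given by its linear part. -/
theorem comp_F {n m : ℕ} (hnm : n ≤ m) {x : g.S} (hx : x ∈ filt R g.even g.odd n) :
    comp R h.even h.odd m (f.F x) =
      SSym.map f.linear f.linear_inv (comp R g.even g.odd m x) := by
  let M := SSym.map f.linear f.linear_inv
  have hT : comp R h.even h.odd m ((f.F - M.toLinearMap) x) = 0 := by
    refine comp_eq_zero_of_mem_filt (fun k hk y hy => ?_) hx
    refine comp_eq_zero_of_linear (A := M.toLinearMap)
      (B := f.F) (fun x => ?_) ?_ ?_ ?_ ?_ (hk.trans hnm) hy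
    · rw [LinearMap.sub_apply, map_sub, f.F_comul, AlgHom.toLinearMap_apply, comul_map]
      induction comul R g.even g.odd x with
      | zero => simp
      | add x y hx hy =>
        simp only [map_add] at hx hy ⊢
        rw [add_sub_add_comm, hx, hy]
        abel
      | tmul x y =>
        simp only [TensorProduct.map_tmul, LinearMap.sub_apply, TensorProduct.sub_tmul,
          TensorProduct.tmul_sub]
        simp [M]
    · intro n m h x hx
      exact comp_of_ne h.ne' (map_mem_words _ hx)
    · rw [f.F_one, proj_one]
    · rw [LinearMap.sub_apply, f.F_one, AlgHom.toLinearMap_apply, map_one, sub_self]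
    · intro v
      rw [LinearMap.sub_apply, f.F_ι, AlgHom.toLinearMap_apply, map_ι, sub_self, map_zero]
  rw [LinearMap.sub_apply, map_sub, sub_eq_zero] at hT
  exact hT.trans (comp_comm (T := M.toLinearMap) (fun _ _ => map_mem_words _) m x)

theorem F_mem_filt {n : ℕ} {x : g.S} (hx : x ∈ filt R g.even g.odd n) :
    f.F x ∈ filt R h.even h.odd n := fun m hm => by
  rw [f.comp_F hm.le hx, hx m hm, map_zero]

end Hom

/-! ### Two criteria -/

/-- The map `H(V, d) → H(Sym V, Q)` is injective: no cocycle of `V` becomes exact in `Sym V` unless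
it is exact in `V`. -/
def InjectiveUnit : Prop :=
  ∀ x v, g.Q x = ι R g.even g.odd v → v ∈ LinearMap.range g.diff

/-- Every cocycle of `Symⁿ V` for the linear part of `Q` is the leading term of a cocycle
for `Q`. -/
def LiftsCocycles : Prop :=
  ∀ n, ∀ ξ ∈ words R g.even g.odd n, g.linQ ξ = 0 →
    ∃ ω ∈ filt R g.even g.odd n, comp R g.even g.odd n ω = ξ ∧ g.Q ω = 0

variable {g}

theorem diff_proj_of_mem_filt_one {x : g.S} (hx : x ∈ filt R g.even g.odd 1) :
    g.Q x = ι R g.even g.odd (g.diff (proj R g.even g.odd x)) := by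
  conv_lhs => rw [← sum_comp hx]
  rw [Finset.sum_range_succ, Finset.sum_range_one, comp_one_eq, comp_zero, map_add, map_smul,
    g.Q_one, smul_zero, zero_add, g.Q_ι]

/-- In a relation `Q x = v` the leading term of `x` can be removed, by a cocycle with the same
leading term, until `x` has length one. -/
theorem LiftsCocycles.injectiveUnit (hg : g.LiftsCocycles) : g.InjectiveUnit := by
  intro x v hx
  obtain ⟨n, hn⟩ := exists_mem_filt x
  replace hn := filt_mono (Nat.le_succ n) hn
  induction n generalizing x with
  | zero =>
    rw [diff_proj_of_mem_filt_one hn] at hx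
    exact ⟨_, ι_injective hx⟩
  | succ n ih =>
    have h0 : g.linQ (comp R g.even g.odd (n + 1 + 1) x) = 0 := by
      rw [← g.comp_Q le_rfl hn, hx]
      exact comp_of_ne (by omega) (ι_mem_words v)
    obtain ⟨ω, hω, hc, hQ⟩ := hg _ _ (comp_mem _ x) h0
    refine ih (x - ω) (by rw [map_sub, hQ, sub_zero, hx]) (mem_filt_of_succ (sub_mem hn hω) ?_)
    rw [map_sub, hc, sub_self]

/-- `InjectiveUnit` passes to the source of a morphism which is injective on cohomology. -/
theorem InjectiveUnit.of_injective {g₁ : LInfAlg.{u, v} R} (hg : g.InjectiveUnit) (f : Hom g₁ g)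
    (hf : Function.Injective f.cohomologyMap) : g₁.InjectiveUnit := by
  intro x v hx
  have hv : g₁.diff v = 0 := by
    apply ι_injective (R := R)
    rw [← g₁.Q_ι, ← hx, g₁.Q_Q, map_zero]
  have h1 : g.Q (f.F x) = ι R g.even g.odd (f.linear v) := by rw [← f.F_Q, hx, f.F_ι]
  let c : g₁.cohomology := Submodule.Quotient.mk ⟨v, hv⟩
  have h2 : f.cohomologyMap c = 0 := (Submodule.Quotient.mk_eq_zero _).mpr (hg _ _ h1)
  have h3 : c = 0 := hf (h2.trans (map_zero _).symm)
  exact (Submodule.Quotient.mk_eq_zero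
    ((LinearMap.range g₁.diff).submoduleOf (LinearMap.ker g₁.diff))).mp h3

end LInfAlg

/-! ### Linear algebra of complexes over a field -/

section linearAlgebra

variable {k : Type*} [Field k] {S V V' : Type*} [AddCommGroup S] [Module k S] [AddCommGroup V]
  [Module k V] [AddCommGroup V'] [Module k V']

theorem LinearMap.exists_generalizedInverse (d : V →ₗ[k] V') :
    ∃ s : V' →ₗ[k] V, ∀ v, d (s (d v)) = d v := by
  obtain ⟨a, ha⟩ := d.rangeRestrict.exists_rightInverse_of_surjective d.range_rangeRestrict
  obtain ⟨s, hs⟩ := LinearMap.exists_extend a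
  refine ⟨s, fun v => ?_⟩
  have h1 := LinearMap.congr_fun hs ⟨d v, v, rfl⟩
  have h2 := congrArg Subtype.val (LinearMap.congr_fun ha ⟨d v, v, rfl⟩)
  simp only [LinearMap.comp_apply, Submodule.subtype_apply] at h1
  rw [h1]
  exact h2

theorem LinearMap.exists_factor {f : V →ₗ[k] S} {g : V →ₗ[k] V'} (h : ∀ v, f v = 0 → g v = 0) :
    ∃ φ : S →ₗ[k] V', ∀ v, φ (f v) = g v := by
  obtain ⟨s, hs⟩ := f.exists_generalizedInverse
  refine ⟨g ∘ₗ s, fun v => ?_⟩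
  have h1 := h (s (f v) - v) (by rw [map_sub, hs, sub_self])
  rwa [map_sub, sub_eq_zero] at h1

/-- A subcomplex of a complex of vector spaces is a direct summand if its cohomology injects into
that of the complex. -/
theorem exists_chain_retraction {Q : S →ₗ[k] S} {d : V →ₗ[k] V} {i : V →ₗ[k] S} {p : S →ₗ[k] V}
    (hp : ∀ v, p (i v) = v) (hi : ∀ v, Q (i v) = i (d v)) (hQ : ∀ x, Q (Q x) = 0)
    (hd : ∀ v, d (d v) = 0) (hC : ∀ x v, Q x = i v → v ∈ LinearMap.range d) :
    ∃ r : S →ₗ[k] V, (∀ v, r (i v) = v) ∧ ∀ x, r (Q x) = d (r x) := by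
  obtain ⟨s, hs⟩ := d.exists_generalizedInverse
  -- the projection of `V` onto representatives of its cohomology
  let π : V →ₗ[k] LinearMap.ker d :=
    (LinearMap.id - d ∘ₗ s - s ∘ₗ d).codRestrict _ (fun v => by simp [hd, hs])
  have hπ : ∀ v, (π v : V) = v - d (s v) - s (d v) := fun v => rfl
  have hπd : ∀ v, π (d v) = 0 := fun v => by
    apply Subtype.ext
    rw [hπ]
    simp [hd, hs]
  obtain ⟨φ, hφ⟩ := LinearMap.exists_factor (f := (LinearMap.range Q).mkQ ∘ₗ i) (g := π) (by
    intro v hv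
    rw [LinearMap.comp_apply, Submodule.mkQ_apply, Submodule.Quotient.mk_eq_zero] at hv
    obtain ⟨x, hx⟩ := hv
    obtain ⟨w, rfl⟩ := hC x v hx
    exact hπd w)
  refine ⟨d ∘ₗ s ∘ₗ p + s ∘ₗ p ∘ₗ Q +
    (LinearMap.ker d).subtype ∘ₗ φ ∘ₗ (LinearMap.range Q).mkQ, fun v => ?_, fun x => ?_⟩
  · have h := hφ v
    rw [LinearMap.comp_apply] at h
    simp only [LinearMap.add_apply, LinearMap.comp_apply, h, Submodule.subtype_apply, hπ, hp, hi]
    abel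
  · have h : (LinearMap.range Q).mkQ (Q x) = 0 := by simp
    have h' : d (φ ((LinearMap.range Q).mkQ x) : V) = 0 :=
      LinearMap.mem_ker.mp (φ ((LinearMap.range Q).mkQ x)).2
    simp only [LinearMap.add_apply, LinearMap.comp_apply, map_add, h, map_zero,
      Submodule.subtype_apply, h', hQ, hd]
    simp

end linearAlgebra

namespace LInfAlg

open SSym

variable {k : Type u} [Field k] [Algebra ℚ k] {g : LInfAlg.{u, v} k}

/-! ### Homotopy abelian `L∞`-algebras over a field -/

/-- If `H(V) → H(Sym V)` is injective, the complex `V` is a direct summand of `Sym V`, by a parity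
preserving projection. -/
theorem InjectiveUnit.exists_retraction (hg : g.InjectiveUnit) : ∃ r : g.S →ₗ[k] g.V,
    (∀ v, r (ι k g.even g.odd v) = v) ∧ (∀ x, r (g.Q x) = g.diff (r x)) ∧
    (∀ x, r (parity k g.even g.odd x) = inv k g.even g.odd (r x)) ∧ r 1 = 0 := by
  obtain ⟨r, hr, hQ⟩ := exists_chain_retraction (p := proj k g.even g.odd) proj_ι g.Q_ι g.Q_Q
    g.diff_diff hg
  -- remove the value at `1`
  let r₁ : g.S →ₗ[k] g.V := r - (LinearMap.toSpanSingleton k g.V (r 1)) ∘ₗ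
    (counit k g.even g.odd).toLinearMap
  have e₁ : ∀ x, r₁ x = r x - counit k g.even g.odd x • r 1 := fun x => rfl
  have h1 : g.diff (r 1) = 0 := by rw [← hQ, g.Q_one, map_zero]
  -- average over the parity involution
  let c : k := algebraMap ℚ k (((1 : ℕ) + 1 : ℚ)⁻¹)
  have hc : ∀ v : g.V, c • (v + v) = v := fun v => by
    rw [← two_nsmul]
    exact (eq_inv_smul_of_succ_nsmul_eq (R := k) rfl).symm
  let r₂ : g.S →ₗ[k] g.V :=
    c • (r₁ + inv k g.even g.odd ∘ₗ r₁ ∘ₗ (parity k g.even g.odd).toLinearMap)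
  have e₂ : ∀ x, r₂ x = c • (r₁ x + inv k g.even g.odd (r₁ (parity k g.even g.odd x))) :=
    fun x => rfl
  refine ⟨r₂, fun v => ?_, fun x => ?_, fun x => ?_, ?_⟩
  · rw [e₂, e₁, e₁, counit_parity, counit_ι, zero_smul, sub_zero, sub_zero, parity_ι, hr, hr,
      inv_apply, neg_neg]
    exact hc v
  · have hi := g.diff_inv (r (parity k g.even g.odd x))
    have hi' := g.diff_inv (r 1)
    rw [h1, map_zero, neg_zero] at hi'
    have hP : r (parity k g.even g.odd (g.Q x)) = -g.diff (r (parity k g.even g.odd x)) := by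
      rw [← hQ, g.Q_parity, map_neg, neg_neg]
    rw [e₂, e₂, e₁, e₁, e₁, e₁, counit_parity, g.counit_Q, zero_smul, sub_zero, sub_zero, hP, hQ,
      map_smul, map_add, map_sub, map_sub (inv k g.even g.odd), map_sub g.diff, hi, map_neg,
      map_smul, map_smul, map_smul, h1, hi', smul_zero, sub_zero, smul_zero, sub_zero]
  · rw [e₂, e₂, parity_parity, map_smul, map_add, inv_inv_apply, add_comm]
  · rw [e₂, map_one (parity k g.even g.odd), e₁, map_one (counit k g.even g.odd), one_smul,
      sub_self, map_zero, add_zero, smul_zero]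

/-- The retraction extends, by cofreeness, to an `L∞`-morphism onto the linear part. -/
theorem InjectiveUnit.exists_hom (hg : g.InjectiveUnit) :
    ∃ f : Hom g g.linearPart.toLInfAlg, ∀ v, f.linear v = v := by
  obtain ⟨r, hr, hQ, hP, h1⟩ := hg.exists_retraction
  have hcomul := comul_coalgLift hP h1
  have hproj := proj_coalgLift h1
  have hQ' : coalgLift r ∘ₗ g.Q - g.linQ ∘ₗ coalgLift r = 0 := by
    refine eq_zero_of_proj (A := coalgLift r)
      (B := coalgLift r ∘ₗ (parity k g.even g.odd).toLinearMap) (fun x => ?_) (fun x => ?_)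
      (fun x => ?_)
    · rw [LinearMap.sub_apply, map_sub, LinearMap.comp_apply, LinearMap.comp_apply, linQ_comul,
        hcomul, hcomul, g.Q_comul]
      induction comul k g.even g.odd x with
      | zero => simp
      | add x y hx hy =>
        simp only [map_add] at hx hy ⊢
        rw [← sub_eq_zero] at hx hy ⊢
        apply DGLie.eq_zero_of_add hx hy
        abel
      | tmul x y =>
        simp only [TensorProduct.map_tmul, map_add, LinearMap.sub_apply, TensorProduct.sub_tmul,
          TensorProduct.tmul_sub, LinearMap.comp_apply, LinearMap.id_apply,
          AlgHom.toLinearMap_apply, coalgLift_parity hP]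
        abel
    · rw [LinearMap.sub_apply, map_sub, LinearMap.comp_apply, LinearMap.comp_apply,
        counit_coalgLift, g.counit_Q, counit_linQ, sub_zero]
    · rw [LinearMap.sub_apply, map_sub, LinearMap.comp_apply, LinearMap.comp_apply, hproj,
        proj_linQ, hproj, hQ, sub_self]
  refine ⟨⟨coalgLift r, coalgLift_parity hP, hcomul, counit_coalgLift, coalgLift_one h1,
    fun x => sub_eq_zero.mp (LinearMap.congr_fun hQ' x)⟩, fun v => ?_⟩
  exact (hproj _).trans (hr v)

theorem linearPart_diff (g : LInfAlg.{u, v} k) (v : g.V) :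
    g.linearPart.toLInfAlg.diff v = g.diff v := by
  rw [DGLie.toLInfAlg_diff]
  rfl

theorem Hom.isQuasiIso_of_linear_eq (f : Hom g g.linearPart.toLInfAlg)
    (hf : ∀ v, f.linear v = v) : f.IsQuasiIso := by
  constructor
  · rw [injective_iff_map_eq_zero]
    intro c hc
    obtain ⟨⟨v, hv⟩, rfl⟩ := Submodule.Quotient.mk_surjective _ c
    obtain ⟨w, hw⟩ := (Submodule.Quotient.mk_eq_zero
      ((LinearMap.range g.linearPart.toLInfAlg.diff).submoduleOf
        (LinearMap.ker g.linearPart.toLInfAlg.diff))).mp hc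
    exact (Submodule.Quotient.mk_eq_zero
      ((LinearMap.range g.diff).submoduleOf (LinearMap.ker g.diff))).mpr
      ⟨w, (linearPart_diff g w).symm.trans (hw.trans (hf v))⟩
  · intro c
    obtain ⟨⟨v, hv⟩, rfl⟩ := Submodule.Quotient.mk_surjective _ c
    exact ⟨Submodule.Quotient.mk ⟨v, (linearPart_diff g v).symm.trans hv⟩,
      congrArg Submodule.Quotient.mk (Subtype.ext (hf v))⟩

theorem InjectiveUnit.isHomotopyAbelian (hg : g.InjectiveUnit) : g.IsHomotopyAbelian := by
  obtain ⟨f, hf⟩ := hg.exists_hom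
  exact ⟨g.linearPart, g.linearPart_isAbelian, .rel _ _ ⟨f, f.isQuasiIso_of_linear_eq hf⟩⟩

theorem _root_.SSym.map_eq_self {R : Type u} [CommRing R] [Algebra ℚ R]
    {V₀ V₁ : Type v} [AddCommGroup V₀] [Module R V₀] [AddCommGroup V₁] [Module R V₁]
    {f : V₀ × V₁ →ₗ[R] V₀ × V₁} (h : ∀ v, f (inv R V₀ V₁ v) = inv R V₀ V₁ (f v))
    (hf : ∀ v, f v = v) (x : SSym R V₀ V₁) : SSym.map f h x = x := by
  have e : SSym.map f h = AlgHom.id R _ := by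
    apply algHom_ext
    intro v
    rw [map_ι, hf, AlgHom.id_apply]
  exact DFunLike.congr_fun e x

/-- The morphism to the linear part is an isomorphism of filtered spaces and the identity on leading
terms, and for the linear part itself there is nothing to lift. -/
theorem InjectiveUnit.liftsCocycles (hg : g.InjectiveUnit) : g.LiftsCocycles := by
  obtain ⟨f, hf⟩ := hg.exists_hom
  let F : g.S →ₗ[k] g.S := f.F
  have hF1 : F 1 = 1 := f.F_one
  have hFQ : ∀ x, F (g.Q x) = g.linQ (F x) := f.F_Q
  have hF : ∀ {n m}, n ≤ m → ∀ x ∈ filt k g.even g.odd n,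
      comp k g.even g.odd m (F x) = comp k g.even g.odd m x := fun hnm x hx =>
    (f.comp_F hnm hx).trans (map_eq_self _ hf _)
  have hsurj : ∀ n, ∀ ξ ∈ filt k g.even g.odd n, ∃ ω ∈ filt k g.even g.odd n,
      comp k g.even g.odd n ω = comp k g.even g.odd n ξ ∧ F ω = ξ := by
    intro n
    induction n with
    | zero =>
      intro ξ hξ
      refine ⟨ξ, hξ, rfl, ?_⟩
      have e := sum_comp hξ
      rw [zero_add, Finset.sum_range_one, comp_zero] at e
      rw [← e, map_smul, hF1]
    | succ n ih =>
      intro ξ hξ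
      have h1 : ξ - F ξ ∈ filt k g.even g.odd (n + 1) :=
        sub_mem hξ fun m hm => (hF hm.le ξ hξ).trans (hξ m hm)
      have h2 : ξ - F ξ ∈ filt k g.even g.odd n := by
        refine mem_filt_of_succ h1 ?_
        rw [map_sub, hF le_rfl ξ hξ, sub_self]
      obtain ⟨ω, hω, _, hFω⟩ := ih _ h2
      refine ⟨ξ + ω, add_mem hξ (filt_mono n.le_succ hω), ?_, ?_⟩
      · rw [map_add, hω (n + 1) n.lt_succ_self, add_zero]
      · rw [map_add, hFω]
        abel
  have hinj : ∀ x, F x = 0 → x = 0 := by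
    intro x hx
    obtain ⟨n, hn⟩ := exists_mem_filt x
    induction n with
    | zero =>
      have e := sum_comp hn
      rw [zero_add, Finset.sum_range_one, ← hF le_rfl x hn, hx, map_zero] at e
      exact e.symm
    | succ n ih =>
      apply ih
      apply mem_filt_of_succ hn
      rw [← hF le_rfl x hn, hx, map_zero]
  intro n ξ hξ h0
  obtain ⟨ω, hω, hc, hFω⟩ := hsurj n ξ (words_le_filt n hξ)
  refine ⟨ω, hω, hc.trans (comp_self hξ), hinj _ ?_⟩
  rw [hFQ, hFω, h0]

/-- For an abelian dg Lie algebra the projection `Sym V → V` is a chain map. -/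
theorem _root_.DGLie.IsAbelian.injectiveUnit {R : Type u} [CommRing R] {L : DGLie.{u, v} R}
    [Algebra ℚ R] (hL : L.IsAbelian) : L.toLInfAlg.InjectiveUnit := by
  intro x v hx
  have h := (L.proj_ce hL x).symm.trans (congrArg (proj R L.odd L.even) hx)
  rw [DGLie.toLInfAlg_diff]
  exact ⟨_, h.trans (proj_ι v)⟩

end LInfAlg

/-! ### The Künneth theorem for symmetric powers -/

namespace SSym

/-- Euler's formula on words of length `n`. -/
theorem projMul_comul_of_mem_words {R : Type u} [CommRing R]
    {V₀ V₁ : Type v} [AddCommGroup V₀] [Module R V₀] [AddCommGroup V₁] [Module R V₁]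
    {n : ℕ} {x : SSym R V₀ V₁} (hx : x ∈ words R V₀ V₁ n) :
    projMul R V₀ V₁ (comul R V₀ V₁ x) = n • x := by
  rw [← sub_eq_zero]
  refine eq_zero_of_comp fun m => ?_
  have h : comp R V₀ V₁ m (projMul R V₀ V₁ (comul R V₀ V₁ x)) = m • comp R V₀ V₁ m x :=
    coeff_weight_euler x m
  rw [map_sub, h, map_nsmul, comp_of_mem hx]
  split_ifs with e
  · rw [e, sub_self]
  · simp

end SSym

namespace LInfAlg

open SSym

section homotopy

variable {R : Type u} [CommRing R] [Algebra ℚ R] (g : LInfAlg.{u, v} R) (p s : g.V →ₗ[R] g.V)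

/-- The homotopy on `Symⁿ V` which is induced by a homotopy `s` between the identity and an
endomorphism `p` of the complex `V`: the symmetrization of `s ⊗ 1 ⊗ ⋯ ⊗ 1 + p ⊗ s ⊗ 1 ⊗ ⋯ ⊗ 1 + ⋯`. -/
def symHomotopy : ℕ → g.S →ₗ[R] g.S
  | 0 => 0
  | n + 1 => algebraMap ℚ R ((n + 1 : ℚ)⁻¹) •
      (mulMap (s ∘ₗ proj R g.even g.odd) LinearMap.id +
        mulMap (p ∘ₗ inv R g.even g.odd ∘ₗ proj R g.even g.odd) (symHomotopy n)) ∘ₗ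
        comul R g.even g.odd

theorem symHomotopy_succ (n : ℕ) (x : g.S) : (n + 1) • g.symHomotopy p s (n + 1) x =
    mulMap (s ∘ₗ proj R g.even g.odd) LinearMap.id (comul R g.even g.odd x) +
      mulMap (p ∘ₗ inv R g.even g.odd ∘ₗ proj R g.even g.odd) (g.symHomotopy p s n)
        (comul R g.even g.odd x) :=
  succ_nsmul_inv_smul (R := R) n _

variable {p s}

/-- If `s` is a homotopy between `p` and the identity of `V`, then `symHomotopy p s n` is one between
`Sym(p)` and the identity of `Symⁿ V`. -/
theorem symHomotopy_spec (hp : ∀ v, p (inv R g.even g.odd v) = inv R g.even g.odd (p v))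
    (hs : ∀ v, s (inv R g.even g.odd v) = -inv R g.even g.odd (s v))
    (hdp : ∀ v, g.diff (p v) = 0) (hpd : ∀ v, p (g.diff v) = 0)
    (hds : ∀ v, g.diff (s v) + s (g.diff v) = v - p v) {n : ℕ} {x : g.S}
    (hx : x ∈ words R g.even g.odd n) :
    g.linQ (g.symHomotopy p s n x) + g.symHomotopy p s n (g.linQ x) =
      x - SSym.map p hp x := by
  induction n generalizing x with
  | zero =>
    refine words_zero_induction (fun r => ?_) hx
    rw [map_smul (SSym.map p hp), map_one]
    simp [symHomotopy]
  | succ n ih =>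
    apply succ_nsmul_cancel R (n := n)
    -- the operator which vanishes on words of length `n` by the induction hypothesis
    let B : g.S →ₗ[R] g.S := g.linQ ∘ₗ g.symHomotopy p s n + g.symHomotopy p s n ∘ₗ g.linQ -
      (LinearMap.id - (SSym.map p hp).toLinearMap)
    have hB : ∀ y, B y = g.linQ (g.symHomotopy p s n y) + g.symHomotopy p s n (g.linQ y) -
      (y - SSym.map p hp y) := fun y => rfl
    have h0 : mulMap (p ∘ₗ proj R g.even g.odd) B (comul R g.even g.odd x) = 0 := by
      rw [mulMap, LinearMap.comp_apply, map_comul_eq_zero _ hx, map_zero]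
      intro i j hij
      by_cases hi : i = 1
      · right
        intro y hy
        obtain rfl : j = n := by omega
        rw [hB, ih hy, sub_self]
      · left
        intro y hy
        simp [proj_of_mem_words hi hy]
    have h1 : (n + 1) • (x - SSym.map p hp x) =
        projMul R g.even g.odd (comul R g.even g.odd x) -
          SSym.map p hp (projMul R g.even g.odd (comul R g.even g.odd x)) := by
      rw [projMul_comul_of_mem_words hx, map_nsmul, smul_sub]
    rw [h1, smul_add, ← map_nsmul g.linQ, symHomotopy_succ, symHomotopy_succ, linQ_comul,
      ← sub_zero (_ + _), ← h0]
    generalize comul R g.even g.odd x = t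
    rw [← sub_eq_zero]
    induction t with
    | zero => simp
    | add x y hx hy =>
      simp only [map_add] at hx hy ⊢
      apply DGLie.eq_zero_of_add hx hy
      abel
    | tmul x y =>
      have e1 : p (inv R g.even g.odd (g.diff (proj R g.even g.odd x))) = 0 := by
        rw [hp, hpd, map_zero]
      have e2 : ∀ v, ι R g.even g.odd (s (g.diff v)) =
          ι R g.even g.odd v - ι R g.even g.odd (p v) - ι R g.even g.odd (g.diff (s v)) := by
        intro v
        rw [← map_sub, ← map_sub, ← hds, add_sub_cancel_left]
      simp only [map_add, TensorProduct.map_tmul, mulMap_tmul, LinearMap.comp_apply, projMul,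
        linQ_ι_mul, LinearMap.id_apply, AlgHom.toLinearMap_apply, proj_parity, proj_linQ,
        LinearMap.mul'_apply, map_mul, map_ι, hB, hp, inv_inv_apply, hs, g.diff_inv, hdp, hpd,
        map_zero, map_neg, neg_zero, zero_mul, e2, mul_add, mul_sub, sub_mul, neg_mul, zero_add]
      abel

end homotopy

section field

variable {k : Type u} [Field k] [Algebra ℚ k] (g : LInfAlg.{u, v} k)

/-- A complex of vector spaces is homotopy equivalent to any space of cocycles which represents
its cohomology, in the sense that the identity is homotopic to a map into this space. -/
theorem exists_homotopy {Z : Submodule k g.V}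
    (hZinv : ∀ z ∈ Z, inv k g.even g.odd z ∈ Z) (hZ : ∀ z ∈ Z, g.diff z = 0)
    (hker : ∀ v, g.diff v = 0 → ∃ z ∈ Z, ∃ w, v = z + g.diff w) :
    ∃ p s : g.V →ₗ[k] g.V, (∀ v, p (inv k g.even g.odd v) = inv k g.even g.odd (p v)) ∧
      (∀ v, s (inv k g.even g.odd v) = -inv k g.even g.odd (s v)) ∧ (∀ v, p v ∈ Z) ∧
      (∀ v, p (g.diff v) = 0) ∧ ∀ v, g.diff (s v) + s (g.diff v) = v - p v := by
  have hd := g.diff_diff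
  obtain ⟨s, hs⟩ := g.diff.exists_generalizedInverse
  let π : g.V →ₗ[k] LinearMap.ker g.diff :=
    (LinearMap.id - g.diff ∘ₗ s - s ∘ₗ g.diff).codRestrict _ (fun v => by simp [hd, hs])
  have hπ : ∀ v, (π v : g.V) = v - g.diff (s v) - s (g.diff v) := fun v => rfl
  have hπd : ∀ v, π (g.diff v) = 0 := fun v => by
    apply Subtype.ext
    rw [hπ]
    simp [hd, hs]
  let q : Z × g.V →ₗ[k] LinearMap.ker g.diff :=
    (Z.subtype.coprod g.diff).codRestrict _ (fun v => by simp [hd, hZ])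
  obtain ⟨σ, hσ⟩ := q.exists_rightInverse_of_surjective (by
    rw [LinearMap.range_eq_top]
    rintro ⟨v, hv⟩
    obtain ⟨z, hz, w, hw⟩ := hker v hv
    exact ⟨(⟨z, hz⟩, w), Subtype.ext hw.symm⟩)
  have hσ' : ∀ v, ((σ (π v)).1 : g.V) + g.diff (σ (π v)).2 = v - g.diff (s v) - s (g.diff v) :=
    fun v => (congrArg Subtype.val (LinearMap.congr_fun hσ (π v))).trans (hπ v)
  let p₀ : g.V →ₗ[k] g.V := Z.subtype ∘ₗ LinearMap.fst k _ _ ∘ₗ σ ∘ₗ π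
  let s₀ : g.V →ₗ[k] g.V := s + LinearMap.snd k _ _ ∘ₗ σ ∘ₗ π
  have hp₀Z : ∀ v, p₀ v ∈ Z := fun v => (σ (π v)).1.2
  have hp₀d : ∀ v, p₀ (g.diff v) = 0 := fun v => by simp [p₀, hπd]
  have hs₀ : ∀ v, g.diff (s₀ v) + s₀ (g.diff v) = v - p₀ v := by
    intro v
    have h := hσ' v
    simp only [s₀, p₀, LinearMap.add_apply, LinearMap.comp_apply, LinearMap.snd_apply, map_add,
      hπd, map_zero, add_zero, LinearMap.fst_apply, Submodule.subtype_apply]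
    rw [← eq_sub_iff_add_eq'] at h
    rw [h]
    abel
  -- average over the parity involution
  let c : k := algebraMap ℚ k (((1 : ℕ) + 1 : ℚ)⁻¹)
  have hc : ∀ v : g.V, c • (v + v) = v := fun v => by
    rw [← two_nsmul]
    exact (eq_inv_smul_of_succ_nsmul_eq (R := k) rfl).symm
  let J := inv k g.even g.odd
  have hJJ : ∀ v, J (J v) = v := inv_inv_apply
  have hJd : ∀ v, g.diff (J v) = -J (g.diff v) := g.diff_inv
  refine ⟨c • (p₀ + J ∘ₗ p₀ ∘ₗ J), c • (s₀ - J ∘ₗ s₀ ∘ₗ J), fun v => ?_, fun v => ?_, fun v => ?_,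
    fun v => ?_, fun v => ?_⟩
  · change c • (p₀ (J v) + J (p₀ (J (J v)))) = J (c • (p₀ v + J (p₀ (J v))))
    rw [hJJ, map_smul, map_add, hJJ, add_comm]
  · change c • (s₀ (J v) - J (s₀ (J (J v)))) = -J (c • (s₀ v - J (s₀ (J v))))
    rw [hJJ, map_smul, map_sub, hJJ, ← smul_neg, neg_sub]
  · exact Submodule.smul_mem _ _ (add_mem (hp₀Z v) (hZinv _ (hp₀Z _)))
  · change c • (p₀ (g.diff v) + J (p₀ (J (g.diff v)))) = 0
    have e : J (g.diff v) = g.diff (-J v) := by rw [map_neg, hJd, neg_neg]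
    rw [e, hp₀d, hp₀d, map_zero, add_zero, smul_zero]
  · change g.diff (c • (s₀ v - J (s₀ (J v)))) + c • (s₀ (g.diff v) - J (s₀ (J (g.diff v)))) =
      v - c • (p₀ v + J (p₀ (J v)))
    have e : J (g.diff v) = g.diff (-J v) := by rw [map_neg, hJd, neg_neg]
    have h1 := hs₀ v
    have h2 := congrArg J (hs₀ (J v))
    rw [map_sub, hJJ, map_add] at h2
    have h3 : v - c • (p₀ v + J (p₀ (J v))) = c • (v + v - (p₀ v + J (p₀ (J v)))) := by
      rw [smul_sub, hc]
    rw [map_smul, map_sub, hJd, e, h3, ← smul_add]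
    simp only [map_neg]
    congr 1
    rw [← sub_eq_zero] at h1 h2 ⊢
    apply DGLie.eq_zero_of_add h1 h2
    abel

/-- The Künneth theorem: cocycles of `Symⁿ V` are cohomologous to polynomials in cocycles
of `V`. -/
theorem exists_kunneth {Z : Submodule k g.V}
    (hZinv : ∀ z ∈ Z, inv k g.even g.odd z ∈ Z) (hZ : ∀ z ∈ Z, g.diff z = 0)
    (hker : ∀ v, g.diff v = 0 → ∃ z ∈ Z, ∃ w, v = z + g.diff w) :
    ∃ (p : g.V →ₗ[k] g.V) (hp : ∀ v, p (inv k g.even g.odd v) = inv k g.even g.odd (p v)),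
      (∀ v, p v ∈ Z) ∧ ∀ n, ∀ x ∈ words k g.even g.odd n, g.linQ x = 0 →
        ∃ z, x = SSym.map p hp x + g.linQ z := by
  obtain ⟨p, s, hp, hs, hpZ, hpd, hds⟩ := g.exists_homotopy hZinv hZ hker
  refine ⟨p, hp, hpZ, fun n x hx h0 => ⟨g.symHomotopy p s n x, ?_⟩⟩
  have h := g.symHomotopy_spec hp hs (fun v => hZ _ (hpZ v)) hpd hds hx
  rw [h0, map_zero, add_zero] at h
  rw [h, add_sub_cancel]

variable {g}

/-- `LiftsCocycles` passes to the target of a morphism which is surjective on cohomology. -/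
theorem LiftsCocycles.of_surjective {g₁ : LInfAlg.{u, v} k} (hg : g₁.LiftsCocycles)
    (f : Hom g₁ g) (hf : Function.Surjective f.cohomologyMap) : g.LiftsCocycles := by
  obtain ⟨p, hp, hpZ, hK⟩ := g.exists_kunneth
    (Z := (LinearMap.ker g₁.diff).map f.linear)
    (by
      rintro _ ⟨z, hz, rfl⟩
      refine ⟨inv k g₁.even g₁.odd z, ?_, f.linear_inv z⟩
      change g₁.diff _ = 0
      rw [g₁.diff_inv, LinearMap.mem_ker.mp hz, map_zero, neg_zero])
    (by
      rintro _ ⟨z, hz, rfl⟩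
      rw [← f.linear_diff, LinearMap.mem_ker.mp hz, map_zero])
    (by
      intro v hv
      obtain ⟨c, hc⟩ := hf (Submodule.Quotient.mk ⟨v, hv⟩)
      obtain ⟨⟨z, hz⟩, rfl⟩ := Submodule.Quotient.mk_surjective _ c
      obtain ⟨w, hw⟩ := (Submodule.Quotient.eq
        ((LinearMap.range g.diff).submoduleOf (LinearMap.ker g.diff))).mp hc.symm
      refine ⟨f.linear z, ⟨z, hz, rfl⟩, w, ?_⟩
      have hw' : g.diff w = v - f.linear z := hw
      rw [hw', add_sub_cancel])
  -- polynomials in the images of cocycles are images of polynomials in cocycles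
  have hy : ∀ x : g.S, ∃ y, g₁.linQ y = 0 ∧ SSym.map f.linear f.linear_inv y = SSym.map p hp x := by
    intro x
    induction x using induction_left with
    | one => exact ⟨1, g₁.linQ_one, by rw [map_one, map_one]⟩
    | add x x' hx hx' =>
      obtain ⟨y, hy, e⟩ := hx
      obtain ⟨y', hy', e'⟩ := hx'
      exact ⟨y + y', by rw [map_add, hy, hy', add_zero], by rw [map_add, map_add, e, e']⟩
    | smul r x hx =>
      obtain ⟨y, hy, e⟩ := hx
      exact ⟨r • y, by rw [map_smul, hy, smul_zero], by rw [map_smul, map_smul, e]⟩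
    | mul v x hx =>
      obtain ⟨y, hy, e⟩ := hx
      obtain ⟨z, hz, hzv⟩ := hpZ v
      refine ⟨ι k g₁.even g₁.odd z * y, ?_, ?_⟩
      · rw [linQ_ι_mul, hy, LinearMap.mem_ker.mp hz, map_zero, zero_mul, mul_zero, add_zero]
      · rw [map_mul, map_mul, map_ι, map_ι, e, hzv]
  intro n ξ hξ h0
  obtain ⟨z, hz⟩ := hK n ξ hξ h0
  obtain ⟨y, hy0, hy⟩ := hy ξ
  obtain ⟨ω, hω, hc, hQ⟩ := hg n (comp k g₁.even g₁.odd n y) (comp_mem n y)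
    (by rw [← comp_linQ, hy0, map_zero])
  have hcz := comp_mem n z
  refine ⟨f.F ω + g.Q (comp k g.even g.odd n z),
    add_mem (f.F_mem_filt hω) (g.Q_mem_filt (words_le_filt n hcz)), ?_, ?_⟩
  · have e : comp k g.even g.odd n (SSym.map f.linear f.linear_inv y) =
        SSym.map f.linear f.linear_inv (comp k g₁.even g₁.odd n y) :=
      comp_comm (T := (SSym.map f.linear f.linear_inv).toLinearMap)
        (fun _ _ => map_mem_words _) n y
    rw [map_add, f.comp_F le_rfl hω, hc, g.comp_Q le_rfl (words_le_filt n hcz), comp_self hcz,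
      ← e, ← comp_linQ, ← map_add, hy, ← hz, comp_self hξ]
  · rw [map_add, ← f.F_Q, hQ, map_zero, g.Q_Q, add_zero]

theorem InjectiveUnit.of_surjective {g₁ : LInfAlg.{u, v} k} (hg : g₁.InjectiveUnit)
    (f : Hom g₁ g) (hf : Function.Surjective f.cohomologyMap) : g.InjectiveUnit :=
  (hg.liftsCocycles.of_surjective f hf).injectiveUnit

theorem QuasiIsomorphic.injectiveUnit_iff {g h : LInfAlg.{u, v} k} (H : g.QuasiIsomorphic h) :
    g.InjectiveUnit ↔ h.InjectiveUnit := by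
  induction H with
  | rel a b hab =>
    obtain ⟨f, hf⟩ := hab
    exact ⟨fun h => h.of_surjective f hf.2, fun h => h.of_injective f hf.1⟩
  | refl a => exact Iff.rfl
  | symm a b _ ih => exact ih.symm
  | trans a b c _ _ h₁ h₂ => exact h₁.trans h₂

theorem isHomotopyAbelian_iff : g.IsHomotopyAbelian ↔ g.InjectiveUnit := by
  refine ⟨fun ⟨L, hL, h⟩ => ?_, InjectiveUnit.isHomotopyAbelian⟩
  exact h.injectiveUnit_iff.mpr hL.injectiveUnit

end field

end LInfAlg

/-! ### Flatness of symmetric powers -/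

namespace SSym

section flat

variable {R : Type u} [CommRing R] [Algebra ℚ R]
variable {V₀ V₁ : Type v} [AddCommGroup V₀] [Module R V₀] [AddCommGroup V₁] [Module R V₁]

/-- In characteristic zero `Symⁿ⁺¹ V` is a direct summand of `V ⊗ Symⁿ V`. Hence symmetric powers
of flat modules are flat. -/
theorem flat_words [Module.Flat R (V₀ × V₁)] (n : ℕ) : Module.Flat R (words R V₀ V₁ n) := by
  induction n with
  | zero =>
    refine Module.Flat.of_retract (R := R) (M := R)
      ((counit R V₀ V₁).toLinearMap ∘ₗ (words R V₀ V₁ 0).subtype)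
      (LinearMap.toSpanSingleton R (words R V₀ V₁ 0) ⟨1, one_mem_words⟩) ?_
    ext x
    exact (eq_smul_of_mem_words_zero x.2).symm
  | succ n ih =>
    let c : SSym R V₀ V₁ →ₗ[R] words R V₀ V₁ n :=
      (comp R V₀ V₁ n).codRestrict _ (comp_mem n)
    let i : words R V₀ V₁ (n + 1) →ₗ[R] (V₀ × V₁) ⊗[R] words R V₀ V₁ n :=
      algebraMap ℚ R ((n + 1 : ℚ)⁻¹) • TensorProduct.map (proj R V₀ V₁) c ∘ₗ comul R V₀ V₁ ∘ₗ
        (words R V₀ V₁ (n + 1)).subtype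
    let m : (V₀ × V₁) ⊗[R] words R V₀ V₁ n →ₗ[R] SSym R V₀ V₁ :=
      LinearMap.mul' R _ ∘ₗ TensorProduct.map (ι R V₀ V₁) (words R V₀ V₁ n).subtype
    have hm : ∀ t, m t ∈ words R V₀ V₁ (n + 1) := by
      intro t
      induction t with
      | zero => rw [map_zero]; exact zero_mem _
      | add x y hx hy => rw [map_add]; exact add_mem hx hy
      | tmul v x => exact ι_mul_mem_words v x.2
    refine Module.Flat.of_retract i (m.codRestrict _ hm) ?_
    ext x
    have e : m (TensorProduct.map (proj R V₀ V₁) c (comul R V₀ V₁ x)) =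
        eulerMap R V₀ V₁ n (comul R V₀ V₁ x) := by
      induction comul R V₀ V₁ (x : SSym R V₀ V₁) with
      | zero => simp
      | add x y hx hy => simp only [map_add, hx, hy]
      | tmul x y => simp [m, c]
    change m (algebraMap ℚ R ((n + 1 : ℚ)⁻¹) •
      TensorProduct.map (proj R V₀ V₁) c (comul R V₀ V₁ x)) = x
    rw [map_smul, e, ← succ_nsmul_comp, comp_self x.2]
    exact (eq_inv_smul_of_succ_nsmul_eq rfl).symm

theorem eq_zero_of_smul_eq_zero [IsDomain R] [Module.Flat R (V₀ × V₁)] {t : R} (ht : t ≠ 0)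
    {x : SSym R V₀ V₁} (h : t • x = 0) : x = 0 := by
  refine eq_zero_of_comp fun n => ?_
  have := flat_words (R := R) (V₀ := V₀) (V₁ := V₁) n
  have hr : IsSMulRegular (words R V₀ V₁ n) t :=
    Module.Flat.isSMulRegular_of_isRegular (IsRegular.of_ne_zero ht)
  have e : t • (⟨comp R V₀ V₁ n x, comp_mem n x⟩ : words R V₀ V₁ n) = t • 0 := by
    apply Subtype.ext
    rw [smul_zero]
    change t • comp R V₀ V₁ n x = 0
    rw [← map_smul, h, map_zero]
  exact congrArg Subtype.val (hr e)

end flat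

/-! ### Base change -/

section baseChange

variable {R : Type u} [CommRing R] (A : Type w) [CommRing A] [Algebra R A]
variable {V₀ V₁ : Type v} [AddCommGroup V₀] [Module R V₀] [AddCommGroup V₁] [Module R V₁]

theorem ofBase_ι_mul (v : V₀ × V₁) (x : SSym R V₀ V₁) : ofBase A V₀ V₁ (ι R V₀ V₁ v * x) =
    ι A (A ⊗[R] V₀) (A ⊗[R] V₁) (baseMk A V₀ V₁ v) * ofBase A V₀ V₁ x := by
  rw [map_mul, ofBase_ι]
  rfl

theorem counit_ofBase (x : SSym R V₀ V₁) :
    counit A _ _ (ofBase A V₀ V₁ x) = algebraMap R A (counit R V₀ V₁ x) := by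
  have h : ((counit A _ _).restrictScalars R).comp (ofBase A V₀ V₁) =
      (Algebra.ofId R A).comp (counit R V₀ V₁) := by
    apply algHom_ext
    intro v
    simp
  exact DFunLike.congr_fun h x

theorem proj_ofBase (x : SSym R V₀ V₁) :
    proj A _ _ (ofBase A V₀ V₁ x) = baseMk A V₀ V₁ (proj R V₀ V₁ x) := by
  have h : (proj A _ _).restrictScalars R ∘ₗ (ofBase A V₀ V₁).toLinearMap =
      baseMk A V₀ V₁ ∘ₗ proj R V₀ V₁ := by
    apply linearMap_ext
    · simp
    · intro v x _
      simp only [LinearMap.comp_apply, AlgHom.toLinearMap_apply,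
        LinearMap.restrictScalars_apply]
      rw [ofBase_ι_mul, proj_ι_mul, proj_ι_mul, counit_ofBase, algebraMap_smul, map_smul]
  exact LinearMap.congr_fun h x

theorem comp_ofBase (n : ℕ) (x : SSym R V₀ V₁) :
    comp A _ _ n (ofBase A V₀ V₁ x) = ofBase A V₀ V₁ (comp R V₀ V₁ n x) := by
  induction x using induction_left generalizing n with
  | one =>
    rw [map_one, comp_one, comp_one]
    split_ifs <;> simp
  | add x y hx hy => simp only [map_add, hx, hy]
  | smul r x hx =>
    rw [map_smul, ← algebraMap_smul A r (ofBase A V₀ V₁ x), map_smul, hx, algebraMap_smul,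
      map_smul, map_smul]
  | mul v x hx =>
    rw [ofBase_ι_mul]
    cases n with
    | zero => rw [comp_zero_ι_mul, comp_zero_ι_mul, map_zero]
    | succ n => rw [comp_succ_ι_mul, comp_succ_ι_mul, hx, ofBase_ι_mul]

theorem ofBase_mem_words {n : ℕ} {x : SSym R V₀ V₁} (hx : x ∈ words R V₀ V₁ n) :
    ofBase A V₀ V₁ x ∈ words A _ _ n := by
  rw [← comp_self hx, ← comp_ofBase]
  exact comp_mem n _

end baseChange

end SSym

namespace LInfAlg

open SSym

section baseChange

variable {R : Type u} [CommRing R] (A : Type w) [CommRing A] [Algebra R A]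
variable (g : LInfAlg.{u, v} R)

/-- The differential of the base change, with its type unfolded. -/
def diffBase : (A ⊗[R] g.even) × (A ⊗[R] g.odd) →ₗ[A] (A ⊗[R] g.even) × (A ⊗[R] g.odd) :=
  (g.baseChange A).diff

theorem diffBase_baseMk (v : g.V) :
    g.diffBase A (baseMk (R := R) A g.even g.odd v) = baseMk (R := R) A g.even g.odd (g.diff v) := by
  change proj A _ _ (baseChangeMap A g.even g.odd g.Q (ι A _ _ (baseMk (R := R) A g.even g.odd v))) = _
  have e : ι A _ _ (baseMk (R := R) A g.even g.odd v) = ofBase A g.even g.odd (ι R g.even g.odd v) :=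
    (ofBase_ι A g.even g.odd v).symm
  rw [e, baseChangeMap_ofBase, proj_ofBase]
  rfl

variable [Algebra ℚ R] [Algebra ℚ A]

/-- The linear part of the codifferential of the base change, with its type unfolded. -/
def linQBase : SSym A (A ⊗[R] g.even) (A ⊗[R] g.odd) →ₗ[A]
    SSym A (A ⊗[R] g.even) (A ⊗[R] g.odd) := (g.baseChange A).linQ

theorem linQBase_ofBase (x : g.S) :
    g.linQBase A (ofBase A g.even g.odd x) = ofBase A g.even g.odd (g.linQ x) := by
  have h : (g.linQBase A).restrictScalars R ∘ₗ (ofBase A g.even g.odd).toLinearMap =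
      (ofBase A g.even g.odd).toLinearMap ∘ₗ g.linQ := by
    apply linearMap_ext
    · simp only [LinearMap.comp_apply, AlgHom.toLinearMap_apply, map_one, linQ_one, map_zero]
      exact (g.baseChange A).linQ_one
    · intro v x hx
      simp only [LinearMap.comp_apply, AlgHom.toLinearMap_apply,
        LinearMap.restrictScalars_apply] at hx ⊢
      rw [ofBase_ι_mul, linQ_ι_mul, map_add, ofBase_ι_mul, ofBase_ι_mul, ← hx, ← diffBase_baseMk]
      have e : baseMk (R := R) A g.even g.odd (inv R g.even g.odd v) =
          inv A _ _ (baseMk (R := R) A g.even g.odd v) := by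
        simp [baseMk_apply, TensorProduct.tmul_neg]
      rw [e]
      exact (g.baseChange A).linQ_ι_mul (baseMk (R := R) A g.even g.odd v) (ofBase A g.even g.odd x)
  exact LinearMap.congr_fun h x

end baseChange

end LInfAlg

/-! ### The fibres of a family -/

theorem TensorProduct.exists_eq_smul_of_one_tmul_eq_zero {R : Type u} [CommRing R] {t : R}
    {k : Type*} [CommRing k] [Algebra R k] (hsurj : Function.Surjective (algebraMap R k))
    (hker : ∀ r, algebraMap R k r = 0 ↔ t ∣ r) {M : Type*} [AddCommGroup M] [Module R M] {x : M}
    (h : (1 : k) ⊗ₜ[R] x = 0) : ∃ y, x = t • y := by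
  have hex : Function.Exact (LinearMap.lsmul R R t) (Algebra.linearMap R k) := by
    intro r
    rw [Algebra.linearMap_apply, hker]
    exact ⟨fun ⟨s, hs⟩ => ⟨s, hs.symm⟩, fun ⟨s, hs⟩ => ⟨s, hs.symm⟩⟩
  have h' := rTensor_exact M hex hsurj
  obtain ⟨z, hz⟩ := (h' (1 ⊗ₜ[R] x)).mp (by simpa using h)
  refine ⟨TensorProduct.lid R M z, ?_⟩
  have e : ∀ z : R ⊗[R] M, TensorProduct.lid R M ((LinearMap.lsmul R R t).rTensor M z) =
      t • TensorProduct.lid R M z := by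
    intro z
    induction z with
    | zero => simp
    | add a b ha hb => simp only [map_add, ha, hb, smul_add]
    | tmul a b => simp [mul_smul]
  rw [← e, hz, TensorProduct.lid_tmul, one_smul]

theorem TensorProduct.one_tmul_surjective {R : Type u} [CommRing R]
    {k : Type*} [CommRing k] [Algebra R k] (hsurj : Function.Surjective (algebraMap R k))
    {M : Type*} [AddCommGroup M] [Module R M] (z : k ⊗[R] M) : ∃ x : M, (1 : k) ⊗ₜ[R] x = z := by
  induction z with
  | zero => exact ⟨0, TensorProduct.tmul_zero _ _⟩
  | add a b ha hb =>
    obtain ⟨x, rfl⟩ := ha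
    obtain ⟨y, rfl⟩ := hb
    exact ⟨x + y, TensorProduct.tmul_add _ _ _⟩
  | tmul c x =>
    obtain ⟨r, rfl⟩ := hsurj c
    exact ⟨r • x, by rw [TensorProduct.tmul_smul, TensorProduct.smul_tmul', Algebra.algebraMap_eq_smul_one]⟩

namespace SSym

variable {R : Type u} [CommRing R] {t : R}
variable {V₀ V₁ : Type v} [AddCommGroup V₀] [Module R V₀] [AddCommGroup V₁] [Module R V₁]

theorem baseMk_surjective {k : Type w} [CommRing k] [Algebra R k]
    (hsurj : Function.Surjective (algebraMap R k)) (v : (k ⊗[R] V₀) × (k ⊗[R] V₁)) :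
    ∃ x, baseMk k V₀ V₁ x = v := by
  obtain ⟨a, ha⟩ := TensorProduct.one_tmul_surjective hsurj v.1
  obtain ⟨b, hb⟩ := TensorProduct.one_tmul_surjective hsurj v.2
  exact ⟨(a, b), Prod.ext ha hb⟩

theorem exists_eq_smul_of_baseMk_eq_zero {k : Type w} [CommRing k] [Algebra R k]
    (hsurj : Function.Surjective (algebraMap R k)) (hker : ∀ r, algebraMap R k r = 0 ↔ t ∣ r)
    {x : V₀ × V₁} (h : baseMk (R := R) k V₀ V₁ x = 0) : ∃ y, x = t • y := by
  obtain ⟨a, ha⟩ := TensorProduct.exists_eq_smul_of_one_tmul_eq_zero hsurj hker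
    (congrArg Prod.fst h)
  obtain ⟨b, hb⟩ := TensorProduct.exists_eq_smul_of_one_tmul_eq_zero hsurj hker
    (congrArg Prod.snd h)
  exact ⟨(a, b), Prod.ext ha hb⟩

theorem ofBase_surjective {k : Type w} [CommRing k] [Algebra R k]
    (hsurj : Function.Surjective (algebraMap R k)) (y : SSym k (k ⊗[R] V₀) (k ⊗[R] V₁)) :
    ∃ x, ofBase k V₀ V₁ x = y := by
  obtain ⟨x, hx⟩ := TensorProduct.one_tmul_surjective hsurj (fromSSym k V₀ V₁ y)
  refine ⟨x, ?_⟩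
  rw [← toSSym_fromSSym k V₀ V₁ y, ← hx, toSSym_tmul, one_smul]

theorem exists_eq_smul_of_ofBase_eq_zero {k : Type w} [CommRing k] [Algebra R k]
    (hsurj : Function.Surjective (algebraMap R k)) (hker : ∀ r, algebraMap R k r = 0 ↔ t ∣ r)
    {x : SSym R V₀ V₁} (h : ofBase k V₀ V₁ x = 0) : ∃ y, x = t • y :=
  TensorProduct.exists_eq_smul_of_one_tmul_eq_zero hsurj hker
    (by rw [← fromSSym_ofBase, h, map_zero])

theorem ofBase_injective_of_isLocalization [IsDomain R] [Algebra ℚ R]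
    [Module.Flat R (V₀ × V₁)] (ht : t ≠ 0) (K : Type w)
    [CommRing K] [Algebra R K] [IsLocalization (Submonoid.powers t) K] :
    Function.Injective (ofBase (R := R) K V₀ V₁) := by
  rw [injective_iff_map_eq_zero]
  intro x h
  have h1 : TensorProduct.mk R K (SSym R V₀ V₁) 1 x = 0 := by
    rw [TensorProduct.mk_apply, ← fromSSym_ofBase, h, map_zero]
  obtain ⟨⟨_, N, rfl⟩, hc⟩ := (IsLocalizedModule.eq_zero_iff (Submonoid.powers t) _).mp h1
  exact eq_zero_of_smul_eq_zero (pow_ne_zero N ht) hc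

theorem exists_smul_eq_ofBase {t : R} (K : Type w) [CommRing K] [Algebra R K]
    [IsLocalization (Submonoid.powers t) K] (y : SSym K (K ⊗[R] V₀) (K ⊗[R] V₁)) :
    ∃ (N : ℕ) (x : SSym R V₀ V₁), algebraMap R K (t ^ N) • y = ofBase K V₀ V₁ x := by
  obtain ⟨⟨x, ⟨_, N, rfl⟩⟩, hx⟩ := IsLocalizedModule.surj (Submonoid.powers t)
    (TensorProduct.mk R K (SSym R V₀ V₁) 1) (fromSSym K V₀ V₁ y)
  refine ⟨N, x, ?_⟩
  have e : algebraMap R K (t ^ N) • fromSSym K V₀ V₁ y = 1 ⊗ₜ[R] x := by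
    rw [algebraMap_smul]
    exact hx
  rw [← toSSym_fromSSym K V₀ V₁ y, ← map_smul, e, toSSym_tmul, one_smul]

end SSym

namespace LInfAlg

open SSym

section family

variable {R : Type u} [CommRing R] [IsDomain R] [Algebra ℚ R] {t : R} (g : LInfAlg.{u, v} R)

theorem exists_eq_diff_of_smul_eq_diff [Module.Flat R g.V] [Module.Flat R g.cohomology]
    {s : R} (hs : s ≠ 0) {z w : g.V} (h : s • z = g.diff w) : ∃ w', z = g.diff w' := by
  have hz : g.diff z = 0 := by
    refine (Module.Flat.isSMulRegular_of_isRegular (IsRegular.of_ne_zero hs) :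
      IsSMulRegular g.V s) ?_
    change s • g.diff z = s • 0
    rw [← map_smul, h, g.diff_diff, smul_zero]
  let c : g.cohomology := Submodule.Quotient.mk ⟨z, hz⟩
  have hc : c = 0 := by
    refine (Module.Flat.isSMulRegular_of_isRegular (IsRegular.of_ne_zero hs) :
      IsSMulRegular g.cohomology s) ?_
    change s • c = s • 0
    rw [smul_zero]
    exact (Submodule.Quotient.mk_eq_zero
      ((LinearMap.range g.diff).submoduleOf (LinearMap.ker g.diff))).mpr ⟨w, h.symm⟩
  obtain ⟨w', hw'⟩ := (Submodule.Quotient.mk_eq_zero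
    ((LinearMap.range g.diff).submoduleOf (LinearMap.ker g.diff))).mp hc
  exact ⟨w', hw'.symm⟩

/-- If `H(V)` has no torsion, then neither has the cohomology of `Symⁿ V`: by the Künneth theorem
modulo `t`, a cochain whose differential is divisible by `t` agrees modulo `t` and up to exact
cochains with a polynomial in cocycles of `V` over `R`. -/
theorem exists_eq_linQ_of_smul_eq_linQ [Module.Flat R g.V] [Module.Flat R g.cohomology]
    (ht : t ≠ 0) {k : Type w} [Field k] [Algebra ℚ k] [Algebra R k]
    (hsurj : Function.Surjective (algebraMap R k)) (hker : ∀ r, algebraMap R k r = 0 ↔ t ∣ r)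
    {n : ℕ} {x y : g.S} (hx : x ∈ words R g.even g.odd n) (h : t • y = g.linQ x) :
    ∃ z, y = g.linQ z := by
  -- the cocycles of the special fibre which lift to cocycles of the family
  let Z : Submodule k ((k ⊗[R] g.even) × (k ⊗[R] g.odd)) :=
    { carrier := {z | ∃ v, g.diff v = 0 ∧ baseMk k g.even g.odd v = z}
      add_mem' := by
        rintro _ _ ⟨v, hv, rfl⟩ ⟨w, hw, rfl⟩
        exact ⟨v + w, by rw [map_add, hv, hw, add_zero], map_add _ _ _⟩
      zero_mem' := ⟨0, map_zero _, map_zero _⟩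
      smul_mem' := by
        rintro c _ ⟨v, hv, rfl⟩
        obtain ⟨r, rfl⟩ := hsurj c
        exact ⟨r • v, by rw [map_smul, hv, smul_zero], by rw [map_smul, algebraMap_smul]⟩ }
  have hK : ∃ (p : (k ⊗[R] g.even) × (k ⊗[R] g.odd) →ₗ[k] (k ⊗[R] g.even) × (k ⊗[R] g.odd))
      (hp : ∀ v, p (inv k _ _ v) = inv k _ _ (p v)),
      (∀ v, p v ∈ Z) ∧ ∀ n, ∀ x ∈ words k (k ⊗[R] g.even) (k ⊗[R] g.odd) n,
        g.linQBase k x = 0 → ∃ z, x = SSym.map p hp x + g.linQBase k z := by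
    refine (g.baseChange k).exists_kunneth (Z := Z) ?_ ?_ ?_
    · rintro _ ⟨v, hv, rfl⟩
      refine ⟨inv R _ _ v, by rw [g.diff_inv, hv, map_zero, neg_zero], ?_⟩
      simp [baseMk_apply, TensorProduct.tmul_neg]
      rfl
    · rintro _ ⟨v, hv, rfl⟩
      refine (g.diffBase_baseMk k v).trans ?_
      rw [hv, map_zero]
      rfl
    · intro v₀ hv₀
      obtain ⟨v, rfl⟩ := baseMk_surjective (V₀ := g.even) (V₁ := g.odd) hsurj v₀
      have h0 := (g.diffBase_baseMk k v).symm.trans hv₀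
      obtain ⟨w, hw⟩ := exists_eq_smul_of_baseMk_eq_zero hsurj hker h0
      obtain ⟨w', hw'⟩ := g.exists_eq_diff_of_smul_eq_diff ht (z := w) hw.symm
      refine ⟨_, ⟨v - t • w', ?_, rfl⟩, 0, ?_⟩
      · rw [map_sub, map_smul, ← hw', ← hw, sub_self]
      · rw [map_zero, map_sub, map_smul, ← algebraMap_smul k t, (hker t).mpr dvd_rfl, zero_smul,
          sub_zero]
        exact (add_zero _).symm
  obtain ⟨p, hp, hpZ, hK⟩ := hK
  -- a polynomial in liftable cocycles is liftable
  have hlift : ∀ x₀ : SSym k (k ⊗[R] g.even) (k ⊗[R] g.odd), ∃ x : g.S, g.linQ x = 0 ∧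
      ofBase k g.even g.odd x = SSym.map p hp x₀ := by
    intro x₀
    induction x₀ using induction_left with
    | one => exact ⟨1, g.linQ_one, by rw [map_one, map_one]⟩
    | add x x' hx hx' =>
      obtain ⟨y, hy, e⟩ := hx
      obtain ⟨y', hy', e'⟩ := hx'
      exact ⟨y + y', by rw [map_add, hy, hy', add_zero], by rw [map_add, map_add, e, e']⟩
    | smul c x hx =>
      obtain ⟨y, hy, e⟩ := hx
      obtain ⟨r, rfl⟩ := hsurj c
      exact ⟨r • y, by rw [map_smul, hy, smul_zero],
        by rw [map_smul (ofBase k g.even g.odd), e, map_smul, algebraMap_smul]⟩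
    | mul v x hx =>
      obtain ⟨y, hy, e⟩ := hx
      obtain ⟨z, hz, hzv⟩ := hpZ v
      refine ⟨ι R g.even g.odd z * y, ?_, ?_⟩
      · rw [linQ_ι_mul, hy, hz, map_zero, zero_mul, mul_zero, add_zero]
      · rw [ofBase_ι_mul, map_mul, map_ι, e, hzv]
  obtain ⟨z₀, hz₀⟩ := hK n _ (ofBase_mem_words k hx) (by
    rw [linQBase_ofBase, ← h, map_smul, ← algebraMap_smul k t, (hker t).mpr dvd_rfl, zero_smul])
  obtain ⟨x', hx', e'⟩ := hlift (ofBase k g.even g.odd x)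
  obtain ⟨z, rfl⟩ := ofBase_surjective hsurj z₀
  rw [linQBase_ofBase, ← e', ← map_add, ← sub_eq_zero, ← map_sub] at hz₀
  obtain ⟨w, hw⟩ := exists_eq_smul_of_ofBase_eq_zero hsurj hker hz₀
  refine ⟨w, ?_⟩
  rw [← sub_eq_zero]
  refine eq_zero_of_smul_eq_zero ht ?_
  rw [smul_sub, h, ← map_smul, ← hw, map_sub, map_add, hx', linQ_linQ, add_zero, sub_zero, sub_self]

theorem exists_eq_linQ_of_pow_smul_eq_linQ [Module.Flat R g.V] [Module.Flat R g.cohomology]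
    (ht : t ≠ 0) {k : Type w} [Field k] [Algebra ℚ k] [Algebra R k]
    (hsurj : Function.Surjective (algebraMap R k)) (hker : ∀ r, algebraMap R k r = 0 ↔ t ∣ r)
    {n : ℕ} (N : ℕ) {x y : g.S} (hx : x ∈ words R g.even g.odd n)
    (hy : y ∈ words R g.even g.odd n) (h : t ^ N • y = g.linQ x) :
    ∃ z ∈ words R g.even g.odd n, y = g.linQ z := by
  induction N generalizing x with
  | zero => exact ⟨x, hx, by rw [← h, pow_zero, one_smul]⟩
  | succ N ih =>
    obtain ⟨z, hz⟩ := g.exists_eq_linQ_of_smul_eq_linQ ht hsurj hker hx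
      (y := t ^ N • y) (by rw [← h, pow_succ', mul_smul])
    refine ih (comp_mem n z) ?_
    rw [← comp_linQ, ← hz, comp_self (Submodule.smul_mem _ _ hy)]

/-- If the generic fibre is homotopy abelian, then some multiple `tᴺ ξ` of a cocycle `ξ` of
`Symⁿ V` is the leading term of a cocycle for `Q`. -/
theorem exists_pow_smul_lift [Module.Flat R g.V] (ht : t ≠ 0) {K : Type w} [Field K] [Algebra ℚ K]
    [Algebra R K] [IsLocalization (Submonoid.powers t) K] (hK : (g.baseChange K).InjectiveUnit)
    {n : ℕ} {ξ : g.S} (hξ : ξ ∈ words R g.even g.odd n) (h : g.linQ ξ = 0) :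
    ∃ (N : ℕ), ∃ ω ∈ filt R g.even g.odd n, comp R g.even g.odd n ω = t ^ N • ξ ∧ g.Q ω = 0 := by
  have hinj : Function.Injective (ofBase K g.even g.odd) :=
    ofBase_injective_of_isLocalization ht K
  have hL : ∃ ω ∈ filt K (K ⊗[R] g.even) (K ⊗[R] g.odd) n,
      comp K _ _ n ω = ofBase K g.even g.odd ξ ∧ baseChangeMap K g.even g.odd g.Q ω = 0 :=
    hK.liftsCocycles n _ (ofBase_mem_words K hξ)
      ((g.linQBase_ofBase K ξ).trans ((congrArg _ h).trans (map_zero _)))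
  obtain ⟨ω, hω, hc, hQ⟩ := hL
  obtain ⟨N, w, hw⟩ := exists_smul_eq_ofBase (t := t) K ω
  refine ⟨N, w, fun m hm => ?_, ?_, ?_⟩ <;> apply hinj
  · rw [← comp_ofBase, ← hw, map_smul, hω m hm, smul_zero, map_zero]
  · rw [← comp_ofBase, ← hw, map_smul, hc, algebraMap_smul, map_smul]
  · rw [← baseChangeMap_ofBase, ← hw, map_smul, hQ, smul_zero, map_zero]

/-- The words of length at least two can be removed from a relation `Q x = tᴺ (v + t y)`, at the
cost of enlarging `N`: the leading term of `y` is exact since the cohomology of `Symⁿ V` has no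
torsion, and once `y` has been shortened, a multiple of the leading term of `x` is the leading term
of a cocycle. -/
theorem eq_diff_add_smul_of_filt [Module.Flat R g.V] [Module.Flat R g.cohomology] (ht : t ≠ 0)
    {K : Type w} [Field K] [Algebra ℚ K] [Algebra R K] [IsLocalization (Submonoid.powers t) K]
    {k : Type*} [Field k] [Algebra ℚ k] [Algebra R k]
    (hsurj : Function.Surjective (algebraMap R k)) (hker : ∀ r, algebraMap R k r = 0 ↔ t ∣ r)
    (hK : (g.baseChange K).InjectiveUnit) (n N : ℕ) {x y : g.S} {v : g.V}
    (hx : x ∈ filt R g.even g.odd (n + 1)) (hy : y ∈ filt R g.even g.odd (n + 1))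
    (h : t ^ N • (ι R g.even g.odd v + t • y) = g.Q x) : ∃ a b, v = g.diff a + t • b := by
  induction n generalizing N x y with
  | zero =>
    rw [g.diff_proj_of_mem_filt_one hx] at h
    have h' := congrArg (proj R g.even g.odd) h
    rw [map_smul, map_add, map_smul, proj_ι, proj_ι] at h'
    obtain ⟨a, ha⟩ := g.exists_eq_diff_of_smul_eq_diff (pow_ne_zero N ht) h'
    exact ⟨a, -proj R g.even g.odd y, by rw [smul_neg, ← ha, add_neg_cancel_right]⟩
  | succ n ih =>
    have hcx := comp_mem (n + 2) x
    have hcy := comp_mem (n + 2) y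
    have hv : comp R g.even g.odd (n + 2) (ι R g.even g.odd v) = 0 :=
      comp_of_ne (by omega) (ι_mem_words v)
    have hlead : t ^ (N + 1) • comp R g.even g.odd (n + 2) y =
        g.linQ (comp R g.even g.odd (n + 2) x) := by
      rw [← g.comp_Q le_rfl hx, ← h, map_smul, map_add, map_smul, hv, zero_add, pow_succ, mul_smul]
    obtain ⟨z, hz, hyz⟩ := g.exists_eq_linQ_of_pow_smul_eq_linQ ht hsurj hker (N + 1) hcx hcy hlead
    have hzf := words_le_filt _ hz
    have hy' : y - g.Q z ∈ filt R g.even g.odd (n + 1) := by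
      refine mem_filt_of_succ (sub_mem hy (g.Q_mem_filt hzf)) ?_
      rw [map_sub, g.comp_Q le_rfl hzf, comp_self hz, hyz, sub_self]
    have hcoc : g.linQ (comp R g.even g.odd (n + 2) (x - t ^ (N + 1) • z)) = 0 := by
      rw [map_sub, map_smul, comp_self hz, map_sub, map_smul, ← hlead, hyz, sub_self]
    obtain ⟨M, w, hw, hcw, hQw⟩ := g.exists_pow_smul_lift ht hK
      (comp_mem (n + 2) (x - t ^ (N + 1) • z)) hcoc
    refine ih (M + N) (x := t ^ M • (x - t ^ (N + 1) • z) - w) (y := y - g.Q z) ?_ hy' ?_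
    · refine mem_filt_of_succ (sub_mem (Submodule.smul_mem _ _
        (sub_mem hx (Submodule.smul_mem _ _ hzf))) hw) ?_
      rw [map_sub, map_smul, hcw, sub_self]
    · rw [map_sub, hQw, sub_zero, map_smul, map_sub, map_smul, ← h, pow_add, mul_smul, pow_succ,
        mul_smul, ← smul_sub, add_sub_assoc, ← smul_sub]

/-- The criterion passes from the generic fibre `t ≠ 0` to the special fibre `t = 0`: it lifts to
relations `Q x = v + t y` over `R`, to which `eq_diff_add_smul_of_filt` applies with `N = 0`. -/
theorem InjectiveUnit.baseChange_of_isLocalization {g : LInfAlg.{u, v} R} [Module.Flat R g.V]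
    [Module.Flat R g.cohomology] (ht : t ≠ 0)
    {K : Type w} [Field K] [Algebra ℚ K] [Algebra R K] [IsLocalization (Submonoid.powers t) K]
    {k : Type*} [Field k] [Algebra ℚ k] [Algebra R k]
    (hsurj : Function.Surjective (algebraMap R k)) (hker : ∀ r, algebraMap R k r = 0 ↔ t ∣ r)
    (hK : (g.baseChange K).InjectiveUnit) : (g.baseChange k).InjectiveUnit := by
  intro x₀ v₀ h₀
  obtain ⟨x, rfl⟩ := ofBase_surjective (V₀ := g.even) (V₁ := g.odd) hsurj x₀
  obtain ⟨v, rfl⟩ := baseMk_surjective (V₀ := g.even) (V₁ := g.odd) hsurj v₀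
  have h₁ : ofBase k g.even g.odd (g.Q x - ι R g.even g.odd v) = 0 := by
    rw [map_sub, sub_eq_zero, ofBase_ι, ← baseChangeMap_ofBase]
    exact h₀
  obtain ⟨y, hy⟩ := exists_eq_smul_of_ofBase_eq_zero hsurj hker h₁
  obtain ⟨n, hn⟩ := exists_mem_filt x
  obtain ⟨m, hm⟩ := exists_mem_filt y
  obtain ⟨a, b, hab⟩ := g.eq_diff_add_smul_of_filt ht hsurj hker hK (n + m) 0
    (filt_mono (by omega) hn) (filt_mono (by omega) hm) (v := v)
    (by rw [← hy, pow_zero, one_smul, add_sub_cancel])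
  refine ⟨baseMk (R := R) k g.even g.odd a, (g.diffBase_baseMk k a).trans ?_⟩
  rw [hab, map_add, map_smul, ← algebraMap_smul k t, (hker t).mpr dvd_rfl, zero_smul, add_zero]

end family

/-! ### Families over the formal disc -/

theorem specialFibre_isHomotopyAbelian (g : LInfAlg.{0, v} (PowerSeries ℂ))
    [Module.Flat (PowerSeries ℂ) g.V] [Module.Flat (PowerSeries ℂ) g.cohomology]
    (h : g.genericFibre.IsHomotopyAbelian) : g.specialFibre.IsHomotopyAbelian := by
  let : Algebra (PowerSeries ℂ) ℂ := RingHom.toAlgebra PowerSeries.constantCoeff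
  have hK : (g.baseChange (LaurentSeries ℂ)).InjectiveUnit := isHomotopyAbelian_iff.mp h
  have hk : (g.baseChange ℂ).InjectiveUnit :=
    InjectiveUnit.baseChange_of_isLocalization (t := PowerSeries.X) PowerSeries.X_ne_zero
      (fun c => ⟨PowerSeries.C c, PowerSeries.constantCoeff_C c⟩)
      (fun _ => PowerSeries.X_dvd_iff.symm) hK
  exact isHomotopyAbelian_iff.mpr hk

end LInfAlg

namespace DGLie

variable {R : Type u} [CommRing R] (L : DGLie.{u, v} R)

/-- The parity shift from a dg Lie algebra to the super module of its `L∞`-algebra. -/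
def shift : (L.even × L.odd) ≃ₗ[R] L.toLInfAlg.V := LinearEquiv.prodComm R L.even L.odd

theorem toLInfAlg_diff_shift (x : L.even × L.odd) :
    L.toLInfAlg.diff (L.shift x) = L.shift (L.d x) := by
  rw [toLInfAlg_diff]
  rfl

/-- The identification of the cocycles of a dg Lie algebra with those of its `L∞`-algebra. -/
def kerEquiv : LinearMap.ker L.d ≃ₗ[R] LinearMap.ker L.toLInfAlg.diff :=
  L.shift.ofSubmodules _ _ (by
    ext x
    obtain ⟨x, rfl⟩ := L.shift.surjective x
    rw [Submodule.mem_map_equiv, LinearEquiv.symm_apply_apply, LinearMap.mem_ker,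
      LinearMap.mem_ker, toLInfAlg_diff_shift, LinearEquiv.map_eq_zero_iff])

/-- The cohomology of a dg Lie algebra is, up to the parity shift, the cohomology of the associated
`L∞`-algebra. -/
def cohomologyEquiv : L.cohomology ≃ₗ[R] L.toLInfAlg.cohomology :=
  Submodule.Quotient.equiv _ _ L.kerEquiv (by
    ext x
    obtain ⟨x, rfl⟩ := L.kerEquiv.surjective x
    rw [Submodule.mem_map_equiv, LinearEquiv.symm_apply_apply]
    constructor
    · rintro ⟨w, hw⟩
      exact ⟨L.shift w, (L.toLInfAlg_diff_shift w).trans (congrArg _ hw)⟩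
    · rintro ⟨w, hw⟩
      obtain ⟨w, rfl⟩ := L.shift.surjective w
      exact ⟨w, L.shift.injective ((L.toLInfAlg_diff_shift w).symm.trans hw)⟩)

end DGLie

end

theorem mainTheorem9 :
    -- (i) for flat families of `L∞`-algebras
    (∀ g : LInfAlg.{0, v} (PowerSeries ℂ), Module.Flat (PowerSeries ℂ) g.V →
      g.genericFibre.IsHomotopyAbelian → Module.Flat (PowerSeries ℂ) g.cohomology →
      g.specialFibre.IsHomotopyAbelian) ∧
    -- (i) for flat families of dg Lie algebras
    (∀ L : DGLie.{0, v} (PowerSeries ℂ), Module.Flat (PowerSeries ℂ) (L.even × L.odd) →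
      L.genericFibre.IsHomotopyAbelian → Module.Flat (PowerSeries ℂ) L.cohomology →
      L.specialFibre.IsHomotopyAbelian) ∧
    -- (ii)
    (∀ (g₁ g : LInfAlg.{0, v} ℂ) (f : LInfAlg.Hom g₁ g), g.IsHomotopyAbelian →
      Function.Injective f.cohomologyMap → g₁.IsHomotopyAbelian) ∧
    -- (iii)
    (∀ (g g₂ : LInfAlg.{0, v} ℂ) (f : LInfAlg.Hom g g₂), g.IsHomotopyAbelian →
      Function.Surjective f.cohomologyMap → g₂.IsHomotopyAbelian) := by
  refine ⟨fun g _ h _ => g.specialFibre_isHomotopyAbelian h, fun L _ h _ => ?_,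
    fun g₁ g f h hf => ?_, fun g g₂ f h hf => ?_⟩
  · have h' : L.toLInfAlg.genericFibre.IsHomotopyAbelian := by
      rw [LInfAlg.genericFibre, ← DGLie.toLInfAlg_baseChange]
      exact h
    have : Module.Flat (PowerSeries ℂ) L.toLInfAlg.V :=
      Module.Flat.of_linearEquiv L.shift.symm
    have : Module.Flat (PowerSeries ℂ) L.toLInfAlg.cohomology :=
      Module.Flat.of_linearEquiv L.cohomologyEquiv.symm
    have h₀ := L.toLInfAlg.specialFibre_isHomotopyAbelian h'
    rw [LInfAlg.specialFibre, ← DGLie.toLInfAlg_baseChange] at h₀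
    exact h₀
  · rw [LInfAlg.isHomotopyAbelian_iff] at h ⊢
    exact h.of_injective f hf
  · rw [LInfAlg.isHomotopyAbelian_iff] at h ⊢
    exact h.of_surjective f hf
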